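/- **Setting.** Let $\Xi=\{\xi_k\}_{k\in\mathbb Z}$ be a stationary, centered, (circularly symmetric) complex Gaussian process with covariance $\gamma(k-l)=\mathbb E[\xi_k\overline{\xi_l}]$, $\gamma(0)=1$, and let $F$ be its spectral measure, i.e. the probability measure on $(-\pi,\pi]$ with $\gamma(k)=\int_{-\pi}^{\pi}e^{-ikt}F(dt)$. Let $X_\Xi(z)=\sum_{k\ge 0}\xi_kz^k$ for $|z|<1$, and let $\rho_1$ be the first intensity of its zero process $\sum_{|z|<1,\,X_\Xi(z)=0}\delta_z$, i.e. the continuous function on the unit disk with $\mathbb E[\#\{z\in A: X_\Xi(z)=0\}]=\int_A\rho_1\,dm$ for all Borel subsets $A$ of the unit disk, where $m$ is Lebesgue measure. For a function $h$ put $\hat h(s)=\frac{h(s)+h(-s)}2$, $\check h(s)=\frac{h(s)-h(-s)}2$ and $\mathcal I(h)=\frac1{2\pi}\int_{-\pi}^{\pi}h(s)\,ds$. For a symmetric $h$ that is smooth at $0$ put $Th(s)=\frac{h(s)-h(0)}{1-\cos s}$ for $s\ne0$ and $Th(0)=h''(0)$. **Theorem.** Fix $\phi\in\mathbb R$ and let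 $F_\phi(ds)=F(d(s+\phi))$ on $(-\pi,\pi]$ modulo $2\pi$. Suppose that $F_\phi(ds)=f_\phi(s)\,ds$ with a nonnegative density $f_\phi$ that is smooth at $s=0$. Then the first intensity $\rho_1$ exists, all integrals below converge, $\mathcal I(T\hat f_\phi)>0$ in (ii) and (iii), and, as $r\to1^-$: (i) if $f_\phi(0)>0$, then $$\rho_1(re^{i\phi})=\frac1{\pi(1-r^2)^2}-\frac1{4\pi f_\phi(0)^2}\Big\{f_\phi'(0)^2+\mathcal I(T\hat f_\phi)^2\Big\}+O(1-r^2);$$ (ii) if $f_\phi(0)=0$, then $$\rho_1(re^{i\phi})=\frac1{\pi(1-r^2)}\,\frac{f_\phi''(0)}{2\,\mathcal I(T\hat f_\phi)}+O(1);$$ (iii) if $f_\phi(0)=f_\phi''(0)=0$, then $$\rho_1(re^{i\phi})=\frac1\pi\,\frac{\mathcal I(T^2\hat f_\phi)^2-\mathcal I\big(T^2(\hat f_\phi\cos s)\big)^2-\mathcal I\big(T^2(\check f_\phi\sin s)\big)^2}{4\,\mathcal I(T\hat f_\phi)^2}+O(1-r^2).$$ -/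

import Mathlib

open Real Set Filter Topology MeasureTheory ProbabilityTheory Asymptotics
open scoped ContDiff ENNReal ComplexConjugate

noncomputable section

/-- `ξ` is a centered, jointly (circularly symmetric) complex Gaussian family indexed by `ℤ` with
`𝔼[ξ k * conj (ξ l)] = γ (k - l)`; such a family is stationary, and its law is determined by `γ`.
Circular symmetry (`𝔼[ξ k * ξ l] = 0`) is part of the notion of a complex Gaussian process. -/
structure IsStationaryComplexGaussian {Ω : Type*} [MeasurableSpace Ω]
    (ξ : ℤ → Ω → ℂ) (γ : ℤ → ℂ) (P : Measure Ω) : Prop where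
  gaussian : IsGaussianProcess ξ P
  centered : ∀ k, ∫ x, ξ k x ∂P = 0
  circular : ∀ k l, ∫ x, ξ k x * ξ l x ∂P = 0
  covariance : ∀ k l, ∫ x, ξ k x * conj (ξ l x) ∂P = γ (k - l)

/-- `F` is the spectral measure, on `(-π, π]`, of a process with covariance function `γ`
normalized by `γ 0 = 1`. -/
structure IsSpectralMeasure (F : Measure ℝ) (γ : ℤ → ℂ) : Prop where
  isProbabilityMeasure : IsProbabilityMeasure F
  concentrated : F (Ioc (-π) π)ᶜ = 0
  fourier : ∀ k : ℤ, γ k = ∫ t : ℝ, Complex.exp (-(Complex.I * k * t)) ∂F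

/-- The rotated measure `F_φ(ds) = F(d(s + φ))` on `(-π, π]` modulo `2π`: the image of `F` under
`t ↦ t - φ`, reduced modulo `2π` to `(-π, π]`. -/
def rotatedMeasure (F : Measure ℝ) (φ : ℝ) : Measure ℝ :=
  F.map (fun t => toIocMod two_pi_pos (-π) (t - φ))

/-- `f` is a (nonnegative, integrable) Lebesgue density on `(-π, π]` of the measure `G`. -/
structure IsDensityOnCircle (f : ℝ → ℝ) (G : Measure ℝ) : Prop where
  integrable : IntegrableOn f (Ioc (-π) π)
  nonneg : ∀ s ∈ Ioc (-π) π, 0 ≤ f s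
  eq_withDensity :
    G = (volume.restrict (Ioc (-π) π)).withDensity (fun s => ENNReal.ofReal (f s))

/-- The random power series `X(z) = ∑_{k ≥ 0} ξ_k z^k`. -/
def randomSeries {Ω : Type*} (ξ : ℤ → Ω → ℂ) (x : Ω) (z : ℂ) : ℂ :=
  ∑' k : ℕ, ξ (k : ℤ) x * z ^ k

/-- The number of points in `A` of the zero process `∑_{z : |z| < 1, X(z) = 0} δ_z`. -/
def zeroCount {Ω : Type*} (ξ : ℤ → Ω → ℂ) (A : Set ℂ) (x : Ω) : ℝ≥0∞ :=
  ({z ∈ A | ‖z‖ < 1 ∧ randomSeries ξ x z = 0}.encard : ℝ≥0∞)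

/-- `ρ` is the first intensity of the zero process: the continuous density on the unit disk, with
respect to Lebesgue measure, of `A ↦ 𝔼[number of zeros in A]`. Its values on the disk are uniquely
determined by this; its values outside the disk play no role. -/
structure IsFirstIntensity {Ω : Type*} [MeasurableSpace Ω]
    (ξ : ℤ → Ω → ℂ) (P : Measure Ω) (ρ : ℂ → ℝ) : Prop where
  continuousOn : ContinuousOn ρ (Metric.ball 0 1)
  nonneg : ∀ z ∈ Metric.ball (0 : ℂ) 1, 0 ≤ ρ z
  expectation_eq : ∀ A : Set ℂ, MeasurableSet A → A ⊆ Metric.ball 0 1 →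
    ∫⁻ x, zeroCount ξ A x ∂P = ∫⁻ z in A, ENNReal.ofReal (ρ z)

/-- The symmetrization of `h`. -/
def symmPart (h : ℝ → ℝ) (s : ℝ) : ℝ := (h s + h (-s)) / 2

/-- The anti-symmetrization of `h`. -/
def antisymmPart (h : ℝ → ℝ) (s : ℝ) : ℝ := (h s - h (-s)) / 2

/-- The operator `T`. It is only used on `[-π, π]`, where `1 - cos s` vanishes only at `0`. -/
def opT (h : ℝ → ℝ) (s : ℝ) : ℝ :=
  if s = 0 then iteratedDeriv 2 h 0 else (h s - h 0) / (1 - cos s)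

/-- The normalized integral `I(h) = (2π)⁻¹ ∫_{-π}^{π} h(s) ds`. -/
def opI (h : ℝ → ℝ) : ℝ := (1 / (2 * π)) * ∫ s in (-π)..π, h s

end

noncomputable section

/-! ### The area formula for holomorphic functions -/

/-! Existence of the intensity. Write X(z) = Y(z) + ξ_0 G(z) with G(z) = ∑ γ(k) z^k and Y(z) = ∑
(ξ_k - γ(k) ξ_0) z^k. The coefficients of Y are independent of ξ_0 (`indepFun_innovation`), and Re G
≥ 1/2 because G is the F-average of K_z(t) = 1/(1 - z e^{-it}), whose values have real part at least
1/2. So the zeros of X are the points where the holomorphic function h = -Y/G takes the value ξ_0.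
With Y frozen and ξ_0 integrated against its density e^{-|c|²}/π, the area formula
`lintegral_mul_encard_preimage` turns the expected count in A into the integral over A of π⁻¹
e^{-|h|²} |h'|². By Tonelli it remains to average over Y at a fixed z, where h and h' are jointly
complex Gaussian; regressing h' on h gives this average in terms of three covariances
(`integral_exp_neg_norm_sq_mul_norm_sq`). The spectral representation expresses them by N = ∫ |K_z|²
dF, D = ∫ |K_z'|² dF and M = ∫ K_z' conj K_z dF, the prime being the z-derivative, and the result is
ρ = (N D - |M|²) / (π N²), which is `zeroIntensity`. It is continuous on the disk, and
`isFirstIntensity_zeroIntensity` follows once zero counts are known to be measurable.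

On the ray z = r e^{iφ}, put d(s) = |1 - r e^{-is}|² and let J0, J1, J2 be the integrals of the even
part of f against 1/d, (1 - cos s)/d², (1 + cos s)/d², and J3 that of the odd part against sin s/d².
Then πρ = (J1 J2 - J3²)/J0² (`zeroIntensity_ray`). In each J the Taylor part of f that produces a
singularity is split off; its integral has a closed form of Poisson kernel type. What remains is a
weight v, integrable and bounded near 0, against a power of (1 - cos s)/d(s). This quotient is 1/2
up to (1 - r) + (1 - r)²/d(s), and ∫ 1/d = 2π/(1 - r²), so the remainder converges with an error O(1
- r) (`IsTameWeight.linearLimit_integral`).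

If f(0) > 0, the identity (1 - r)² J2 + (1 + r)² J1 = 2 J0 gives J1 J2/J0² = 1/(1 - r²)² - (J0 - (1
+ r)² J1)² / ((1 - r²)² J0²). The singular parts of J0 and (1 + r)² J1 agree, so their difference
converges, while (1 - r²) J0 and (1 - r²) J3 tend to 2π f(0) and π f'(0) (`linearLimit_of_ne_zero`).
If f(0) = 0, then 0 is a minimum and f'(0) = 0; now J0, J1, J3 converge and only J2 is singular,
with (1 - r²) J2 → π f''(0) (`linearLimit_of_eq_zero`). If f''(0) = 0 as well, all four converge
(`linearLimit_of_eq_zero_of_iteratedDeriv_eq_zero`). The denominator limit is positive because f has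
total mass 1 and 1 - cos s ≤ 2. -/

lemma abs_det_restrictScalars_toSpanSingleton (w : ℂ) :
    |((ContinuousLinearMap.toSpanSingleton ℂ w).restrictScalars ℝ).det| = ‖w‖ ^ 2 := by
  simp [ContinuousLinearMap.det, LinearMap.det_restrictScalars, Algebra.norm_complex_eq,
    Complex.normSq_eq_norm_sq]

/-- A differentiable function is injective on each piece of a countable measurable partition of
the set of its noncritical points. -/
lemma exists_partition_injOn {h h' : ℂ → ℂ} {s : Set ℂ}
    (hh : ∀ z ∈ s, HasDerivAt h (h' z) z) (hne : ∀ z ∈ s, h' z ≠ 0) :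
    ∃ t : ℕ → Set ℂ, Pairwise (Function.onFun Disjoint t) ∧ (∀ n, MeasurableSet (t n)) ∧
      s ⊆ (⋃ n, t n) ∧ ∀ n, InjOn h (s ∩ t n) := by
  classical
  obtain ⟨t, L, hd, hm, hs, ha, hL⟩ := exists_partition_approximatesLinearOn_of_hasFDerivWithinAt
    h s (fun z => (ContinuousLinearMap.toSpanSingleton ℂ (h' z)).restrictScalars ℝ)
    (fun z hz => ((hh z hz).hasFDerivAt.restrictScalars ℝ).hasFDerivWithinAt)
    -- Approximation within half the size of the derivative already forces injectivity. The value 1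
    -- is a default for `L 1 = 0`, which does not occur at noncritical points.
    (fun L => if L 1 = 0 then 1 else ‖L 1‖₊ / 2) (by
      intro L
      by_cases hL : L 1 = 0 <;> simp [hL])
  refine ⟨t, hd, hm, hs, fun n x hx y hy hxy => ?_⟩
  obtain ⟨w, hw, hLw⟩ := hL ⟨x, hx.1⟩ n
  have h1 : L n 1 = h' w := by simp [hLw]
  have h2 := ha n x hx y hy
  have h3 : L n 1 ≠ 0 := h1 ▸ hne w hw
  rw [hxy, sub_self, zero_sub, norm_neg, if_neg h3] at h2
  have h4 : ‖L n (x - y)‖ = ‖x - y‖ * ‖h' w‖ := by simp [hLw]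
  rw [h4, h1] at h2
  by_contra hne'
  have h5 : 0 < ‖x - y‖ := norm_pos_iff.2 (sub_ne_zero.2 hne')
  have h6 : 0 < ‖h' w‖ := norm_pos_iff.2 (hne w hw)
  push_cast at h2
  nlinarith [mul_pos h5 h6]

/-- The area formula for a holomorphic function. -/
lemma lintegral_mul_encard_preimage {h : ℂ → ℂ} {U A : Set ℂ} (hU : IsOpen U)
    (hh : DifferentiableOn ℂ h U) (hA : MeasurableSet A) (hAU : A ⊆ U)
    {p : ℂ → ℝ≥0∞} (hp : Measurable p) :
    ∫⁻ c, p c * (({z ∈ A | h z = c}.encard : ℕ∞) : ℝ≥0∞) =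
      ∫⁻ z in A, p (h z) * ‖deriv h z‖ₑ ^ 2 := by
  have hd : ∀ z ∈ A, HasDerivAt h (deriv h z) z := fun z hz =>
    (hh.differentiableAt (hU.mem_nhds (hAU hz))).hasDerivAt
  set C : Set ℂ := A ∩ {z | deriv h z = 0} with hC
  have hCm : MeasurableSet C := hA.inter ((measurable_deriv h) (measurableSet_singleton 0))
  set B : Set ℂ := A \ C with hB
  have hBm : MeasurableSet B := hA.diff hCm
  have hBA : B ⊆ A := sdiff_subset
  have hBne : ∀ z ∈ B, deriv h z ≠ 0 := fun z hz h0 => hz.2 ⟨hz.1, h0⟩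
  obtain ⟨t, htd, htm, hst, htinj⟩ := exists_partition_injOn (fun z hz => hd z (hBA hz)) hBne
  -- Easy case of Sard's theorem: critical values form a null set, so both sides of the formula
  -- ignore the critical points.
  have hCnull : volume (h '' C) = 0 := by
    refine addHaar_image_eq_zero_of_det_fderivWithin_eq_zero volume
      (f' := fun z => (ContinuousLinearMap.toSpanSingleton ℂ (deriv h z)).restrictScalars ℝ)
      (fun z hz => ((hd z hz.1).hasFDerivAt.restrictScalars ℝ).hasFDerivWithinAt) fun z hz => ?_
    rw [← abs_eq_zero, abs_det_restrictScalars_toSpanSingleton]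
    simp [show deriv h z = 0 from hz.2]
  have hFD : ∀ n, ∀ z ∈ B ∩ t n, HasFDerivWithinAt h
      ((ContinuousLinearMap.toSpanSingleton ℂ (deriv h z)).restrictScalars ℝ) (B ∩ t n) z :=
    fun n z hz => ((hd z (hBA hz.1)).hasFDerivAt.restrictScalars ℝ).hasFDerivWithinAt
  have himg : ∀ n, MeasurableSet (h '' (B ∩ t n)) := fun n =>
    measurable_image_of_fderivWithin (hBm.inter (htm n)) (hFD n) (htinj n)
  have hcount : ∀ c, c ∉ h '' C → (({z ∈ A | h z = c}.encard : ℕ∞) : ℝ≥0∞) =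
      ∑' n, (h '' (B ∩ t n)).indicator 1 c := by
    intro c hc
    have hsub : ∀ n, {z ∈ B ∩ t n | h z = c}.Subsingleton := fun n x hx y hy =>
      htinj n hx.1 hy.1 (hx.2.trans hy.2.symm)
    have hset : {z ∈ A | h z = c} = ⋃ n, {z ∈ B ∩ t n | h z = c} := by
      ext z
      simp only [mem_ofPred_eq, mem_iUnion]
      constructor
      · rintro ⟨hz, hzc⟩
        have hzB : z ∈ B := ⟨hz, fun hzC => hc ⟨z, hzC, hzc⟩⟩
        obtain ⟨n, hn⟩ := mem_iUnion.1 (hst hzB)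
        exact ⟨n, ⟨hzB, hn⟩, hzc⟩
      · rintro ⟨n, hz, hzc⟩
        exact ⟨hBA hz.1, hzc⟩
    have hm : ∀ n, MeasurableSet {z ∈ B ∩ t n | h z = c} := fun n => (hsub n).measurableSet
    rw [← Measure.count_apply (hset ▸ MeasurableSet.iUnion hm), hset, measure_iUnion _ hm]
    · refine tsum_congr fun n => ?_
      rw [Measure.count_apply (hm n)]
      by_cases hcn : c ∈ h '' (B ∩ t n)
      · obtain ⟨z, hz, rfl⟩ := hcn
        have : {w ∈ B ∩ t n | h w = h z} = {z} :=
          (hsub n).eq_singleton_of_mem ⟨hz, rfl⟩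
        rw [this, indicator_of_mem (mem_image_of_mem h hz)]
        simp
      · have : {w ∈ B ∩ t n | h w = c} = ∅ :=
          eq_empty_of_forall_notMem fun w hw => hcn ⟨w, hw.1, hw.2⟩
        rw [this, indicator_of_notMem hcn]
        simp
    · exact fun i j hij => (htd hij).mono (fun z hz => hz.1.2) (fun z hz => hz.1.2)
  have hae : ∀ᵐ c : ℂ, p c * (({z ∈ A | h z = c}.encard : ℕ∞) : ℝ≥0∞) =
      ∑' n, (h '' (B ∩ t n)).indicator p c := by
    filter_upwards [measure_eq_zero_iff_ae_notMem.1 hCnull] with c hc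
    rw [hcount c hc, ← ENNReal.tsum_mul_left]
    refine tsum_congr fun n => ?_
    by_cases hcn : c ∈ h '' (B ∩ t n) <;> simp [hcn]
  have hCint : ∫⁻ z in C, p (h z) * ‖deriv h z‖ₑ ^ 2 = 0 := by
    rw [setLIntegral_congr_fun hCm (g := fun _ => 0) fun z hz => by
      simp [show deriv h z = 0 from hz.2]]
    simp
  have hBU : B = ⋃ n, B ∩ t n := by rw [← inter_iUnion, inter_eq_left.2 hst]
  have hsplit : ∫⁻ z in A, p (h z) * ‖deriv h z‖ₑ ^ 2 =
      ∫⁻ z in B, p (h z) * ‖deriv h z‖ₑ ^ 2 := by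
    rw [← lintegral_inter_add_sdiff _ A hCm,
      inter_eq_right.2 (show C ⊆ A from inter_subset_left), hCint, zero_add]
  rw [lintegral_congr_ae hae, lintegral_tsum fun n => (hp.indicator (himg n)).aemeasurable, hsplit]
  conv_rhs => rw [hBU]
  rw [lintegral_iUnion (fun n => hBm.inter (htm n))
    fun i j hij => (htd hij).mono inter_subset_right inter_subset_right]
  refine tsum_congr fun n => ?_
  rw [lintegral_indicator (himg n), lintegral_image_eq_lintegral_abs_det_fderiv_mul volume
    (hBm.inter (htm n)) (hFD n) (htinj n)]
  refine lintegral_congr fun z => ?_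
  rw [abs_det_restrictScalars_toSpanSingleton, mul_comm, ENNReal.ofReal_pow (norm_nonneg _),
    ofReal_norm]

/-! ### Measurability of the number of zeros -/

section Measurability

variable {α : Type*} [MeasurableSpace α] {Φ : α → ℂ → ℂ} {K : Set ℂ}

/-- The event that a random continuous function has a zero in a compact set is measurable. -/
lemma measurableSet_exists_zero (hK : IsCompact K) (hΦ : ∀ z ∈ K, Measurable fun x => Φ x z)
    (hc : ∀ x, ContinuousOn (Φ x) K) : MeasurableSet {x | ∃ z ∈ K, Φ x z = 0} := by
  obtain ⟨D, hDK, hDc, hD⟩ :=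
    (TopologicalSpace.IsSeparable.of_separableSpace K).exists_countable_dense_subset
  have heq : {x | ∃ z ∈ K, Φ x z = 0} = ⋂ n : ℕ, ⋃ q ∈ D, {x | ‖Φ x q‖ < 1 / ((n : ℝ) + 1)} := by
    ext x
    simp only [mem_ofPred_eq, mem_iInter, mem_iUnion, exists_prop]
    constructor
    · rintro ⟨z, hz, hz0⟩ n
      have hcz : ContinuousWithinAt (Φ x) D z := (hc x z hz).mono hDK
      have hpos : (0 : ℝ) < 1 / ((n : ℝ) + 1) := by positivity
      have hev : ∀ᶠ q in 𝓝[D] z, ‖Φ x q‖ < 1 / ((n : ℝ) + 1) := by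
        refine hcz.norm.eventually (gt_mem_nhds ?_)
        simpa [hz0] using hpos
      have : (𝓝[D] z).NeBot := mem_closure_iff_nhdsWithin_neBot.1 (hD hz)
      obtain ⟨q, hq, hqD⟩ := (hev.and self_mem_nhdsWithin).exists
      exact ⟨q, hqD, hq⟩
    · intro hx
      choose q hqD hq using hx
      obtain ⟨z, hz, φ, hφ, hlim⟩ := hK.tendsto_subseq fun n => hDK (hqD n)
      refine ⟨z, hz, ?_⟩
      have h1 : Tendsto (fun n => Φ x (q (φ n))) atTop (𝓝 (Φ x z)) :=
        (hc x z hz).tendsto.comp (tendsto_nhdsWithin_iff.2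
          ⟨hlim, Eventually.of_forall fun n => hDK (hqD _)⟩)
      have h2 : Tendsto (fun n => Φ x (q (φ n))) atTop (𝓝 0) := by
        refine squeeze_zero_norm (fun n => (hq (φ n)).le) ?_
        exact (tendsto_one_div_add_atTop_nhds_zero_nat (𝕜 := ℝ)).comp hφ.tendsto_atTop
      exact tendsto_nhds_unique h1 h2
  rw [heq]
  exact MeasurableSet.iInter fun n => MeasurableSet.biUnion hDc fun q hq =>
    measurableSet_lt (hΦ q (hDK hq)).norm measurable_const

/-- Finite subsets suffice even for infinite `Z`: it has finite subsets of every size, which forces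
`B = ⊤`. -/
lemma encard_le_of_forall_finset {β : Type*} {Z : Set β} {B : ℝ≥0∞}
    (h : ∀ F : Finset β, (F : Set β) ⊆ Z → (F.card : ℝ≥0∞) ≤ B) :
    ((Z.encard : ℕ∞) : ℝ≥0∞) ≤ B := by
  rcases Z.finite_or_infinite with hZ | hZ
  · have := h hZ.toFinset (by simp)
    rw [hZ.encard_eq_coe_toFinset_card]
    simpa using this
  · have : B = ⊤ := by
      refine ENNReal.eq_top_of_forall_nnreal_le fun r => ?_
      obtain ⟨n, hn⟩ := exists_nat_ge r
      obtain ⟨F, hF, hFn⟩ := hZ.exists_subset_card_eq n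
      refine le_trans ?_ (h F hF)
      rw [hFn]
      exact_mod_cast hn
    rw [this]
    exact le_top

/-- The number of zeros in a compact set of a random continuous function is measurable. -/
lemma measurable_encard_zeros (hK : IsCompact K) (hΦ : ∀ z ∈ K, Measurable fun x => Φ x z)
    (hc : ∀ x, ContinuousOn (Φ x) K) :
    Measurable fun x => (({z ∈ K | Φ x z = 0}.encard : ℕ∞) : ℝ≥0∞) := by
  classical
  set b : ℕ × ℕ → Set ℂ := fun i =>
    Metric.closedBall (TopologicalSpace.denseSeq ℂ i.1) (1 / (i.2 + 1)) with hb
  set E : ℕ × ℕ → Set α := fun i => {x | ∃ z ∈ K ∩ b i, Φ x z = 0} with hE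
  have hEm : ∀ i, MeasurableSet (E i) := fun i =>
    measurableSet_exists_zero (hK.inter_right Metric.isClosed_closedBall)
      (fun z hz => hΦ z hz.1) fun x => (hc x).mono inter_subset_left
  set T : Set (Finset (ℕ × ℕ)) := {t | (t : Set (ℕ × ℕ)).PairwiseDisjoint b} with hT
  -- The count is the supremum, over finite families of pairwise disjoint balls from a countable
  -- collection, of the number of balls that meet the zero set. Finitely many zeros can be separated
  -- by such balls; conversely, disjoint balls contribute distinct zeros.
  have key : (fun x => (({z ∈ K | Φ x z = 0}.encard : ℕ∞) : ℝ≥0∞)) =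
      fun x => ⨆ t ∈ T, ∑ i ∈ t, (E i).indicator 1 x := by
    funext x
    refine le_antisymm ?_ (iSup₂_le fun t ht => ?_)
    · refine encard_le_of_forall_finset fun F hF => ?_
      obtain ⟨U, hU, hUd⟩ := F.finite_toSet.t2_separation
      have hsmall : ∀ z, ∃ i, z ∈ b i ∧ b i ⊆ U z := by
        intro z
        obtain ⟨ε, hε, hεU⟩ := Metric.isOpen_iff.1 (hU z).2 z (hU z).1
        obtain ⟨n, hn⟩ := exists_nat_one_div_lt (half_pos hε)
        obtain ⟨k, hk⟩ := (TopologicalSpace.denseRange_denseSeq ℂ).exists_dist_lt z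
          (show (0 : ℝ) < 1 / ((n : ℝ) + 1) by positivity)
        refine ⟨(k, n), Metric.mem_closedBall.2 hk.le, fun w hw => hεU ?_⟩
        have hw' : dist w (TopologicalSpace.denseSeq ℂ k) ≤ 1 / ((n : ℝ) + 1) := hw
        rw [dist_comm] at hk
        rw [Metric.mem_ball]
        linarith [dist_triangle w (TopologicalSpace.denseSeq ℂ k) z]
      choose i hi hiU using hsmall
      have hinj : InjOn i F := by
        intro z hz w hw hzw
        by_contra hne
        exact disjoint_left.1 (hUd hz hw hne) (hU z).1 (hiU w (hzw ▸ hi z))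
      have hpd : F.image i ∈ T := by
        rintro j hj k hk hjk
        simp only [Finset.coe_image, mem_image] at hj hk
        obtain ⟨z, hz, rfl⟩ := hj
        obtain ⟨w, hw, rfl⟩ := hk
        exact (hUd hz hw fun h => hjk (h ▸ rfl)).mono (hiU z) (hiU w)
      refine le_trans ?_ (le_iSup₂ (f := fun (t : Finset (ℕ × ℕ)) (_ : t ∈ T) =>
        ∑ i ∈ t, (E i).indicator (1 : α → ℝ≥0∞) x) (F.image i) hpd)
      rw [Finset.sum_image hinj, Finset.sum_congr rfl fun z hz =>
        indicator_of_mem (show x ∈ E (i z) from ⟨z, ⟨(hF hz).1, hi z⟩, (hF hz).2⟩) _]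
      simp
    · have hz : ∀ i, x ∈ E i → ∃ z, z ∈ K ∩ b i ∧ Φ x z = 0 := fun i ⟨z, hz⟩ => ⟨z, hz⟩
      choose! z hzK hz0 using hz
      set t' := t.filter fun i => x ∈ E i with ht'
      have hinj : InjOn z t' := by
        intro i hi j hj hij
        simp only [ht', Finset.coe_filter, mem_ofPred_eq] at hi hj
        by_contra hne
        exact disjoint_left.1 (ht hi.1 hj.1 hne) (hzK i hi.2).2 (hij ▸ (hzK j hj.2).2)
      have hsum : ∑ i ∈ t, (E i).indicator (1 : α → ℝ≥0∞) x = (t'.card : ℝ≥0∞) := by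
        simp [ht', indicator_apply]
      have hle : ((t'.image z : Finset ℂ) : Set ℂ).encard ≤ {z ∈ K | Φ x z = 0}.encard := by
        refine encard_le_encard fun w hw => ?_
        simp only [Finset.coe_image, mem_image] at hw
        obtain ⟨i, hi, rfl⟩ := hw
        have hi' : x ∈ E i := (Finset.mem_filter.1 hi).2
        exact ⟨(hzK i hi').1, hz0 i hi'⟩
      rw [encard_coe_eq_coe_finsetCard, Finset.card_image_of_injOn hinj] at hle
      rw [hsum]
      exact_mod_cast hle
  rw [key]
  exact Measurable.biSup _ T.to_countable fun t _ =>
    Finset.measurable_fun_sum _ fun i _ => measurable_one.indicator (hEm i)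

end Measurability

/-! ### Complex Gaussian variables -/

section ComplexGaussian

variable {Ω : Type*} [MeasurableSpace Ω] {P : Measure Ω}

lemma MeasureTheory.MemLp.integrable_mul_conj {U V : Ω → ℂ} (hU : MemLp U 2 P)
    (hV : MemLp V 2 P) : Integrable (fun x => U x * conj (V x)) P :=
  hU.integrable_mul (hV.star : MemLp (fun x => conj (V x)) 2 P)

/-- The covariance of two real linear functionals of centered complex variables. -/
lemma covariance_inner_inner [IsProbabilityMeasure P] {U V : Ω → ℂ} (hU : MemLp U 2 P)
    (hV : MemLp V 2 P) (hU0 : ∫ x, U x ∂P = 0) (x y : ℂ) :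
    cov[fun u => inner ℝ x (U u), fun u => inner ℝ y (V u); P] =
      (conj x * conj y * ∫ u, U u * V u ∂P + conj x * y * ∫ u, U u * conj (V u) ∂P).re / 2 := by
  have hUV : Integrable (fun u => U u * V u) P := hU.integrable_mul hV
  have hUV' := hU.integrable_mul_conj hV
  rw [covariance_eq_sub (hU.const_inner x) (hV.const_inner y)]
  have h0 : ∫ u, inner ℝ x (U u) ∂P = 0 := by
    rw [integral_inner (hU.integrable one_le_two), hU0, inner_zero_right]
  rw [h0, zero_mul, sub_zero, ← integral_const_mul, ← integral_const_mul,
    ← integral_add (hUV.const_mul _) (hUV'.const_mul _)]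
  have hre := integral_re ((hUV.const_mul (conj x * conj y)).add (hUV'.const_mul (conj x * y)))
  simp only [RCLike.re_eq_complex_re, Pi.add_apply] at hre
  rw [← hre, ← integral_div]
  refine integral_congr_ae (Eventually.of_forall fun u => ?_)
  simp only [Pi.mul_apply, Complex.inner, Complex.add_re, Complex.mul_re, Complex.mul_im,
    Complex.conj_re, Complex.conj_im]
  ring

/-- Jointly Gaussian complex variables are independent if they are uncorrelated in the sense of
complex Gaussian variables. -/
lemma ProbabilityTheory.HasGaussianLaw.indepFun_of_complex_covariance {U V : Ω → ℂ}
    (hUV : HasGaussianLaw (fun u => (U u, V u)) P) (hU0 : ∫ x, U x ∂P = 0)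
    (h1 : ∫ u, U u * V u ∂P = 0) (h2 : ∫ u, U u * conj (V u) ∂P = 0) : IndepFun U V P := by
  have := hUV.isProbabilityMeasure
  refine hUV.indepFun_of_covariance_inner fun x y => ?_
  rw [covariance_inner_inner hUV.fst.memLp_two hUV.snd.memLp_two hU0, h1, h2]
  simp

/-- The density of a centered circularly symmetric complex Gaussian law with variance `a`. -/
def complexGaussianPDF (a : ℝ) (c : ℂ) : ℝ := (π * a)⁻¹ * rexp (-(a⁻¹ * ‖c‖ ^ 2))

lemma continuous_complexGaussianPDF (a : ℝ) : Continuous (complexGaussianPDF a) := by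
  unfold complexGaussianPDF
  fun_prop

lemma complexGaussianPDF_nonneg {a : ℝ} (ha : 0 ≤ a) (c : ℂ) : 0 ≤ complexGaussianPDF a c := by
  unfold complexGaussianPDF
  positivity

/-- A centered circularly symmetric complex Gaussian variable of positive variance has the expected
density. -/
lemma ProbabilityTheory.HasGaussianLaw.map_eq_withDensity_complex {Z : Ω → ℂ}
    (hZ : HasGaussianLaw Z P) (h0 : ∫ u, Z u ∂P = 0) (h1 : ∫ u, Z u * Z u ∂P = 0) {a : ℝ}
    (ha : 0 < a) (h2 : ∫ u, Z u * conj (Z u) ∂P = a) :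
    P.map Z = volume.withDensity fun c => ENNReal.ofReal (complexGaussianPDF a c) := by
  have := hZ.isProbabilityMeasure
  have hL : HasGaussianLaw (fun u => ((Z u).re, (Z u).im)) P :=
    hZ.map_fun Complex.equivRealProdCLM.toContinuousLinearMap
  have hre : (fun u => (Z u).re) = fun u => inner ℝ (1 : ℂ) (Z u) := by
    funext u; simp [Complex.inner]
  have him : (fun u => (Z u).im) = fun u => inner ℝ Complex.I (Z u) := by
    funext u; simp [Complex.inner]
  have hcov : cov[fun u => (Z u).re, fun u => (Z u).im; P] = 0 := by
    rw [hre, him, covariance_inner_inner hZ.memLp_two hZ.memLp_two h0, h1, h2]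
    simp
  have hvre : Var[fun u => (Z u).re; P] = a / 2 := by
    rw [← covariance_self hL.fst.aemeasurable, hre,
      covariance_inner_inner hZ.memLp_two hZ.memLp_two h0, h1, h2]
    simp
  have hvim : Var[fun u => (Z u).im; P] = a / 2 := by
    rw [← covariance_self hL.snd.aemeasurable, him,
      covariance_inner_inner hZ.memLp_two hZ.memLp_two h0, h1, h2]
    simp
  have hmre : ∫ u, (Z u).re ∂P = 0 := by
    have := integral_re hZ.integrable
    simp only [RCLike.re_eq_complex_re] at this
    rw [this, h0, Complex.zero_re]
  have hmim : ∫ u, (Z u).im ∂P = 0 := by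
    have := integral_im hZ.integrable
    simp only [RCLike.im_eq_complex_im] at this
    rw [this, h0, Complex.zero_im]
  have hind := hL.indepFun_of_covariance_eq_zero hcov
  have hne : (a / 2).toNNReal ≠ 0 := by
    rw [Ne, Real.toNNReal_eq_zero, not_le]
    positivity
  have hprod : P.map (fun u => ((Z u).re, (Z u).im)) =
      (volume : Measure (ℝ × ℝ)).withDensity fun q =>
        gaussianPDF 0 (a / 2).toNNReal q.1 * gaussianPDF 0 (a / 2).toNNReal q.2 := by
    rw [(indepFun_iff_map_prod_eq_prod_map_map hL.fst.aemeasurable hL.snd.aemeasurable).1 hind,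
      hL.fst.map_eq_gaussianReal, hL.snd.map_eq_gaussianReal, hmre, hmim, hvre, hvim,
      gaussianReal_of_var_ne_zero _ hne,
      prod_withDensity (measurable_gaussianPDF _ _) (measurable_gaussianPDF _ _)]
    rfl
  have hpdf : ∀ c : ℂ, gaussianPDF 0 (a / 2).toNNReal c.re * gaussianPDF 0 (a / 2).toNNReal c.im =
      ENNReal.ofReal (complexGaussianPDF a c) := by
    intro c
    rw [gaussianPDF, gaussianPDF, ← ENNReal.ofReal_mul (gaussianPDFReal_nonneg _ _ _)]
    congr 1
    rw [gaussianPDFReal, gaussianPDFReal, complexGaussianPDF, Real.coe_toNNReal _ (by positivity),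
      mul_mul_mul_comm, ← Real.exp_add, ← mul_inv, Real.mul_self_sqrt (by positivity),
      Complex.sq_norm, Complex.normSq_apply]
    congr 2
    · ring
    · field_simp
      ring
  have hZeq : Z = fun u => Complex.measurableEquivRealProd.symm ((Z u).re, (Z u).im) := by
    funext u
    simp [Complex.measurableEquivRealProd_symm_apply]
  have hmap : P.map Z =
      (P.map fun u => ((Z u).re, (Z u).im)).map Complex.measurableEquivRealProd.symm := by
    rw [AEMeasurable.map_map_of_aemeasurable
      Complex.measurableEquivRealProd.symm.measurable.aemeasurable hL.aemeasurable]
    exact congrArg (P.map ·) hZeq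
  rw [hmap, hprod]
  refine Measure.ext_of_lintegral _ fun g hg => ?_
  have hgm : Measurable fun q => g (Complex.measurableEquivRealProd.symm q) :=
    hg.comp (MeasurableEquiv.measurable _)
  rw [lintegral_map hg (MeasurableEquiv.measurable _),
    lintegral_withDensity_eq_lintegral_mul volume (f := fun q : ℝ × ℝ =>
      gaussianPDF 0 (a / 2).toNNReal q.1 * gaussianPDF 0 (a / 2).toNNReal q.2)
      (((measurable_gaussianPDF _ _).comp measurable_fst).mul
        ((measurable_gaussianPDF _ _).comp measurable_snd)) hgm,
    lintegral_withDensity_eq_lintegral_mul _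
      (continuous_complexGaussianPDF a).measurable.ennreal_ofReal hg]
  rw [← Complex.volume_preserving_equiv_real_prod.symm.lintegral_comp
    (((continuous_complexGaussianPDF a).measurable.ennreal_ofReal).mul hg)]
  refine lintegral_congr fun q => ?_
  simp only [Pi.mul_apply]
  rw [← hpdf]
  simp [Complex.measurableEquivRealProd_symm_apply]

/-- The exponentials combine to a Gaussian of rate `1 + a⁻¹`, whose mass is elementary; the next
lemma uses its second moment in the same way. -/
lemma integral_complexGaussianPDF_mul {a : ℝ} (ha : 0 < a) :
    ∫ c : ℂ, complexGaussianPDF a c * rexp (-‖c‖ ^ 2) = (1 + a)⁻¹ := by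
  have h := Complex.integral_rpow_mul_exp_neg_mul_rpow (p := 2) (q := 0) (b := 1 + a⁻¹)
    one_le_two (by norm_num) (by positivity)
  have h2 : ∀ c : ℂ, complexGaussianPDF a c * rexp (-‖c‖ ^ 2) =
      (π * a)⁻¹ * (‖c‖ ^ (0 : ℝ) * rexp (-(1 + a⁻¹) * ‖c‖ ^ (2 : ℝ))) := by
    intro c
    rw [complexGaussianPDF, mul_assoc, ← Real.exp_add, Real.rpow_zero, one_mul, Real.rpow_two]
    ring_nf
  simp_rw [h2]
  rw [integral_const_mul, h]
  norm_num
  rw [Real.rpow_neg_one]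
  field_simp
  ring

lemma integral_complexGaussianPDF_mul_norm_sq {a : ℝ} (ha : 0 < a) :
    ∫ c : ℂ, complexGaussianPDF a c * (rexp (-‖c‖ ^ 2) * ‖c‖ ^ 2) = a / (1 + a) ^ 2 := by
  have h := Complex.integral_rpow_mul_exp_neg_mul_rpow (p := 2) (q := 2) (b := 1 + a⁻¹)
    one_le_two (by norm_num) (by positivity)
  have h2 : ∀ c : ℂ, complexGaussianPDF a c * (rexp (-‖c‖ ^ 2) * ‖c‖ ^ 2) =
      (π * a)⁻¹ * (‖c‖ ^ (2 : ℝ) * rexp (-(1 + a⁻¹) * ‖c‖ ^ (2 : ℝ))) := by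
    intro c
    have h3 : rexp (-(1 + a⁻¹) * ‖c‖ ^ (2 : ℝ)) =
        rexp (-(a⁻¹ * ‖c‖ ^ 2)) * rexp (-‖c‖ ^ 2) := by
      rw [← Real.exp_add, Real.rpow_two]
      ring_nf
    rw [complexGaussianPDF, h3, Real.rpow_two]
    ring
  simp_rw [h2]
  rw [integral_const_mul, h]
  norm_num
  field_simp
  ring

lemma integral_comp_of_map_eq_complexGaussian {Z : Ω → ℂ} (hZ : AEMeasurable Z P) {a : ℝ}
    (ha : 0 < a)
    (hmap : P.map Z = volume.withDensity fun c => ENNReal.ofReal (complexGaussianPDF a c))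
    {G : ℂ → ℝ} (hG : Continuous G) :
    ∫ u, G (Z u) ∂P = ∫ c, complexGaussianPDF a c * G c := by
  rw [← integral_map hZ hG.aestronglyMeasurable, hmap,
    integral_withDensity_eq_integral_toReal_smul
      (continuous_complexGaussianPDF a).measurable.ennreal_ofReal (by simp)]
  simp_rw [ENNReal.toReal_ofReal (complexGaussianPDF_nonneg ha.le _), smul_eq_mul]

lemma integral_norm_sq_eq_of_mul_conj {Z : Ω → ℂ} {a : ℝ}
    (h : ∫ u, Z u * conj (Z u) ∂P = a) : ∫ u, ‖Z u‖ ^ 2 ∂P = a := by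
  have h1 : ∀ u, Z u * conj (Z u) = ((‖Z u‖ ^ 2 : ℝ) : ℂ) := fun u => by
    rw [Complex.mul_conj, Complex.normSq_eq_norm_sq]
  simp_rw [h1] at h
  rw [integral_complex_ofReal] at h
  exact_mod_cast h

/-- The Gaussian expectation which appears in the Kac--Rice formula. -/
lemma integral_exp_neg_norm_sq_mul_norm_sq {U V : Ω → ℂ}
    (hUV : HasGaussianLaw (fun u => (U u, V u)) P) (hU0 : ∫ u, U u ∂P = 0)
    (hV0 : ∫ u, V u ∂P = 0) (hUU : ∫ u, U u * U u ∂P = 0) (hVU : ∫ u, V u * U u ∂P = 0)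
    {a d : ℝ} {b : ℂ} (ha : ∫ u, U u * conj (U u) ∂P = a) (hb : ∫ u, V u * conj (U u) ∂P = b)
    (hd : ∫ u, V u * conj (V u) ∂P = d) :
    ∫ u, rexp (-‖U u‖ ^ 2) * ‖V u‖ ^ 2 ∂P = d / (1 + a) - ‖b‖ ^ 2 / (1 + a) ^ 2 := by
  have := hUV.isProbabilityMeasure
  have hU2 := hUV.fst.memLp_two
  have hV2 := hUV.snd.memLp_two
  have hUm : AEStronglyMeasurable U P := hU2.aestronglyMeasurable
  have hasq := integral_norm_sq_eq_of_mul_conj ha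
  have hdsq := integral_norm_sq_eq_of_mul_conj hd
  have ha0 : 0 ≤ a := hasq ▸ integral_nonneg fun _ => by positivity
  -- If `a = 0` then `U` vanishes almost surely and has no density, so this case is separate. It
  -- does occur: at `z = 0` the innovation series vanishes.
  rcases ha0.eq_or_lt with ha0 | ha0
  · have hz : ∀ᵐ u ∂P, U u = 0 := by
      have := (integral_eq_zero_iff_of_nonneg (fun u => by positivity)
        (hU2.norm.integrable_sq)).1 (hasq.trans ha0.symm)
      filter_upwards [this] with u hu
      simpa using hu
    have hb0 : b = 0 := by
      rw [← hb]
      refine integral_eq_zero_of_ae ?_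
      filter_upwards [hz] with u hu
      simp [hu]
    rw [integral_congr_ae (g := fun u => ‖V u‖ ^ 2) (by
      filter_upwards [hz] with u hu
      simp [hu]), hdsq, ← ha0, hb0]
    simp
  -- `β` is the regression coefficient of `V` on `U`, so that the residual `W = V - β U` is
  -- uncorrelated with `U`, hence independent of it.
  · set β : ℂ := b / a with hβ
    have hac : (a : ℂ) ≠ 0 := by exact_mod_cast ha0.ne'
    set W : Ω → ℂ := fun u => V u - β * U u with hW
    have hWU : HasGaussianLaw (fun u => (W u, U u)) P :=
      hUV.map_fun ((ContinuousLinearMap.snd ℝ ℂ ℂ - (ContinuousLinearMap.mul ℝ ℂ β).comp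
        (ContinuousLinearMap.fst ℝ ℂ ℂ)).prod (ContinuousLinearMap.fst ℝ ℂ ℂ))
    have hW2 := hWU.fst.memLp_two
    have hUi := hU2.integrable one_le_two
    have hVi := hV2.integrable one_le_two
    have hW0 : ∫ u, W u ∂P = 0 := by
      rw [integral_sub hVi (hUi.const_mul β), integral_const_mul, hU0, hV0]
      simp
    have hWU0 : ∫ u, W u * U u ∂P = 0 := by
      simp_rw [hW, sub_mul, mul_assoc]
      have hi1 : Integrable (fun u => V u * U u) P := hV2.integrable_mul hU2
      have hi2 : Integrable (fun u => U u * U u) P := hU2.integrable_mul hU2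
      rw [integral_sub hi1 (hi2.const_mul β), integral_const_mul, hUU, hVU]
      simp
    have hWUc : ∫ u, W u * conj (U u) ∂P = 0 := by
      simp_rw [hW, sub_mul, mul_assoc]
      rw [integral_sub (hV2.integrable_mul_conj hU2) ((hU2.integrable_mul_conj hU2).const_mul β),
        integral_const_mul, ha, hb, hβ, div_mul_cancel₀ _ hac, sub_self]
    have hind := hWU.indepFun_of_complex_covariance hW0 hWU0 hWUc
    have hWsq : ∫ u, ‖W u‖ ^ 2 ∂P = d - ‖b‖ ^ 2 / a := by
      refine integral_norm_sq_eq_of_mul_conj ?_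
      have h1 : ∀ u, W u * conj (W u) =
          V u * conj (V u) - β * conj (V u * conj (U u)) - conj β * (W u * conj (U u)) := by
        intro u
        simp only [hW, map_sub, map_mul, Complex.conj_conj]
        ring
      have hVUc := hV2.integrable_mul_conj hU2
      simp_rw [h1]
      have hi1 : Integrable (fun u => β * conj (V u * conj (U u))) P :=
        (Complex.conjLIE.toContinuousLinearEquiv.toContinuousLinearMap.integrable_comp
          hVUc).const_mul β
      have hi2 : Integrable (fun u => V u * conj (V u) - β * conj (V u * conj (U u))) P :=
        (hV2.integrable_mul_conj hV2).sub hi1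
      rw [integral_sub hi2 ((hW2.integrable_mul_conj hU2).const_mul _),
        integral_sub (hV2.integrable_mul_conj hV2) hi1, integral_const_mul, integral_const_mul, hWUc, integral_conj, hb,
        hd, hβ, div_mul_eq_mul_div, Complex.mul_conj, Complex.normSq_eq_norm_sq]
      push_cast
      ring
    have hmap := hUV.fst.map_eq_withDensity_complex hU0 hUU ha0 ha
    have hE0 : ∫ u, rexp (-‖U u‖ ^ 2) ∂P = (1 + a)⁻¹ := by
      rw [integral_comp_of_map_eq_complexGaussian hUV.fst.aemeasurable ha0 hmap
        (G := fun c => rexp (-‖c‖ ^ 2)) (by fun_prop), integral_complexGaussianPDF_mul ha0]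
    have hE2 : ∫ u, rexp (-‖U u‖ ^ 2) * ‖U u‖ ^ 2 ∂P = a / (1 + a) ^ 2 := by
      rw [integral_comp_of_map_eq_complexGaussian hUV.fst.aemeasurable ha0 hmap
        (G := fun c => rexp (-‖c‖ ^ 2) * ‖c‖ ^ 2) (by fun_prop),
        integral_complexGaussianPDF_mul_norm_sq ha0]
    have hI1 : ∫ u, ‖W u‖ ^ 2 * rexp (-‖U u‖ ^ 2) ∂P = (d - ‖b‖ ^ 2 / a) * (1 + a)⁻¹ := by
      rw [← hWsq, ← hE0]
      exact (hind.comp (φ := fun w : ℂ => ‖w‖ ^ 2) (ψ := fun w : ℂ => rexp (-‖w‖ ^ 2))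
        (by fun_prop) (by fun_prop)).integral_fun_mul_eq_mul_integral
        (hW2.aestronglyMeasurable.norm.pow 2)
        ((by fun_prop : Continuous fun w : ℂ => rexp (-‖w‖ ^ 2)).comp_aestronglyMeasurable hUm)
    -- The cross term factors by independence, and `W` is centered.
    have hI2 : ∫ u, W u * (conj (U u) * (rexp (-‖U u‖ ^ 2) : ℂ)) ∂P = 0 := by
      have := (hind.comp (φ := fun w : ℂ => w) (ψ := fun w : ℂ => conj w * (rexp (-‖w‖ ^ 2) : ℂ))
        (by fun_prop) (by fun_prop)).integral_fun_mul_eq_mul_integral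
        hW2.aestronglyMeasurable
        ((by fun_prop : Continuous fun w : ℂ => conj w * (rexp (-‖w‖ ^ 2) : ℂ)
          ).comp_aestronglyMeasurable hUm)
      simp only [Function.comp_apply] at this
      rw [this]
      simp [hW0]
    have hbd : ∀ u, ‖rexp (-‖U u‖ ^ 2)‖ ≤ 1 := fun u => by
      rw [Real.norm_eq_abs, abs_of_pos (Real.exp_pos _), Real.exp_le_one_iff]
      nlinarith [norm_nonneg (U u)]
    have hem : AEStronglyMeasurable (fun u => rexp (-‖U u‖ ^ 2)) P :=
      (by fun_prop : Continuous fun w : ℂ => rexp (-‖w‖ ^ 2)).comp_aestronglyMeasurable hUm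
    have hi1 : Integrable (fun u => ‖W u‖ ^ 2 * rexp (-‖U u‖ ^ 2)) P :=
      hW2.norm.integrable_sq.mul_bdd hem (Eventually.of_forall hbd)
    have hi2 : Integrable (fun u => rexp (-‖U u‖ ^ 2) * ‖U u‖ ^ 2) P :=
      hU2.norm.integrable_sq.bdd_mul hem (Eventually.of_forall hbd)
    have hi3 : Integrable (fun u => W u * (conj (U u) * (rexp (-‖U u‖ ^ 2) : ℂ))) P := by
      have := (hW2.integrable_mul_conj hU2).mul_bdd (g := fun u => ((rexp (-‖U u‖ ^ 2) : ℝ) : ℂ))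
        (Complex.continuous_ofReal.comp_aestronglyMeasurable hem)
        (Eventually.of_forall fun u => (Complex.norm_real _).trans_le (hbd u))
      simpa only [mul_assoc] using this
    have hexp : ∀ u, rexp (-‖U u‖ ^ 2) * ‖V u‖ ^ 2 = ‖W u‖ ^ 2 * rexp (-‖U u‖ ^ 2) +
        2 * (conj β * (W u * (conj (U u) * (rexp (-‖U u‖ ^ 2) : ℂ)))).re +
        ‖β‖ ^ 2 * (rexp (-‖U u‖ ^ 2) * ‖U u‖ ^ 2) := by
      intro u
      have hV : V u = W u + β * U u := by simp [hW]
      have h1 : ‖V u‖ ^ 2 = ‖W u‖ ^ 2 + 2 * (W u * conj (β * U u)).re + (‖β‖ * ‖U u‖) ^ 2 := by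
        rw [hV, ← norm_mul, ← Complex.normSq_eq_norm_sq, ← Complex.normSq_eq_norm_sq,
          ← Complex.normSq_eq_norm_sq, Complex.normSq_add]
        ring
      have h2 : (conj β * (W u * (conj (U u) * (rexp (-‖U u‖ ^ 2) : ℂ)))).re =
          (W u * conj (β * U u)).re * rexp (-‖U u‖ ^ 2) := by
        rw [← Complex.re_mul_ofReal, map_mul]
        ring_nf
      rw [h1, h2]
      ring
    simp_rw [hexp]
    have hre := integral_re (hi3.const_mul (conj β))
    simp only [RCLike.re_eq_complex_re] at hre
    have hi4 : Integrable (fun u =>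
        2 * (conj β * (W u * (conj (U u) * (rexp (-‖U u‖ ^ 2) : ℂ)))).re) P :=
      ((hi3.const_mul (conj β)).re).const_mul 2
    have hi5 : Integrable (fun u => ‖W u‖ ^ 2 * rexp (-‖U u‖ ^ 2) +
        2 * (conj β * (W u * (conj (U u) * (rexp (-‖U u‖ ^ 2) : ℂ)))).re) P := hi1.add hi4
    rw [integral_add hi5 (hi2.const_mul _), integral_add hi1 hi4, integral_const_mul,
      integral_const_mul, hI1, hE2, hre, integral_const_mul, hI2, hβ, norm_div,
      Complex.norm_real, Real.norm_eq_abs, abs_of_pos ha0]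
    simp only [mul_zero, Complex.zero_re]
    field_simp
    ring

end ComplexGaussian

/-! ### Power series with admissible coefficients -/

/-- The sum of the power series with coefficients `x`. -/
def powerSum (x : ℕ → ℂ) (z : ℂ) : ℂ := ∑' k, x k * z ^ k

/-- The coefficients of the derivative of a power series. -/
def derivSeq (x : ℕ → ℂ) (k : ℕ) : ℂ := (k + 1) * x (k + 1)

/-- The coefficient sequences whose power series converges absolutely on the unit disk. -/
def admissibleSeq : Set (ℕ → ℂ) :=
  {x | ∀ r : ℝ, 0 ≤ r → r < 1 → Summable fun k => ‖x k‖ * r ^ k}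

lemma summable_norm_mul_pow_iff {x : ℕ → ℂ} {r : ℝ} (hr : 0 ≤ r) :
    (Summable fun k => ‖x k‖ * r ^ k) ↔ ∑' k, ‖x k‖ₑ * ENNReal.ofReal r ^ k ≠ ⊤ := by
  lift r to NNReal using hr
  have h1 : (fun k => ‖x k‖ * (r : ℝ) ^ k) = fun k => ((‖x k‖₊ * r ^ k : NNReal) : ℝ) := by
    funext k; simp
  have h2 : (fun k => ‖x k‖ₑ * ENNReal.ofReal r ^ k) =
      fun k => ((‖x k‖₊ * r ^ k : NNReal) : ℝ≥0∞) := by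
    funext k; simp [enorm_eq_nnnorm]
  rw [h1, h2, NNReal.summable_coe, ENNReal.tsum_coe_ne_top_iff_summable]

/-- Summability at a radius implies it at smaller ones, so countably many radii tending to 1
suffice. This gives measurability and reduces almost sure statements to one radius at a time. -/
lemma admissibleSeq_eq_iInter : admissibleSeq =
    ⋂ n : ℕ, {x | ∑' k, ‖x k‖ₑ * ENNReal.ofReal (1 - 1 / ((n : ℝ) + 1)) ^ k ≠ ⊤} := by
  have hn0 : ∀ n : ℕ, (0 : ℝ) ≤ 1 - 1 / ((n : ℝ) + 1) := fun n => by
    rw [sub_nonneg, div_le_one (by positivity)]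
    linarith [n.cast_nonneg (α := ℝ)]
  ext x
  simp only [admissibleSeq, mem_ofPred_eq, mem_iInter]
  constructor
  · intro hx n
    exact (summable_norm_mul_pow_iff (hn0 n)).1 (hx _ (hn0 n) (by
      have : (0 : ℝ) < 1 / ((n : ℝ) + 1) := by positivity
      linarith))
  · intro hx r hr0 hr1
    obtain ⟨n, hn⟩ := exists_nat_one_div_lt (sub_pos.2 hr1)
    refine ((summable_norm_mul_pow_iff (hn0 n)).2 (hx n)).of_nonneg_of_le
      (fun k => by positivity) fun k => ?_
    gcongr
    linarith

lemma measurableSet_admissibleSeq : MeasurableSet admissibleSeq := by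
  rw [admissibleSeq_eq_iInter]
  refine MeasurableSet.iInter fun n => ?_
  refine (measurableSet_eq_fun ?_ measurable_const).compl
  exact Measurable.tsum fun k => ((measurable_pi_apply k).enorm).mul_const _

section PowerSum

variable {x y : ℕ → ℂ} {z : ℂ}

lemma summable_powerSum (hx : x ∈ admissibleSeq) (hz : ‖z‖ < 1) :
    Summable fun k => x k * z ^ k := by
  refine Summable.of_norm ?_
  simpa [norm_mul, norm_pow] using hx ‖z‖ (norm_nonneg z) hz

lemma add_mul_mem_admissibleSeq (hx : x ∈ admissibleSeq) (hy : y ∈ admissibleSeq) (c : ℂ) :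
    (fun k => x k + c * y k) ∈ admissibleSeq := by
  intro r hr0 hr1
  refine ((hx r hr0 hr1).add ((hy r hr0 hr1).mul_left ‖c‖)).of_nonneg_of_le
    (fun k => by positivity) fun k => ?_
  have : ‖x k + c * y k‖ ≤ ‖x k‖ + ‖c‖ * ‖y k‖ := (norm_add_le _ _).trans (by rw [norm_mul])
  calc ‖x k + c * y k‖ * r ^ k ≤ (‖x k‖ + ‖c‖ * ‖y k‖) * r ^ k := by gcongr
    _ = _ := by ring

lemma powerSum_add_mul (hx : x ∈ admissibleSeq) (hy : y ∈ admissibleSeq) (c : ℂ) (hz : ‖z‖ < 1) :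
    powerSum (fun k => x k + c * y k) z = powerSum x z + c * powerSum y z := by
  have h : ∀ k, (x k + c * y k) * z ^ k = x k * z ^ k + c * (y k * z ^ k) := fun k => by ring
  simp_rw [powerSum, h]
  rw [(summable_powerSum hx hz).tsum_add ((summable_powerSum hy hz).mul_left c), tsum_mul_left]

lemma exists_norm_mul_pow_le (hx : x ∈ admissibleSeq) {r : ℝ} (hr1 : r < 1) :
    ∃ u : ℕ → ℝ, Summable u ∧ ∀ k, ∀ w ∈ Metric.ball (0 : ℂ) r, ‖x k * w ^ k‖ ≤ u k := by
  rcases lt_or_ge r 0 with hr | hr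
  · exact ⟨0, summable_zero, fun k w hw => absurd hw (by simp [Metric.ball_eq_empty.2 hr.le])⟩
  · refine ⟨_, hx r hr hr1, fun k w hw => ?_⟩
    rw [mem_ball_zero_iff] at hw
    rw [norm_mul, norm_pow]
    gcongr

lemma differentiableOn_powerSum (hx : x ∈ admissibleSeq) :
    DifferentiableOn ℂ (powerSum x) (Metric.ball 0 1) := by
  intro z hz
  obtain ⟨r, hzr, hr1⟩ := exists_between (mem_ball_zero_iff.1 hz)
  obtain ⟨u, hu, hxu⟩ := exists_norm_mul_pow_le hx hr1
  have h := Complex.differentiableOn_tsum_of_summable_norm hu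
    (fun k => ((differentiable_id.pow k).const_mul (x k)).differentiableOn) Metric.isOpen_ball hxu
  exact (h.differentiableAt (Metric.isOpen_ball.mem_nhds
    (mem_ball_zero_iff.2 hzr))).differentiableWithinAt

lemma hasSum_deriv_powerSum (hx : x ∈ admissibleSeq) (hz : ‖z‖ < 1) :
    HasSum (fun k => x k * (k * z ^ (k - 1))) (deriv (powerSum x) z) := by
  obtain ⟨r, hzr, hr1⟩ := exists_between hz
  obtain ⟨u, hu, hxu⟩ := exists_norm_mul_pow_le hx hr1
  have h := Complex.hasSum_deriv_of_summable_norm hu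
    (fun k => ((differentiable_id.pow k).const_mul (x k)).differentiableOn) Metric.isOpen_ball hxu
    (mem_ball_zero_iff.2 hzr)
  have h2 : ∀ k, deriv (fun w : ℂ => x k * w ^ k) z = x k * (k * z ^ (k - 1)) := fun k => by
    rw [deriv_const_mul _ (by fun_prop)]
    simp
  simp only [Pi.pow_apply, h2] at h
  exact h

lemma hasSum_derivSeq (hx : x ∈ admissibleSeq) (hz : ‖z‖ < 1) :
    HasSum (fun k => derivSeq x k * z ^ k) (deriv (powerSum x) z) := by
  have h3 := hasSum_deriv_powerSum hx hz
  rw [← hasSum_nat_add_iff' 1] at h3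
  simp only [Finset.range_one, Finset.sum_singleton, Nat.cast_zero, zero_mul, mul_zero,
    sub_zero, add_tsub_cancel_right] at h3
  refine h3.congr_fun fun k => ?_
  simp only [derivSeq]
  push_cast
  ring

lemma deriv_powerSum (hx : x ∈ admissibleSeq) (hz : ‖z‖ < 1) :
    deriv (powerSum x) z = powerSum (derivSeq x) z :=
  (hasSum_derivSeq hx hz).tsum_eq.symm

lemma tendsto_powerSum (hx : x ∈ admissibleSeq) (hz : ‖z‖ < 1) :
    Tendsto (fun n => ∑ k ∈ Finset.range n, x k * z ^ k) atTop (𝓝 (powerSum x z)) :=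
  (summable_powerSum hx hz).hasSum.tendsto_sum_nat

lemma tendsto_powerSum_derivSeq (hx : x ∈ admissibleSeq) (hz : ‖z‖ < 1) :
    Tendsto (fun n => ∑ k ∈ Finset.range n, derivSeq x k * z ^ k) atTop
      (𝓝 (powerSum (derivSeq x) z)) := by
  rw [← deriv_powerSum hx hz]
  exact (hasSum_derivSeq hx hz).tendsto_sum_nat

end PowerSum

/-- On admissible sequences the sums are limits of their partial sums, which are measurable;
elsewhere nothing is claimed, hence only almost everywhere measurability. -/
lemma aemeasurable_powerSum {L : Measure (ℕ → ℂ)} (hL : ∀ᵐ x ∂L, x ∈ admissibleSeq) {z : ℂ}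
    (hz : ‖z‖ < 1) : AEMeasurable (fun x => powerSum x z) L ∧
      AEMeasurable (fun x => powerSum (derivSeq x) z) L := by
  constructor
  · refine aemeasurable_of_tendsto_metrizable_ae atTop (fun n => ?_)
      (by filter_upwards [hL] with x hx using tendsto_powerSum hx hz)
    exact (Finset.measurable_fun_sum _ fun k _ => by fun_prop).aemeasurable
  · refine aemeasurable_of_tendsto_metrizable_ae atTop (fun n => ?_)
      (by filter_upwards [hL] with x hx using tendsto_powerSum_derivSeq hx hz)
    exact (Finset.measurable_fun_sum _ fun k _ => by unfold derivSeq; fun_prop).aemeasurable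

lemma aemeasurable_powerSum_prod {L : Measure (ℕ → ℂ)} [SFinite L] (hL : ∀ᵐ x ∂L, x ∈ admissibleSeq)
    {A : Set ℂ} (hA : MeasurableSet A) (hA1 : A ⊆ Metric.ball 0 1) :
    AEMeasurable (fun q : (ℕ → ℂ) × ℂ => powerSum q.1 q.2) (L.prod (volume.restrict A)) ∧
    AEMeasurable (fun q : (ℕ → ℂ) × ℂ => powerSum (derivSeq q.1) q.2)
      (L.prod (volume.restrict A)) := by
  have h1 : ∀ᵐ q ∂(L.prod (volume.restrict A)), q.1 ∈ admissibleSeq :=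
    Measure.quasiMeasurePreserving_fst.ae hL
  have h2 : ∀ᵐ q ∂(L.prod (volume.restrict A)), ‖q.2‖ < 1 :=
    Measure.quasiMeasurePreserving_snd.ae (p := fun z : ℂ => ‖z‖ < 1) ((ae_restrict_iff' hA).2
      (Eventually.of_forall fun z hz => mem_ball_zero_iff.1 (hA1 hz)))
  constructor
  · refine aemeasurable_of_tendsto_metrizable_ae atTop (fun n => ?_)
      (by filter_upwards [h1, h2] with q hq1 hq2 using tendsto_powerSum hq1 hq2)
    exact (Finset.measurable_fun_sum _ fun k _ => by fun_prop).aemeasurable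
  · refine aemeasurable_of_tendsto_metrizable_ae atTop (fun n => ?_)
      (by filter_upwards [h1, h2] with q hq1 hq2 using tendsto_powerSum_derivSeq hq1 hq2)
    exact (Finset.measurable_fun_sum _ fun k _ => by unfold derivSeq; fun_prop).aemeasurable

/-- The number of zeros in `A` of the power series with coefficients `x`. -/
def zeroNumber (A : Set ℂ) (x : ℕ → ℂ) : ℝ≥0∞ :=
  ({z ∈ A | ‖z‖ < 1 ∧ powerSum x z = 0}.encard : ℝ≥0∞)

lemma aemeasurable_zeroNumber_of_isCompact {L : Measure (ℕ → ℂ)}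
    (hL : ∀ᵐ x ∂L, x ∈ admissibleSeq) {K : Set ℂ} (hK : IsCompact K)
    (hK1 : K ⊆ Metric.ball 0 1) : AEMeasurable (zeroNumber K) L := by
  classical
  -- Replacing inadmissible sequences by 0 makes every power series continuous on `K`, as
  -- `measurable_encard_zeros` requires, and changes nothing almost everywhere.
  set s : (ℕ → ℂ) → ℕ → ℂ := fun x => if x ∈ admissibleSeq then x else 0 with hs
  have hsm : Measurable s := Measurable.ite measurableSet_admissibleSeq measurable_id measurable_const
  have hsa : ∀ x, s x ∈ admissibleSeq := by
    intro x
    by_cases hx : x ∈ admissibleSeq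
    · simp [hs, hx]
    · simp only [hs, hx, if_false]
      intro r _ _
      simp
  refine ⟨fun x => (({z ∈ K | powerSum (s x) z = 0}.encard : ℕ∞) : ℝ≥0∞), ?_, ?_⟩
  · refine measurable_encard_zeros hK (fun z hz => ?_)
      fun x => (differentiableOn_powerSum (hsa x)).continuousOn.mono hK1
    refine measurable_of_tendsto_metrizable (fun n => ?_)
      (tendsto_pi_nhds.2 fun x => tendsto_powerSum (hsa x) (mem_ball_zero_iff.1 (hK1 hz)))
    exact Finset.measurable_fun_sum _ fun k _ =>
      ((measurable_pi_apply k).comp hsm).mul_const _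
  · filter_upwards [hL] with x hx
    have hsx : s x = x := by simp [hs, hx]
    rw [zeroNumber, hsx]
    congr 3
    ext z
    exact ⟨fun h => ⟨h.1, h.2.2⟩, fun h => ⟨h.1, mem_ball_zero_iff.1 (hK1 h.1), h.2⟩⟩

/-! ### Gaussian series with a spectral representation -/

section GaussianSeries

variable {Ω : Type*} [MeasurableSpace Ω] {P : Measure Ω} {F : Measure ℝ} {Y : ℕ → Ω → ℂ}
  {e : ℕ → ℝ → ℂ}

/-- `Y` is a centered circularly symmetric complex Gaussian sequence whose covariances are the
scalar products in `L²(F)` of the bounded functions `e k`. -/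
structure IsSpectralGaussian (Y : ℕ → Ω → ℂ) (e : ℕ → ℝ → ℂ) (P : Measure Ω) (F : Measure ℝ) :
    Prop where
  gaussian : IsGaussianProcess Y P
  centered : ∀ k, ∫ u, Y k u ∂P = 0
  circular : ∀ k l, ∫ u, Y k u * Y l u ∂P = 0
  measurable : ∀ k, Measurable (e k)
  bound : ∀ k t, ‖e k t‖ ≤ 2
  covariance : ∀ k l, ∫ u, Y k u * conj (Y l u) ∂P = ∫ t, e k t * conj (e l t) ∂F

lemma lintegral_enorm_sq_eq_ofReal {U : Ω → ℂ} (hU : MemLp U 2 P) :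
    ∫⁻ u, ‖U u‖ₑ ^ 2 ∂P = ENNReal.ofReal (∫ u, ‖U u‖ ^ 2 ∂P) := by
  rw [ofReal_integral_eq_lintegral_ofReal hU.norm.integrable_sq
    (Eventually.of_forall fun u => by positivity)]
  refine lintegral_congr fun u => ?_
  rw [ENNReal.ofReal_pow (norm_nonneg _), ofReal_norm]

namespace IsSpectralGaussian

variable (h : IsSpectralGaussian Y e P F)
include h

lemma memLp (k : ℕ) : MemLp (Y k) 2 P := (h.gaussian.hasGaussianLaw_eval k).memLp_two

lemma integrable_mul_conj_kernel [IsProbabilityMeasure F] (k l : ℕ) :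
    Integrable (fun t => e k t * conj (e l t)) F := by
  refine Integrable.of_bound (C := 4)
    ((h.measurable k).mul (Complex.continuous_conj.measurable.comp
      (h.measurable l))).aestronglyMeasurable (Eventually.of_forall fun t => ?_)
  rw [norm_mul, RCLike.norm_conj]
  nlinarith [h.bound k t, h.bound l t, norm_nonneg (e k t), norm_nonneg (e l t)]

lemma lintegral_enorm_sq_le [IsProbabilityMeasure F] (k : ℕ) : ∫⁻ u, ‖Y k u‖ₑ ^ 2 ∂P ≤ 4 := by
  have hc := h.covariance k k
  have h1 : ∀ t, e k t * conj (e k t) = ((‖e k t‖ ^ 2 : ℝ) : ℂ) := fun t => by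
    rw [Complex.mul_conj, Complex.normSq_eq_norm_sq]
  simp_rw [h1] at hc
  rw [integral_complex_ofReal] at hc
  rw [lintegral_enorm_sq_eq_ofReal (h.memLp k), integral_norm_sq_eq_of_mul_conj hc]
  refine ENNReal.ofReal_le_of_le_toReal ?_
  calc ∫ t, ‖e k t‖ ^ 2 ∂F ≤ ∫ _, 4 ∂F := by
        refine integral_mono_of_nonneg (Eventually.of_forall fun t => by positivity)
          (integrable_const _) (Eventually.of_forall fun t => ?_)
        dsimp only
        nlinarith [h.bound k t, norm_nonneg (e k t)]
    _ = _ := by simp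

lemma lintegral_tsum_lt_top [IsProbabilityMeasure F] {r : ℝ} (hr1 : r < 1) :
    ∫⁻ u, ∑' k, ‖Y k u‖ₑ ^ 2 * ENNReal.ofReal r ^ k ∂P < ⊤ := by
  rw [lintegral_tsum fun k => ((h.gaussian.aemeasurable k).enorm.pow_const 2).mul_const _]
  calc ∑' k, ∫⁻ u, ‖Y k u‖ₑ ^ 2 * ENNReal.ofReal r ^ k ∂P
      ≤ ∑' k, 4 * ENNReal.ofReal r ^ k := by
        refine ENNReal.tsum_le_tsum fun k => ?_
        rw [lintegral_mul_const'' _ ((h.gaussian.aemeasurable k).enorm.pow_const 2)]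
        gcongr
        exact h.lintegral_enorm_sq_le k
    _ = 4 * (1 - ENNReal.ofReal r)⁻¹ := by rw [ENNReal.tsum_mul_left, ENNReal.tsum_geometric]
    _ < ⊤ := by
        refine ENNReal.mul_lt_top (by simp) (ENNReal.inv_lt_top.2 ?_)
        rw [tsub_pos_iff_lt]
        simpa using hr1

/-- At each of countably many radii the weighted sum of squares has finite expectation, hence is
almost surely finite; `‖y‖ ≤ 1 + ‖y‖²` then bounds the sum of absolute values. -/
lemma ae_mem_admissibleSeq [IsProbabilityMeasure F] :
    ∀ᵐ u ∂P, (fun k => Y k u) ∈ admissibleSeq := by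
  rw [admissibleSeq_eq_iInter]
  simp only [mem_iInter, mem_ofPred_eq]
  refine ae_all_iff.2 fun n => ?_
  have hn : 1 - 1 / ((n : ℝ) + 1) < 1 := by
    have : (0 : ℝ) < 1 / ((n : ℝ) + 1) := by positivity
    linarith
  set r : ℝ := 1 - 1 / ((n : ℝ) + 1)
  filter_upwards [ae_lt_top' (AEMeasurable.tsum fun k =>
    ((h.gaussian.aemeasurable k).enorm.pow_const 2).mul_const (ENNReal.ofReal r ^ k))
    (h.lintegral_tsum_lt_top hn).ne] with u hu
  refine ne_top_of_le_ne_top (b := (1 - ENNReal.ofReal r)⁻¹ +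
    ∑' k, ‖Y k u‖ₑ ^ 2 * ENNReal.ofReal r ^ k) ?_ ?_
  · refine (ENNReal.add_lt_top.2 ⟨ENNReal.inv_lt_top.2 ?_, hu⟩).ne
    rw [tsub_pos_iff_lt]
    simpa using hn
  · rw [← ENNReal.tsum_geometric, ← ENNReal.tsum_add]
    refine ENNReal.tsum_le_tsum fun k => ?_
    have : ‖Y k u‖ₑ ≤ 1 + ‖Y k u‖ₑ ^ 2 := by
      rcases le_total ‖Y k u‖ₑ 1 with h1 | h1
      · exact h1.trans le_self_add
      · calc ‖Y k u‖ₑ = ‖Y k u‖ₑ ^ 1 := (pow_one _).symm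
          _ ≤ ‖Y k u‖ₑ ^ 2 := pow_le_pow_right₀ h1 one_le_two
          _ ≤ _ := le_add_self
    calc ‖Y k u‖ₑ * ENNReal.ofReal r ^ k ≤ (1 + ‖Y k u‖ₑ ^ 2) * ENNReal.ofReal r ^ k := by gcongr
      _ = _ := by rw [add_mul, one_mul]

variable (a c : ℕ → ℂ) (n : ℕ)

lemma memLp_sum : MemLp (fun u => ∑ k ∈ Finset.range n, a k * Y k u) 2 P :=
  memLp_finsetSum _ fun k _ => (h.memLp k).const_mul (a k)

lemma hasGaussianLaw_sum_prod : HasGaussianLaw (fun u =>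
    (∑ k ∈ Finset.range n, a k * Y k u, ∑ k ∈ Finset.range n, c k * Y k u)) P := by
  have hL := (h.gaussian.hasGaussianLaw (Finset.range n)).map_fun
    (∑ k : Finset.range n, ((ContinuousLinearMap.mul ℝ ℂ (a k)).prod
      (ContinuousLinearMap.mul ℝ ℂ (c k))).comp (ContinuousLinearMap.proj k))
  convert! hL using 2
  rename_i u
  rw [sum_apply]
  refine Prod.ext ?_ ?_
  · rw [Prod.fst_sum]
    exact (Finset.sum_coe_sort (Finset.range n) fun k => a k * Y k u).symm
  · rw [Prod.snd_sum]
    exact (Finset.sum_coe_sort (Finset.range n) fun k => c k * Y k u).symm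

lemma integral_sum : ∫ u, ∑ k ∈ Finset.range n, a k * Y k u ∂P = 0 := by
  have := h.gaussian.isProbabilityMeasure
  rw [integral_finsetSum _ fun k _ => ((h.memLp k).integrable one_le_two).const_mul (a k)]
  simp [integral_const_mul, h.centered]

lemma integral_sum_mul_sum :
    ∫ u, (∑ k ∈ Finset.range n, a k * Y k u) * ∑ k ∈ Finset.range n, c k * Y k u ∂P = 0 := by
  have hi : ∀ k l, Integrable (fun u => a k * Y k u * (c l * Y l u)) P := fun k l =>
    ((h.memLp k).const_mul (a k)).integrable_mul ((h.memLp l).const_mul (c l))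
  simp_rw [Finset.sum_mul_sum]
  rw [integral_finsetSum _ fun k _ => integrable_finsetSum _ fun l _ => hi k l]
  refine Finset.sum_eq_zero fun k _ => ?_
  rw [integral_finsetSum _ fun l _ => hi k l]
  refine Finset.sum_eq_zero fun l _ => ?_
  have hm : ∀ u, a k * Y k u * (c l * Y l u) = a k * c l * (Y k u * Y l u) := fun u => by ring
  simp_rw [hm]
  rw [integral_const_mul, h.circular, mul_zero]

lemma integral_sum_mul_conj_sum [IsProbabilityMeasure F] :
    ∫ u, (∑ k ∈ Finset.range n, a k * Y k u) * conj (∑ k ∈ Finset.range n, c k * Y k u) ∂P =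
    ∫ t, (∑ k ∈ Finset.range n, a k * e k t) * conj (∑ k ∈ Finset.range n, c k * e k t) ∂F := by
  have hi : ∀ k l, Integrable (fun u => a k * conj (c l) * (Y k u * conj (Y l u))) P :=
    fun k l => ((h.memLp k).integrable_mul_conj (h.memLp l)).const_mul _
  have hj : ∀ k l, Integrable (fun t => a k * conj (c l) * (e k t * conj (e l t))) F :=
    fun k l => (h.integrable_mul_conj_kernel k l).const_mul _
  have hm : ∀ k l (v w : ℂ), a k * v * (conj (c l) * w) = a k * conj (c l) * (v * w) :=
    fun k l v w => by ring
  simp_rw [map_sum, map_mul, Finset.sum_mul_sum, hm]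
  rw [integral_finsetSum _ fun k _ => integrable_finsetSum _ fun l _ => hi k l,
    integral_finsetSum _ fun k _ => integrable_finsetSum _ fun l _ => hj k l]
  refine Finset.sum_congr rfl fun k _ => ?_
  rw [integral_finsetSum _ fun l _ => hi k l, integral_finsetSum _ fun l _ => hj k l]
  refine Finset.sum_congr rfl fun l _ => ?_
  rw [integral_const_mul, integral_const_mul, h.covariance]

end IsSpectralGaussian

/-- A Cauchy--Schwarz bound for the partial sums of a series with geometrically small weights. -/
lemma norm_sum_sq_le {a y : ℕ → ℂ} {C r : ℝ} (hr0 : 0 ≤ r) (hr1 : r < 1)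
    (ha : ∀ k, ‖a k‖ ≤ C * r ^ k) (n : ℕ) :
    ‖∑ k ∈ Finset.range n, a k * y k‖ ^ 2 ≤
      C ^ 2 / (1 - r) * ∑ k ∈ Finset.range n, ‖y k‖ ^ 2 * r ^ k := by
  have hC : 0 ≤ C := by simpa using (norm_nonneg _).trans (ha 0)
  have h1 : ‖∑ k ∈ Finset.range n, a k * y k‖ ≤
      C * ∑ k ∈ Finset.range n, √r ^ k * (√r ^ k * ‖y k‖) := by
    rw [Finset.mul_sum]
    refine norm_sum_le_of_le _ fun k _ => ?_
    have hsq : √r ^ k * √r ^ k = r ^ k := by rw [← mul_pow, Real.mul_self_sqrt hr0]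
    calc ‖a k * y k‖ = ‖a k‖ * ‖y k‖ := norm_mul _ _
      _ ≤ C * r ^ k * ‖y k‖ := by gcongr; exact ha k
      _ = C * (√r ^ k * (√r ^ k * ‖y k‖)) := by rw [← hsq]; ring
  -- The weight `r ^ k` is split evenly as `√r ^ k * √r ^ k`, so that one factor sums to a geometric
  -- series and the other keeps the weight `r ^ k` on the squares.
  have h2 := Finset.sum_mul_sq_le_sq_mul_sq (Finset.range n) (fun k => √r ^ k)
    (fun k => √r ^ k * ‖y k‖)
  have h3 : ∀ k : ℕ, (√r ^ k) ^ 2 = r ^ k := fun k => by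
    rw [← pow_mul, mul_comm, pow_mul, Real.sq_sqrt hr0]
  simp_rw [mul_pow, h3] at h2
  have h4 : ∑ k ∈ Finset.range n, r ^ k ≤ 1 / (1 - r) := by
    have := (summable_geometric_of_lt_one hr0 hr1).sum_le_tsum (Finset.range n)
      fun k _ => by positivity
    rwa [tsum_geometric_of_lt_one hr0 hr1, ← one_div] at this
  have h5 : 0 ≤ ∑ k ∈ Finset.range n, r ^ k * ‖y k‖ ^ 2 := Finset.sum_nonneg fun k _ => by positivity
  calc ‖∑ k ∈ Finset.range n, a k * y k‖ ^ 2
      ≤ (C * ∑ k ∈ Finset.range n, √r ^ k * (√r ^ k * ‖y k‖)) ^ 2 := by gcongr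
    _ = C ^ 2 * (∑ k ∈ Finset.range n, √r ^ k * (√r ^ k * ‖y k‖)) ^ 2 := by ring
    _ ≤ C ^ 2 * (1 / (1 - r) * ∑ k ∈ Finset.range n, r ^ k * ‖y k‖ ^ 2) := by
        gcongr
        exact h2.trans (by gcongr)
    _ = _ := by
        simp_rw [mul_comm (r ^ _)]
        ring

lemma summable_of_norm_le_geometric {a y : ℕ → ℂ} {C r : ℝ} (hr0 : 0 ≤ r) (hr1 : r < 1)
    (ha : ∀ k, ‖a k‖ ≤ C * r ^ k) (hy : y ∈ admissibleSeq) : Summable fun k => a k * y k := by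
  refine Summable.of_norm (((hy r hr0 hr1).mul_left C).of_nonneg_of_le (fun k => norm_nonneg _)
    fun k => ?_)
  rw [norm_mul]
  calc ‖a k‖ * ‖y k‖ ≤ C * r ^ k * ‖y k‖ := by gcongr; exact ha k
    _ = _ := by ring

lemma mem_admissibleSeq_of_norm_le {y : ℕ → ℂ} {B : ℝ} (hy : ∀ k, ‖y k‖ ≤ B) :
    y ∈ admissibleSeq := fun r hr0 hr1 =>
  ((summable_geometric_of_lt_one hr0 hr1).mul_left B).of_nonneg_of_le (fun k => by positivity)
    fun k => by gcongr; exact hy k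

namespace IsSpectralGaussian

variable (h : IsSpectralGaussian Y e P F)
include h

/-- All partial sums are bounded by `2 * C / (1 - r)`, so dominated convergence applies. This is how
the covariances of partial sums of Gaussian series converge. -/
lemma tendsto_integral_kernel [IsProbabilityMeasure F] {a c : ℕ → ℂ} {C r : ℝ} (hr0 : 0 ≤ r)
    (hr1 : r < 1) (ha : ∀ k, ‖a k‖ ≤ C * r ^ k) (hc : ∀ k, ‖c k‖ ≤ C * r ^ k) :
    Tendsto (fun n => ∫ t, (∑ k ∈ Finset.range n, a k * e k t) *
      conj (∑ k ∈ Finset.range n, c k * e k t) ∂F) atTop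
      (𝓝 (∫ t, (∑' k, a k * e k t) * conj (∑' k, c k * e k t) ∂F)) := by
  have hadm : ∀ t, (fun k => e k t) ∈ admissibleSeq := fun t =>
    mem_admissibleSeq_of_norm_le fun k => h.bound k t
  have hm : ∀ (b : ℕ → ℂ) n, Measurable fun t => ∑ k ∈ Finset.range n, b k * e k t := fun b n =>
    Finset.measurable_fun_sum _ fun k _ => (h.measurable k).const_mul _
  have hC : 0 ≤ C := by simpa using (norm_nonneg _).trans (ha 0)
  have hb : ∀ (b : ℕ → ℂ), (∀ k, ‖b k‖ ≤ C * r ^ k) → ∀ n t,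
      ‖∑ k ∈ Finset.range n, b k * e k t‖ ≤ 2 * C / (1 - r) := by
    intro b hb n t
    have hs := ((summable_geometric_of_lt_one hr0 hr1).mul_left (2 * C)).sum_le_tsum
      (Finset.range n) fun k _ => by positivity
    rw [tsum_mul_left, tsum_geometric_of_lt_one hr0 hr1, ← div_eq_mul_inv] at hs
    refine le_trans (norm_sum_le_of_le _ fun k _ => ?_) hs
    rw [norm_mul]
    calc ‖b k‖ * ‖e k t‖ ≤ (C * r ^ k) * 2 := by
          gcongr
          exacts [hb k, h.bound k t]
      _ = _ := by ring
  refine tendsto_integral_of_dominated_convergence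
    (fun _ => (2 * C / (1 - r)) * (2 * C / (1 - r)))
    (fun n => ((hm a n).mul (Complex.continuous_conj.measurable.comp
      (hm c n))).aestronglyMeasurable)
    (integrable_const _) (fun n => Eventually.of_forall fun t => ?_)
    (Eventually.of_forall fun t => ?_)
  · rw [norm_mul, RCLike.norm_conj]
    have h1 := hb a ha n t
    exact mul_le_mul h1 (hb c hc n t) (norm_nonneg _) ((norm_nonneg _).trans h1)
  · exact (summable_of_norm_le_geometric hr0 hr1 ha (hadm t)).hasSum.tendsto_sum_nat.mul
      ((Complex.continuous_conj.tendsto _).comp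
        (summable_of_norm_le_geometric hr0 hr1 hc (hadm t)).hasSum.tendsto_sum_nat)

/-- The Gaussian expectation in the Kac--Rice formula, for the sums of two series. -/
lemma lintegral_exp_neg_mul [IsProbabilityMeasure F] {a c : ℕ → ℂ} {C r : ℝ} (hr0 : 0 ≤ r)
    (hr1 : r < 1) (ha : ∀ k, ‖a k‖ ≤ C * r ^ k) (hc : ∀ k, ‖c k‖ ≤ C * r ^ k) {α δ : ℝ} {β : ℂ}
    (hα : ∫ t, (∑' k, a k * e k t) * conj (∑' k, a k * e k t) ∂F = α)
    (hβ : ∫ t, (∑' k, c k * e k t) * conj (∑' k, a k * e k t) ∂F = β)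
    (hδ : ∫ t, (∑' k, c k * e k t) * conj (∑' k, c k * e k t) ∂F = δ) :
    ∫⁻ u, ENNReal.ofReal (rexp (-‖∑' k, a k * Y k u‖ ^ 2)) * ‖∑' k, c k * Y k u‖ₑ ^ 2 ∂P =
      ENNReal.ofReal (δ / (1 + α) - ‖β‖ ^ 2 / (1 + α) ^ 2) := by
  have := h.gaussian.isProbabilityMeasure
  set S : (ℕ → ℂ) → ℕ → Ω → ℂ := fun b n u => ∑ k ∈ Finset.range n, b k * Y k u with hS
  set αn : ℕ → ℝ := fun n => ∫ u, ‖S a n u‖ ^ 2 ∂P with hαn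
  set δn : ℕ → ℝ := fun n => ∫ u, ‖S c n u‖ ^ 2 ∂P with hδn
  set βn : ℕ → ℂ := fun n => ∫ u, S c n u * conj (S a n u) ∂P with hβn
  have hreal : ∀ b n, ∫ u, S b n u * conj (S b n u) ∂P = ((∫ u, ‖S b n u‖ ^ 2 ∂P : ℝ) : ℂ) := by
    intro b n
    rw [← integral_complex_ofReal]
    refine integral_congr_ae (Eventually.of_forall fun u => ?_)
    dsimp only
    rw [Complex.mul_conj, Complex.normSq_eq_norm_sq]
  have hαt : Tendsto αn atTop (𝓝 α) := by
    have h1 := h.tendsto_integral_kernel hr0 hr1 ha ha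
    rw [hα] at h1
    have h2 := (Complex.continuous_re.tendsto _).comp h1
    refine h2.congr fun n => ?_
    rw [Function.comp_apply, ← h.integral_sum_mul_conj_sum, hreal, Complex.ofReal_re]
  have hδt : Tendsto δn atTop (𝓝 δ) := by
    have h1 := h.tendsto_integral_kernel hr0 hr1 hc hc
    rw [hδ] at h1
    have h2 := (Complex.continuous_re.tendsto _).comp h1
    refine h2.congr fun n => ?_
    rw [Function.comp_apply, ← h.integral_sum_mul_conj_sum, hreal, Complex.ofReal_re]
  have hβt : Tendsto βn atTop (𝓝 β) := by
    have h1 := h.tendsto_integral_kernel hr0 hr1 hc ha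
    rw [hβ] at h1
    exact h1.congr fun n => (h.integral_sum_mul_conj_sum c a n).symm
  have hα0 : 0 ≤ α := ge_of_tendsto' hαt fun n => integral_nonneg fun u => by positivity
  have hSm : ∀ b n, AEMeasurable (S b n) P := fun b n => (h.memLp_sum b n).aemeasurable
  have hexp1 : ∀ w : ℂ, rexp (-‖w‖ ^ 2) ≤ 1 := fun w => by
    rw [Real.exp_le_one_iff]
    nlinarith [norm_nonneg w]
  -- Only finite partial sums are directly Gaussian vectors; both sides are then passed to the
  -- limit, so no Gaussianity of the infinite sums is needed.
  have hfin : ∀ n, ∫⁻ u, ENNReal.ofReal (rexp (-‖S a n u‖ ^ 2)) * ‖S c n u‖ₑ ^ 2 ∂P =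
      ENNReal.ofReal (δn n / (1 + αn n) - ‖βn n‖ ^ 2 / (1 + αn n) ^ 2) := by
    intro n
    rw [← integral_exp_neg_norm_sq_mul_norm_sq (h.hasGaussianLaw_sum_prod a c n)
      (h.integral_sum a n) (h.integral_sum c n) (h.integral_sum_mul_sum a a n)
      (h.integral_sum_mul_sum c a n) (hreal a n) rfl (hreal c n),
      ofReal_integral_eq_lintegral_ofReal]
    · refine lintegral_congr fun u => ?_
      rw [ENNReal.ofReal_mul (Real.exp_pos _).le, ENNReal.ofReal_pow (norm_nonneg _), ofReal_norm]
    · refine (h.memLp_sum c n).norm.integrable_sq.bdd_mul (c := 1)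
        ((by fun_prop : Continuous fun w : ℂ => rexp (-‖w‖ ^ 2)).comp_aestronglyMeasurable
          (h.memLp_sum a n).aestronglyMeasurable) (Eventually.of_forall fun u => ?_)
      rw [Real.norm_eq_abs, abs_of_pos (Real.exp_pos _)]
      exact hexp1 _
    · exact Eventually.of_forall fun u => by positivity
  have hlim1 : Tendsto (fun n => ∫⁻ u, ENNReal.ofReal (rexp (-‖S a n u‖ ^ 2)) *
      ‖S c n u‖ₑ ^ 2 ∂P) atTop
      (𝓝 (ENNReal.ofReal (δ / (1 + α) - ‖β‖ ^ 2 / (1 + α) ^ 2))) := by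
    simp_rw [hfin]
    refine ENNReal.tendsto_ofReal ?_
    have h1 : 1 + α ≠ 0 := by positivity
    exact (hδt.div (hαt.const_add 1) h1).sub ((hβt.norm.pow 2).div ((hαt.const_add 1).pow 2)
      (pow_ne_zero 2 h1))
  have hlim2 : Tendsto (fun n => ∫⁻ u, ENNReal.ofReal (rexp (-‖S a n u‖ ^ 2)) *
      ‖S c n u‖ₑ ^ 2 ∂P) atTop (𝓝 (∫⁻ u, ENNReal.ofReal (rexp (-‖∑' k, a k * Y k u‖ ^ 2)) *
        ‖∑' k, c k * Y k u‖ₑ ^ 2 ∂P)) := by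
    -- The dominating function is the Cauchy–Schwarz bound `norm_sum_sq_le`, extended to the full
    -- series; the exponential factor is at most 1.
    refine tendsto_lintegral_of_dominated_convergence' (fun u => ENNReal.ofReal (C ^ 2 / (1 - r)) *
      ∑' k, ‖Y k u‖ₑ ^ 2 * ENNReal.ofReal r ^ k) (fun n => ?_)
      (fun n => Eventually.of_forall fun u => ?_) ?_ ?_
    · exact ((by fun_prop : Measurable fun w : ℂ => ENNReal.ofReal (rexp (-‖w‖ ^ 2))
        ).comp_aemeasurable (hSm a n)).mul ((hSm c n).enorm.pow_const 2)
    · have h1 : ENNReal.ofReal (rexp (-‖S a n u‖ ^ 2)) ≤ 1 := by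
        rw [ENNReal.ofReal_le_one]
        exact hexp1 _
      have hpos : 0 ≤ C ^ 2 / (1 - r) := div_nonneg (sq_nonneg C) (sub_pos.2 hr1).le
      calc ENNReal.ofReal (rexp (-‖S a n u‖ ^ 2)) * ‖S c n u‖ₑ ^ 2 ≤ 1 * ‖S c n u‖ₑ ^ 2 := by gcongr
        _ = ENNReal.ofReal (‖S c n u‖ ^ 2) := by
            rw [one_mul, ENNReal.ofReal_pow (norm_nonneg _), ofReal_norm]
        _ ≤ ENNReal.ofReal (C ^ 2 / (1 - r) * ∑ k ∈ Finset.range n, ‖Y k u‖ ^ 2 * r ^ k) :=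
            ENNReal.ofReal_le_ofReal (norm_sum_sq_le (y := fun k => Y k u) hr0 hr1 hc n)
        _ = ENNReal.ofReal (C ^ 2 / (1 - r)) *
              ∑ k ∈ Finset.range n, ‖Y k u‖ₑ ^ 2 * ENNReal.ofReal r ^ k := by
            rw [ENNReal.ofReal_mul hpos, ENNReal.ofReal_sum_of_nonneg fun k _ => by positivity]
            congr 1
            refine Finset.sum_congr rfl fun k _ => ?_
            rw [ENNReal.ofReal_mul (by positivity), ENNReal.ofReal_pow (norm_nonneg _),
              ofReal_norm, ENNReal.ofReal_pow hr0]
        _ ≤ _ := by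
            exact mul_le_mul_right (ENNReal.sum_le_tsum _) _
    · rw [lintegral_const_mul'' _ (AEMeasurable.tsum fun k =>
        ((h.gaussian.aemeasurable k).enorm.pow_const 2).mul_const _)]
      exact (ENNReal.mul_lt_top ENNReal.ofReal_lt_top (h.lintegral_tsum_lt_top hr1)).ne
    · filter_upwards [h.ae_mem_admissibleSeq] with u hu
      have hta := (summable_of_norm_le_geometric hr0 hr1 ha hu).hasSum.tendsto_sum_nat
      have htc := (summable_of_norm_le_geometric hr0 hr1 hc hu).hasSum.tendsto_sum_nat
      refine ENNReal.Tendsto.mul (ENNReal.tendsto_ofReal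
        (((by fun_prop : Continuous fun w : ℂ => rexp (-‖w‖ ^ 2)).tendsto _).comp hta))
        (Or.inr (by simp)) ?_ (Or.inr ENNReal.ofReal_ne_top)
      exact (((by fun_prop : Continuous fun w : ℂ => ‖w‖ₑ ^ 2).tendsto _).comp htc)
  exact tendsto_nhds_unique hlim2 hlim1

end IsSpectralGaussian

end GaussianSeries

/-! ### The spectral kernels and the intensity -/

/-- The kernel `1 / (1 - z e^{-it})`. -/
def spectralKernel (z : ℂ) (t : ℝ) : ℂ := (1 - z * Complex.exp (-(Complex.I * t)))⁻¹

/-- The derivative in `z` of the kernel `1 / (1 - z e^{-it})`. -/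
def spectralKernelDeriv (z : ℂ) (t : ℝ) : ℂ :=
  Complex.exp (-(Complex.I * t)) * spectralKernel z t ^ 2

/-- The first intensity of the zeros, in terms of the spectral measure. -/
def zeroIntensity (F : Measure ℝ) (z : ℂ) : ℝ :=
  π⁻¹ * (((∫ t, ‖spectralKernel z t‖ ^ 2 ∂F) * (∫ t, ‖spectralKernelDeriv z t‖ ^ 2 ∂F) -
    ‖∫ t, spectralKernelDeriv z t * conj (spectralKernel z t) ∂F‖ ^ 2) /
      (∫ t, ‖spectralKernel z t‖ ^ 2 ∂F) ^ 2)

lemma norm_exp_neg_I_mul (t : ℝ) : ‖Complex.exp (-(Complex.I * t))‖ = 1 := by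
  rw [← mul_neg, ← Complex.ofReal_neg, mul_comm, Complex.norm_exp_ofReal_mul_I]

section Kernel

variable {z : ℂ}

lemma norm_mul_exp_lt_one (hz : ‖z‖ < 1) (t : ℝ) : ‖z * Complex.exp (-(Complex.I * t))‖ < 1 := by
  rwa [norm_mul, norm_exp_neg_I_mul, mul_one]

lemma one_sub_mul_exp_ne_zero (hz : ‖z‖ < 1) (t : ℝ) :
    1 - z * Complex.exp (-(Complex.I * t)) ≠ 0 := fun h => by
  have := norm_mul_exp_lt_one hz t
  rw [← sub_eq_zero.1 h] at this
  simp at this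

lemma norm_spectralKernel_le {r : ℝ} (hr : r < 1) (hz : ‖z‖ ≤ r) (t : ℝ) :
    ‖spectralKernel z t‖ ≤ (1 - r)⁻¹ := by
  rw [spectralKernel, norm_inv]
  refine inv_anti₀ (sub_pos.2 hr) ?_
  calc 1 - r ≤ ‖(1 : ℂ)‖ - ‖z * Complex.exp (-(Complex.I * t))‖ := by
        rw [norm_one, norm_mul, norm_exp_neg_I_mul, mul_one]
        linarith
    _ ≤ _ := norm_sub_norm_le _ _

lemma norm_spectralKernelDeriv_le {r : ℝ} (hr : r < 1) (hz : ‖z‖ ≤ r) (t : ℝ) :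
    ‖spectralKernelDeriv z t‖ ≤ (1 - r)⁻¹ ^ 2 := by
  rw [spectralKernelDeriv, norm_mul, norm_exp_neg_I_mul, one_mul, norm_pow]
  gcongr
  exact norm_spectralKernel_le hr hz t

/-- The map `w ↦ 1 / (1 - w)` sends the unit disk to the half plane `Re > 1/2`. Averaged over `F`,
this keeps both the covariance series and the denominator of the intensity away from 0. -/
lemma half_le_re_spectralKernel (hz : ‖z‖ < 1) (t : ℝ) : 1 / 2 ≤ (spectralKernel z t).re := by
  set w := z * Complex.exp (-(Complex.I * t)) with hw
  have h1 : ‖w‖ < 1 := norm_mul_exp_lt_one hz t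
  have h2 : 0 < Complex.normSq (1 - w) := Complex.normSq_pos.2 (one_sub_mul_exp_ne_zero hz t)
  have h3 : Complex.normSq w < 1 := by
    rw [Complex.normSq_eq_norm_sq]
    nlinarith [norm_nonneg w]
  rw [spectralKernel, ← hw, Complex.inv_re, le_div_iff₀ h2]
  rw [Complex.normSq_apply] at h3 ⊢
  simp only [Complex.sub_re, Complex.sub_im, Complex.one_re, Complex.one_im]
  nlinarith

lemma measurable_spectralKernel (z : ℂ) : Measurable (spectralKernel z) := by
  unfold spectralKernel
  fun_prop

lemma measurable_spectralKernelDeriv (z : ℂ) : Measurable (spectralKernelDeriv z) := by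
  unfold spectralKernelDeriv
  have := measurable_spectralKernel z
  fun_prop

lemma powerSum_exp (hz : ‖z‖ < 1) (t : ℝ) :
    powerSum (fun k => Complex.exp (-(Complex.I * t)) ^ k) z = spectralKernel z t := by
  simp_rw [powerSum, ← mul_pow]
  rw [tsum_geometric_of_norm_lt_one (by rw [mul_comm]; exact norm_mul_exp_lt_one hz t),
    spectralKernel, mul_comm]

lemma exp_pow_mem_admissibleSeq (t : ℝ) :
    (fun k : ℕ => Complex.exp (-(Complex.I * t)) ^ k) ∈ admissibleSeq :=
  mem_admissibleSeq_of_norm_le (B := 1) fun k => by rw [norm_pow, norm_exp_neg_I_mul, one_pow]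

lemma hasDerivAt_spectralKernel (hz : ‖z‖ < 1) (t : ℝ) :
    HasDerivAt (fun w => spectralKernel w t) (spectralKernelDeriv z t) z := by
  unfold spectralKernelDeriv spectralKernel
  have h := (((hasDerivAt_id z).mul_const (Complex.exp (-(Complex.I * t)))).const_sub 1).inv
    (one_sub_mul_exp_ne_zero hz t)
  convert! h using 1
  simp only [id, one_mul, neg_neg, inv_pow]
  rw [div_eq_mul_inv]

lemma deriv_powerSum_exp (hz : ‖z‖ < 1) (t : ℝ) :
    deriv (powerSum fun k => Complex.exp (-(Complex.I * t)) ^ k) z = spectralKernelDeriv z t := by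
  rw [← (hasDerivAt_spectralKernel hz t).deriv]
  refine Filter.EventuallyEq.deriv_eq ?_
  filter_upwards [Metric.isOpen_ball.mem_nhds (mem_ball_zero_iff.2 hz)] with w hw
  exact powerSum_exp (mem_ball_zero_iff.1 hw) t

end Kernel

/-! ### Continuity and nonnegativity of the intensity formula -/

section Intensity

variable {F : Measure ℝ} [IsProbabilityMeasure F] {z : ℂ}

/-- For fixed `z` both kernels take values in a compact polydisk, on which `Φ` is bounded. A general
`Φ` covers all the norms and cross products at once; the continuity statement below works the same
way. -/
lemma integrable_comp_kernels {E : Type*} [NormedAddCommGroup E] [NormedSpace ℝ E]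
    [SecondCountableTopology E] [MeasurableSpace E] [BorelSpace E]
    {Φ : ℂ × ℂ → E} (hΦ : Continuous Φ) (hz : ‖z‖ < 1) :
    Integrable (fun t => Φ (spectralKernel z t, spectralKernelDeriv z t)) F := by
  obtain ⟨B, hB⟩ := ((isCompact_closedBall (0 : ℂ) (1 - ‖z‖)⁻¹).prod
    (isCompact_closedBall (0 : ℂ) ((1 - ‖z‖)⁻¹ ^ 2))).exists_bound_of_continuousOn hΦ.continuousOn
  refine Integrable.of_bound (C := B) (hΦ.measurable.comp ((measurable_spectralKernel z).prodMk
    (measurable_spectralKernelDeriv z))).aestronglyMeasurable (Eventually.of_forall fun t => ?_)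
  exact hB _ ⟨mem_closedBall_zero_iff.2 (norm_spectralKernel_le hz le_rfl t),
    mem_closedBall_zero_iff.2 (norm_spectralKernelDeriv_le hz le_rfl t)⟩

lemma continuousOn_integral_comp_kernels {E : Type*} [NormedAddCommGroup E] [NormedSpace ℝ E]
    [SecondCountableTopology E] [MeasurableSpace E] [BorelSpace E]
    {Φ : ℂ × ℂ → E} (hΦ : Continuous Φ) :
    ContinuousOn (fun z => ∫ t, Φ (spectralKernel z t, spectralKernelDeriv z t) ∂F)
      (Metric.ball 0 1) := by
  intro z hz
  refine ContinuousAt.continuousWithinAt ?_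
  obtain ⟨r, hzr, hr1⟩ := exists_between (mem_ball_zero_iff.1 hz)
  obtain ⟨B, hB⟩ := ((isCompact_closedBall (0 : ℂ) (1 - r)⁻¹).prod
    (isCompact_closedBall (0 : ℂ) ((1 - r)⁻¹ ^ 2))).exists_bound_of_continuousOn hΦ.continuousOn
  refine continuousAt_of_dominated (bound := fun _ => B) (Eventually.of_forall fun w =>
    (hΦ.measurable.comp ((measurable_spectralKernel w).prodMk
      (measurable_spectralKernelDeriv w))).aestronglyMeasurable) ?_ (integrable_const _)
    (Eventually.of_forall fun t => ?_)
  · filter_upwards [Metric.isOpen_ball.mem_nhds (mem_ball_zero_iff.2 hzr)] with w hw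
    have hw' := (mem_ball_zero_iff.1 hw).le
    exact Eventually.of_forall fun t => hB _
      ⟨mem_closedBall_zero_iff.2 (norm_spectralKernel_le hr1 hw' t),
        mem_closedBall_zero_iff.2 (norm_spectralKernelDeriv_le hr1 hw' t)⟩
  · have h1 := (hasDerivAt_spectralKernel (mem_ball_zero_iff.1 hz) t).continuousAt
    exact hΦ.continuousAt.comp (h1.prodMk (continuousAt_const.mul (h1.pow 2)))

lemma integral_norm_spectralKernel_sq_pos (hz : ‖z‖ < 1) :
    0 < ∫ t, ‖spectralKernel z t‖ ^ 2 ∂F := by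
  have h1 : ∫ _, (1 / 4 : ℝ) ∂F ≤ ∫ t, ‖spectralKernel z t‖ ^ 2 ∂F := by
    refine integral_mono (integrable_const _)
      (integrable_comp_kernels (Φ := fun q => ‖q.1‖ ^ 2) (by fun_prop) hz) fun t => ?_
    have := (half_le_re_spectralKernel hz t).trans (Complex.re_le_norm _)
    dsimp only
    nlinarith
  simp only [integral_const, probReal_univ, smul_eq_mul, one_mul] at h1
  linarith

lemma continuousOn_zeroIntensity : ContinuousOn (zeroIntensity F) (Metric.ball 0 1) := by
  have h1 := continuousOn_integral_comp_kernels (F := F) (Φ := fun q => ‖q.1‖ ^ 2) (by fun_prop)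
  have h2 := continuousOn_integral_comp_kernels (F := F) (Φ := fun q => ‖q.2‖ ^ 2) (by fun_prop)
  have h3 := continuousOn_integral_comp_kernels (F := F) (Φ := fun q => q.2 * conj q.1)
    (by fun_prop)
  refine continuousOn_const.mul (((h1.mul h2).sub (h3.norm.pow 2)).div (h1.pow 2) fun z hz => ?_)
  exact pow_ne_zero 2 (integral_norm_spectralKernel_sq_pos (mem_ball_zero_iff.1 hz)).ne'

/-- Sesquilinear expansion of the scalar product of two combinations of the kernels and `1`. -/
lemma integral_kernels_mul_conj (hz : ‖z‖ < 1) (p₁ p₂ p₃ q₁ q₂ q₃ : ℂ) :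
    ∫ t, (p₁ * spectralKernel z t + p₂ * spectralKernelDeriv z t + p₃) *
      conj (q₁ * spectralKernel z t + q₂ * spectralKernelDeriv z t + q₃) ∂F =
    p₁ * conj q₁ * ((∫ t, ‖spectralKernel z t‖ ^ 2 ∂F : ℝ) : ℂ) +
    p₂ * conj q₂ * ((∫ t, ‖spectralKernelDeriv z t‖ ^ 2 ∂F : ℝ) : ℂ) +
    p₂ * conj q₁ * (∫ t, spectralKernelDeriv z t * conj (spectralKernel z t) ∂F) +
    p₁ * conj q₂ * conj (∫ t, spectralKernelDeriv z t * conj (spectralKernel z t) ∂F) +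
    p₁ * conj q₃ * (∫ t, spectralKernel z t ∂F) +
    p₂ * conj q₃ * (∫ t, spectralKernelDeriv z t ∂F) +
    p₃ * conj q₁ * conj (∫ t, spectralKernel z t ∂F) +
    p₃ * conj q₂ * conj (∫ t, spectralKernelDeriv z t ∂F) + p₃ * conj q₃ := by
  have key : ∀ {Φ : ℂ × ℂ → ℂ}, Continuous Φ → ∀ c : ℂ, Integrable
      (fun t => c * Φ (spectralKernel z t, spectralKernelDeriv z t)) F :=
    fun hΦ c => (integrable_comp_kernels hΦ hz).const_mul c
  have i1 := key (Φ := fun q => ((‖q.1‖ ^ 2 : ℝ) : ℂ)) (by fun_prop) (p₁ * conj q₁)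
  have i2 := key (Φ := fun q => ((‖q.2‖ ^ 2 : ℝ) : ℂ)) (by fun_prop) (p₂ * conj q₂)
  have i3 := key (Φ := fun q => q.2 * conj q.1) (by fun_prop) (p₂ * conj q₁)
  have i4 := key (Φ := fun q => conj (q.2 * conj q.1)) (by fun_prop) (p₁ * conj q₂)
  have i5 := key (Φ := fun q => q.1) (by fun_prop) (p₁ * conj q₃)
  have i6 := key (Φ := fun q => q.2) (by fun_prop) (p₂ * conj q₃)
  have i7 := key (Φ := fun q => conj q.1) (by fun_prop) (p₃ * conj q₁)
  have i8 := key (Φ := fun q => conj q.2) (by fun_prop) (p₃ * conj q₂)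
  have i9 : Integrable (fun _ : ℝ => p₃ * conj q₃) F := integrable_const _
  have e : ∀ {f g : ℝ → ℂ} {c : ℂ}, Integrable f F → Integrable g F → ∫ t, f t ∂F = c →
      ∫ t, (f + g) t ∂F = c + ∫ t, g t ∂F := fun hf hg hc => by rw [integral_add' hf hg, hc]
  have j2 := i1.add i2
  have j3 := j2.add i3
  have j4 := j3.add i4
  have j5 := j4.add i5
  have j6 := j5.add i6
  have j7 := j6.add i7
  have h := e (j7.add i8) i9 <| e j7 i8 <| e j6 i7 <| e j5 i6 <| e j4 i5 <| e j3 i4 <|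
    e j2 i3 <| e i1 i2 rfl
  simp only [integral_const_mul, integral_conj, integral_complex_ofReal, integral_const,
    probReal_univ, one_smul] at h
  rw [← h]
  refine integral_congr_ae (Eventually.of_forall fun t => ?_)
  simp only [Pi.add_apply, ← Complex.normSq_eq_norm_sq, Complex.normSq_eq_conj_mul_self, map_add,
    map_mul, Complex.conj_conj]
  ring

/-- Cauchy–Schwarz in `L²(F)`: the squared norm of `N K' - M K` equals `N (N D - |M|²)`, and `N >
0`. -/
lemma zeroIntensity_nonneg (hz : ‖z‖ < 1) : 0 ≤ zeroIntensity F z := by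
  have hN := integral_norm_spectralKernel_sq_pos (F := F) hz
  have h := integral_kernels_mul_conj (F := F) hz
    (-∫ t, spectralKernelDeriv z t * conj (spectralKernel z t) ∂F)
    ((∫ t, ‖spectralKernel z t‖ ^ 2 ∂F : ℝ) : ℂ) 0
    (-∫ t, spectralKernelDeriv z t * conj (spectralKernel z t) ∂F)
    ((∫ t, ‖spectralKernel z t‖ ^ 2 ∂F : ℝ) : ℂ) 0
  unfold zeroIntensity
  set N := ∫ t, ‖spectralKernel z t‖ ^ 2 ∂F with hNdef
  set D := ∫ t, ‖spectralKernelDeriv z t‖ ^ 2 ∂F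
  set M := ∫ t, spectralKernelDeriv z t * conj (spectralKernel z t) ∂F
  have h1 : ∀ w : ℂ, w * conj w = ((‖w‖ ^ 2 : ℝ) : ℂ) := fun w => by
    rw [Complex.mul_conj, Complex.normSq_eq_norm_sq]
  simp_rw [h1] at h
  rw [integral_complex_ofReal] at h
  have h2 : 0 ≤ ∫ t, ‖-M * spectralKernel z t + N * spectralKernelDeriv z t + 0‖ ^ 2 ∂F :=
    integral_nonneg fun t => by positivity
  have h3 : ∫ t, ‖-M * spectralKernel z t + N * spectralKernelDeriv z t + 0‖ ^ 2 ∂F =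
      N * (N * D - ‖M‖ ^ 2) := by
    have h4 : ((∫ t, ‖-M * spectralKernel z t + N * spectralKernelDeriv z t + 0‖ ^ 2 ∂F : ℝ) : ℂ) =
        ((N * (N * D - ‖M‖ ^ 2) : ℝ) : ℂ) := by
      rw [h]
      push_cast
      have h5 := h1 M
      push_cast at h5
      simp only [norm_neg, map_neg, Complex.conj_ofReal, map_zero, Complex.norm_real, norm_zero,
        Real.norm_eq_abs, ← Complex.ofReal_pow, sq_abs]
      push_cast
      linear_combination (-2 * (N : ℂ)) * h5
    exact_mod_cast h4
  rw [h3] at h2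
  have h6 : 0 ≤ N * D - ‖M‖ ^ 2 := nonneg_of_mul_nonneg_right h2 hN
  positivity

end Intensity

/-! ### The decomposition of the Gaussian power series -/

section Decomposition

/-- The measure is arbitrary because the expansion is used twice, for the process under `P` and for
the exponentials under `F`; comparing the two gives the covariances of the innovations. -/
lemma integral_sub_mul_conj_sub {α : Type*} [MeasurableSpace α] {μ : Measure α}
    {A A' B B' : α → ℂ} (hA : MemLp A 2 μ) (hA' : MemLp A' 2 μ) (hB : MemLp B 2 μ)
    (hB' : MemLp B' 2 μ) (g g' : ℂ) :
    ∫ x, (A x - g * B x) * conj (A' x - g' * B' x) ∂μ =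
      (∫ x, A x * conj (A' x) ∂μ) - g * (∫ x, B x * conj (A' x) ∂μ) -
        conj g' * (∫ x, A x * conj (B' x) ∂μ) + g * conj g' * ∫ x, B x * conj (B' x) ∂μ := by
  have i1 := hA.integrable_mul_conj hA'
  have i2 := (hB.integrable_mul_conj hA').const_mul g
  have i3 := (hA.integrable_mul_conj hB').const_mul (conj g')
  have i4 := (hB.integrable_mul_conj hB').const_mul (g * conj g')
  have h : ∀ x, (A x - g * B x) * conj (A' x - g' * B' x) =
      ((A x * conj (A' x) - g * (B x * conj (A' x))) - conj g' * (A x * conj (B' x))) +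
        g * conj g' * (B x * conj (B' x)) := fun x => by
    simp only [map_sub, map_mul]
    ring
  simp_rw [h]
  have i12 : Integrable (fun x => A x * conj (A' x) - g * (B x * conj (A' x))) μ := i1.sub i2
  have i123 : Integrable (fun x => A x * conj (A' x) - g * (B x * conj (A' x)) -
      conj g' * (A x * conj (B' x))) μ := i12.sub i3
  rw [integral_add i123 i4, integral_sub i12 i3, integral_sub i1 i2, integral_const_mul,
    integral_const_mul, integral_const_mul]

variable {Ω : Type*} [MeasurableSpace Ω] {P : Measure Ω} {ξ : ℤ → Ω → ℂ} {γ : ℤ → ℂ}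
  {F : Measure ℝ}

lemma IsStationaryComplexGaussian.memLp (hξ : IsStationaryComplexGaussian ξ γ P) (k : ℤ) :
    MemLp (ξ k) 2 P := (hξ.gaussian.hasGaussianLaw_eval k).memLp_two

lemma IsSpectralMeasure.eq_integral_exp_pow (hF : IsSpectralMeasure F γ) (k : ℕ) :
    γ k = ∫ t : ℝ, Complex.exp (-(Complex.I * t)) ^ k ∂F := by
  rw [hF.fourier]
  refine integral_congr_ae (Eventually.of_forall fun t => ?_)
  dsimp only
  rw [← Complex.exp_nat_mul]
  congr 1
  push_cast
  ring

lemma IsSpectralMeasure.norm_le_one (hF : IsSpectralMeasure F γ) (k : ℕ) : ‖γ k‖ ≤ 1 := by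
  have := hF.isProbabilityMeasure
  rw [hF.eq_integral_exp_pow]
  refine (norm_integral_le_integral_norm _).trans ?_
  simp_rw [norm_pow, norm_exp_neg_I_mul, one_pow]
  simp

lemma IsSpectralMeasure.apply_zero (hF : IsSpectralMeasure F γ) : γ 0 = 1 := by
  have := hF.isProbabilityMeasure
  have := hF.eq_integral_exp_pow 0
  simpa using this

lemma memLp_exp_pow [IsProbabilityMeasure F] (k : ℕ) :
    MemLp (fun t : ℝ => Complex.exp (-(Complex.I * t)) ^ k) 2 F := by
  refine MemLp.of_bound (C := 1) (by fun_prop : Continuous _).aestronglyMeasurable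
    (Eventually.of_forall fun t => ?_)
  rw [norm_pow, norm_exp_neg_I_mul, one_pow]

lemma IsSpectralMeasure.integral_exp_pow_mul_conj (hF : IsSpectralMeasure F γ) (k l : ℕ) :
    ∫ t : ℝ, Complex.exp (-(Complex.I * t)) ^ k * conj (Complex.exp (-(Complex.I * t)) ^ l) ∂F =
      γ (k - l) := by
  rw [hF.fourier]
  refine integral_congr_ae (Eventually.of_forall fun t => ?_)
  simp only [← Complex.exp_nat_mul, ← Complex.exp_conj, ← Complex.exp_add, map_mul, map_neg,
    Complex.conj_I, Complex.conj_ofReal, map_natCast]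
  congr 1
  push_cast
  ring

/-- The part of the process which is independent of `ξ 0`. -/
def innovation (ξ : ℤ → Ω → ℂ) (γ : ℤ → ℂ) (k : ℕ) (u : Ω) : ℂ := ξ k u - γ k * ξ 0 u

/-- The spectral representation of `innovation`. -/
def innovationKernel (γ : ℤ → ℂ) (k : ℕ) (t : ℝ) : ℂ := Complex.exp (-(Complex.I * t)) ^ k - γ k

lemma exists_innovation_eq {Ω : Type*} {ξ : ℤ → Ω → ℂ} {γ : ℤ → ℂ} (k : ℕ) : ∃ (I : Finset ℤ) (L : (I → ℂ) →L[ℝ] ℂ),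
    ∀ u, innovation ξ γ k u = L (I.restrict (ξ · u)) := by
  let I : Finset ℤ := {(k : ℤ), 0}
  let p : (I → ℂ) →L[ℝ] ℂ := ContinuousLinearMap.proj ⟨k, by simp [I]⟩
  let q : (I → ℂ) →L[ℝ] ℂ := ContinuousLinearMap.proj ⟨0, by simp [I]⟩
  exact ⟨I, p - (ContinuousLinearMap.mul ℝ ℂ (γ k)).comp q, fun u => rfl⟩

/-- The correspondence between `ξ k` and `e^{-ikt}` preserves scalar products, and `ξ 0` corresponds
to the constant 1. So removing `γ k * ξ 0` amounts to subtracting the constant `γ k` from the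
exponential, which also gives the bound `2 = 1 + 1`. -/
lemma isSpectralGaussian_innovation (hξ : IsStationaryComplexGaussian ξ γ P)
    (hF : IsSpectralMeasure F γ) :
    IsSpectralGaussian (innovation ξ γ) (innovationKernel γ) P F := by
  have := hF.isProbabilityMeasure
  have := hξ.gaussian.isProbabilityMeasure
  refine ⟨?_, fun k => ?_, fun k l => ?_, fun k => ?_, fun k t => ?_, fun k l => ?_⟩
  · exact hξ.gaussian.of_isGaussianProcess exists_innovation_eq
  · unfold innovation
    rw [integral_sub ((hξ.memLp k).integrable one_le_two)
      (((hξ.memLp 0).integrable one_le_two).const_mul _), integral_const_mul, hξ.centered,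
      hξ.centered]
    simp
  · have hi : ∀ k l : ℤ, Integrable (fun u => ξ k u * ξ l u) P := fun k l =>
      (hξ.memLp k).integrable_mul (hξ.memLp l)
    have h : ∀ u, innovation ξ γ k u * innovation ξ γ l u = ((ξ k u * ξ l u -
        γ k * (ξ 0 u * ξ l u)) - γ l * (ξ k u * ξ 0 u)) + γ k * γ l * (ξ 0 u * ξ 0 u) :=
      fun u => by unfold innovation; ring
    simp_rw [h]
    have i12 : Integrable (fun u => ξ k u * ξ l u - γ k * (ξ 0 u * ξ l u)) P :=
      (hi k l).sub ((hi 0 l).const_mul _)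
    have i123 : Integrable (fun u => ξ k u * ξ l u - γ k * (ξ 0 u * ξ l u) -
        γ l * (ξ k u * ξ 0 u)) P := i12.sub ((hi k 0).const_mul _)
    rw [integral_add i123 ((hi 0 0).const_mul _), integral_sub i12 ((hi k 0).const_mul _),
      integral_sub (hi k l) ((hi 0 l).const_mul _), integral_const_mul, integral_const_mul,
      integral_const_mul]
    simp [hξ.circular]
  · unfold innovationKernel
    fun_prop
  · unfold innovationKernel
    refine (norm_sub_le _ _).trans ?_
    rw [norm_pow, norm_exp_neg_I_mul, one_pow]
    linarith [hF.norm_le_one k]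
  · have h1 := integral_sub_mul_conj_sub (hξ.memLp k) (hξ.memLp l) (hξ.memLp 0) (hξ.memLp 0)
      (γ k) (γ l)
    have h2 := integral_sub_mul_conj_sub (memLp_exp_pow (F := F) k) (memLp_exp_pow (F := F) l)
      (memLp_exp_pow (F := F) 0) (memLp_exp_pow (F := F) 0) (γ k) (γ l)
    simp only [hξ.covariance] at h1
    simp only [hF.integral_exp_pow_mul_conj, Nat.cast_zero] at h2
    refine h1.trans (Eq.trans h2.symm ?_)
    simp only [pow_zero, mul_one]
    rfl

/-- The innovations are independent of `ξ 0`. -/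
lemma indepFun_innovation (hξ : IsStationaryComplexGaussian ξ γ P) (hF : IsSpectralMeasure F γ) :
    IndepFun (fun u k => innovation ξ γ k u) (ξ 0) P := by
  have := hξ.gaussian.isProbabilityMeasure
  have hS := isSpectralGaussian_innovation hξ hF
  -- Indexing the innovations and `ξ 0` together by `ℕ ⊕ Unit` makes them one Gaussian process, for
  -- which independence of the two blocks reduces to vanishing covariances.
  have hG : IsGaussianProcess (Sum.elim (innovation ξ γ) fun _ : Unit => ξ 0) P := by
    refine hξ.gaussian.of_isGaussianProcess fun s => ?_
    rcases s with k | s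
    · exact exists_innovation_eq k
    · exact ⟨{0}, ContinuousLinearMap.proj (⟨0, by simp⟩ : ({(0 : ℤ)} : Finset ℤ)), fun u => rfl⟩
  have hi : ∀ k l : ℤ, Integrable (fun u => ξ k u * ξ l u) P := fun k l =>
    (hξ.memLp k).integrable_mul (hξ.memLp l)
  have h := hG.indepFun_of_covariance_inner (fun k => hS.gaussian.aemeasurable k)
    (fun _ => hξ.gaussian.aemeasurable 0) fun k _ x y => by
      have h1 : ∫ u, innovation ξ γ k u * ξ 0 u ∂P = 0 := by
        unfold innovation
        simp_rw [sub_mul, mul_assoc]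
        rw [integral_sub (hi k 0) ((hi 0 0).const_mul _), integral_const_mul, hξ.circular,
          hξ.circular]
        simp
      have h2 : ∫ u, innovation ξ γ k u * conj (ξ 0 u) ∂P = 0 := by
        unfold innovation
        simp_rw [sub_mul, mul_assoc]
        rw [integral_sub ((hξ.memLp k).integrable_mul_conj (hξ.memLp 0))
          (((hξ.memLp 0).integrable_mul_conj (hξ.memLp 0)).const_mul _), integral_const_mul,
          hξ.covariance, hξ.covariance, sub_zero, sub_zero, hF.apply_zero]
        simp
      rw [covariance_inner_inner (hS.memLp k) (hξ.memLp 0) (hS.centered k), h1, h2]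
      simp
  exact h.comp measurable_id (measurable_pi_apply ())

lemma map_apply_zero (hξ : IsStationaryComplexGaussian ξ γ P) (hF : IsSpectralMeasure F γ) :
    P.map (ξ 0) = volume.withDensity fun c => ENNReal.ofReal (complexGaussianPDF 1 c) := by
  refine (hξ.gaussian.hasGaussianLaw_eval 0).map_eq_withDensity_complex (hξ.centered 0)
    (hξ.circular 0 0) one_pos ?_
  rw [hξ.covariance, sub_zero, hF.apply_zero, Complex.ofReal_one]

/-! ### The covariance power series -/

section CovarianceSeries

variable {z : ℂ}

/-- The covariances with nonnegative index. -/
def covSeq (γ : ℤ → ℂ) (k : ℕ) : ℂ := γ k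

lemma covSeq_mem_admissibleSeq (hF : IsSpectralMeasure F γ) : covSeq γ ∈ admissibleSeq :=
  mem_admissibleSeq_of_norm_le hF.norm_le_one

lemma integrable_exp_pow_mul [IsProbabilityMeasure F] (k : ℕ) (w : ℂ) :
    Integrable (fun t : ℝ => Complex.exp (-(Complex.I * t)) ^ k * w) F :=
  ((memLp_exp_pow k).integrable one_le_two).mul_const w

lemma powerSum_covSeq (hF : IsSpectralMeasure F γ) (hz : ‖z‖ < 1) :
    powerSum (covSeq γ) z = ∫ t, spectralKernel z t ∂F := by
  have := hF.isProbabilityMeasure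
  have h := hasSum_integral_of_summable_integral_norm
    (fun k => integrable_exp_pow_mul (F := F) k (z ^ k)) (by
      simp_rw [norm_mul, norm_pow, norm_exp_neg_I_mul, one_pow, one_mul]
      simpa using summable_geometric_of_lt_one (norm_nonneg z) hz)
  simp_rw [integral_mul_const, ← hF.eq_integral_exp_pow] at h
  refine h.tsum_eq.trans (integral_congr_ae (Eventually.of_forall fun t => powerSum_exp hz t))

lemma deriv_powerSum_covSeq (hF : IsSpectralMeasure F γ) (hz : ‖z‖ < 1) :
    deriv (powerSum (covSeq γ)) z = ∫ t, spectralKernelDeriv z t ∂F := by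
  have := hF.isProbabilityMeasure
  have h := hasSum_integral_of_summable_integral_norm
    (fun k => integrable_exp_pow_mul (F := F) k (k * z ^ (k - 1))) (by
      simp_rw [norm_mul, norm_pow, norm_exp_neg_I_mul, one_pow, one_mul]
      have := (hasSum_deriv_powerSum (x := fun _ => 1) (z := ‖z‖)
        (mem_admissibleSeq_of_norm_le (B := 1) (by simp)) (by simpa using hz)).summable.norm
      simpa using this)
  simp_rw [integral_mul_const, ← hF.eq_integral_exp_pow] at h
  refine (hasSum_deriv_powerSum (covSeq_mem_admissibleSeq hF) hz).unique ?_
  convert! h using 1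
  refine integral_congr_ae (Eventually.of_forall fun t => ?_)
  dsimp only
  rw [(hasSum_deriv_powerSum (exp_pow_mem_admissibleSeq t) hz).tsum_eq, deriv_powerSum_exp hz]

/-- The series is an average of kernels with real part at least 1/2. Hence it can be divided by on
the whole disk. -/
lemma powerSum_covSeq_ne_zero (hF : IsSpectralMeasure F γ) (hz : ‖z‖ < 1) :
    powerSum (covSeq γ) z ≠ 0 := by
  have := hF.isProbabilityMeasure
  have hi : Integrable (spectralKernel z) F :=
    integrable_comp_kernels (Φ := fun q => q.1) (by fun_prop) hz
  have h1 : ∫ _, (1 / 2 : ℝ) ∂F ≤ ∫ t, (spectralKernel z t).re ∂F :=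
    integral_mono (integrable_const _) hi.re (half_le_re_spectralKernel hz)
  have h2 := integral_re hi
  simp only [RCLike.re_eq_complex_re] at h2
  rw [h2, ← powerSum_covSeq hF hz] at h1
  intro h0
  rw [h0] at h1
  norm_num at h1

lemma exists_geometric_bound (hz : ‖z‖ < 1) : ∃ C r : ℝ, 0 ≤ C ∧ 0 ≤ r ∧ r < 1 ∧
    (∀ k : ℕ, ‖z ^ k‖ ≤ C * r ^ k) ∧ ∀ k : ℕ, ‖(k : ℂ) * z ^ (k - 1)‖ ≤ C * r ^ k := by
  obtain ⟨ρ, hzρ, hρ1⟩ := exists_between hz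
  have hρ0 : 0 < ρ := (norm_nonneg z).trans_lt hzρ
  obtain ⟨r, hρr, hr1⟩ := exists_between hρ1
  have hr0 : 0 < r := hρ0.trans hρr
  obtain ⟨B, hB⟩ := (tendsto_self_mul_const_pow_of_lt_one (r := ρ / r) (by positivity)
    ((div_lt_one hr0).2 hρr)).bddAbove_range
  have hB' : ∀ k : ℕ, (k : ℝ) * (ρ / r) ^ k ≤ B := fun k => hB ⟨k, rfl⟩
  have hB0 : 0 ≤ B := by simpa using hB' 0
  -- With `‖z‖ < ρ < r < 1`, the 1 serves the bound on `z ^ k`; `B / ρ` serves the derivative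
  -- coefficients, where `k * (ρ / r) ^ k ≤ B` absorbs the factor `k` and `ρ⁻¹` the shifted
  -- exponent.
  refine ⟨1 + B / ρ, r, by positivity, hr0.le, hr1, fun k => ?_, fun k => ?_⟩
  · rw [norm_pow]
    calc ‖z‖ ^ k ≤ r ^ k := by gcongr; exact hzρ.le.trans hρr.le
      _ ≤ (1 + B / ρ) * r ^ k := le_mul_of_one_le_left (by positivity) (by
          have : 0 ≤ B / ρ := by positivity
          linarith)
  · rcases Nat.eq_zero_or_pos k with rfl | hk
    · simp only [Nat.cast_zero, zero_mul, norm_zero]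
      positivity
    · have h1 := hB' k
      rw [div_pow, mul_div_assoc', div_le_iff₀ (by positivity)] at h1
      have h2 : ρ ^ k = ρ * ρ ^ (k - 1) := by
        rw [← pow_succ', Nat.sub_add_cancel hk]
      rw [h2] at h1
      rw [norm_mul, norm_pow, Complex.norm_natCast]
      calc (k : ℝ) * ‖z‖ ^ (k - 1) ≤ k * ρ ^ (k - 1) := by gcongr
        _ = (k * (ρ * ρ ^ (k - 1))) / ρ := by field_simp
        _ ≤ B * r ^ k / ρ := by gcongr
        _ ≤ (1 + B / ρ) * r ^ k := by
            have : 0 ≤ r ^ k := by positivity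
            rw [add_mul, one_mul, div_mul_eq_mul_div]
            linarith

/-- With `g`, `g'` the values of a denominator and its derivative at `z`, the quotient and its
derivative are series in the coefficients `x` with geometrically small weights, the form required by
`IsSpectralGaussian.lintegral_exp_neg_mul`. -/
lemma tsum_mul_quotient_coeff {x : ℕ → ℂ} (hx : x ∈ admissibleSeq) (hz : ‖z‖ < 1) (g g' : ℂ) :
    ∑' k, z ^ k / g * x k = powerSum x z / g ∧
    ∑' k : ℕ, ((k : ℂ) * z ^ (k - 1) / g - z ^ k * g' / g ^ 2) * x k =
      deriv (powerSum x) z / g - powerSum x z * g' / g ^ 2 := by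
  have h1 := (summable_powerSum hx hz).hasSum
  have h2 := hasSum_deriv_powerSum hx hz
  constructor
  · refine ((h1.div_const g).congr_fun fun k => ?_).tsum_eq
    ring
  · refine (((h2.div_const g).sub ((h1.mul_right g').div_const (g ^ 2))).congr_fun
      fun k => ?_).tsum_eq
    ring

lemma powerSum_innovationKernel (hF : IsSpectralMeasure F γ) (hz : ‖z‖ < 1) (t : ℝ) :
    powerSum (fun k => innovationKernel γ k t) z = spectralKernel z t - powerSum (covSeq γ) z ∧
    deriv (powerSum fun k => innovationKernel γ k t) z =
      spectralKernelDeriv z t - deriv (powerSum (covSeq γ)) z := by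
  have hγ := covSeq_mem_admissibleSeq hF
  have hE := exp_pow_mem_admissibleSeq t
  have hadm : (fun k => innovationKernel γ k t) ∈ admissibleSeq := by
    refine mem_admissibleSeq_of_norm_le (B := 2) fun k => ?_
    unfold innovationKernel
    refine (norm_sub_le _ _).trans ?_
    rw [norm_pow, norm_exp_neg_I_mul, one_pow]
    linarith [hF.norm_le_one k]
  constructor
  · rw [← powerSum_exp hz t]
    refine (((summable_powerSum hE hz).hasSum.sub (summable_powerSum hγ hz).hasSum).congr_fun
      fun k => ?_).tsum_eq
    simp only [innovationKernel, covSeq, sub_mul]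
  · rw [← deriv_powerSum_exp hz t]
    refine (hasSum_deriv_powerSum hadm hz).unique
      (((hasSum_deriv_powerSum hE hz).sub (hasSum_deriv_powerSum hγ hz)).congr_fun fun k => ?_)
    simp only [innovationKernel, covSeq, sub_mul]

end CovarianceSeries

end Decomposition

/-! ### The first intensity of the zeros -/

section FirstIntensity

variable {Ω : Type*} [MeasurableSpace Ω] {P : Measure Ω} {ξ : ℤ → Ω → ℂ} {γ : ℤ → ℂ}
  {F : Measure ℝ}

/-- The expected density, at level `ξ 0`, of the zeros of the power series at the point `z`. -/
lemma lintegral_exp_neg_innovation (hξ : IsStationaryComplexGaussian ξ γ P)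
    (hF : IsSpectralMeasure F γ) {z : ℂ} (hz : ‖z‖ < 1) {g g' : ℂ}
    (hg : powerSum (covSeq γ) z = g) (hg' : deriv (powerSum (covSeq γ)) z = g') :
    ∫⁻ u, ENNReal.ofReal (rexp (-‖powerSum (fun k => innovation ξ γ k u) z / g‖ ^ 2)) *
      ‖powerSum (derivSeq fun k => innovation ξ γ k u) z / g -
        powerSum (fun k => innovation ξ γ k u) z * g' / g ^ 2‖ₑ ^ 2 ∂P =
      ENNReal.ofReal (π * zeroIntensity F z) := by
  have := hF.isProbabilityMeasure
  have hS := isSpectralGaussian_innovation hξ hF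
  have hg0 : g ≠ 0 := hg ▸ powerSum_covSeq_ne_zero hF hz
  obtain ⟨C, r, hC0, hr0, hr1, hb1, hb2⟩ := exists_geometric_bound hz
  set a : ℕ → ℂ := fun k => z ^ k / g with ha
  set c : ℕ → ℂ := fun k => (k : ℂ) * z ^ (k - 1) / g - z ^ k * g' / g ^ 2 with hc
  have hrk : ∀ k, 0 ≤ C * r ^ k := fun k => by positivity
  set C' : ℝ := C * (‖g‖⁻¹ + ‖g'‖ * ‖g‖⁻¹ ^ 2) with hC'
  have hab : ∀ k, ‖a k‖ ≤ C' * r ^ k := by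
    intro k
    have h1 : 0 ≤ ‖g'‖ * ‖g‖⁻¹ ^ 2 := by positivity
    calc ‖a k‖ = ‖z ^ k‖ * ‖g‖⁻¹ := by rw [ha, norm_div, div_eq_mul_inv]
      _ ≤ C * r ^ k * ‖g‖⁻¹ := by gcongr; exact hb1 k
      _ ≤ C * r ^ k * (‖g‖⁻¹ + ‖g'‖ * ‖g‖⁻¹ ^ 2) :=
          mul_le_mul_of_nonneg_left (by linarith) (hrk k)
      _ = _ := by rw [hC']; ring
  have hcb : ∀ k, ‖c k‖ ≤ C' * r ^ k := by
    intro k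
    calc ‖c k‖ ≤ ‖(k : ℂ) * z ^ (k - 1)‖ * ‖g‖⁻¹ + ‖z ^ k‖ * (‖g'‖ * ‖g‖⁻¹ ^ 2) := by
          refine (norm_sub_le _ _).trans (le_of_eq ?_)
          rw [norm_div, norm_div, norm_mul (z ^ k), norm_pow g, div_eq_mul_inv, div_eq_mul_inv,
            inv_pow, mul_assoc (‖z ^ k‖)]
      _ ≤ C * r ^ k * ‖g‖⁻¹ + C * r ^ k * (‖g'‖ * ‖g‖⁻¹ ^ 2) := by
          gcongr
          exacts [hb2 k, hb1 k]
      _ = _ := by rw [hC']; ring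
  have hadmK : ∀ t, (fun k => innovationKernel γ k t) ∈ admissibleSeq := fun t =>
    mem_admissibleSeq_of_norm_le fun k => hS.bound k t
  -- In `L²(F)`, the value of `Y/G` at `z` corresponds to `K/g - 1`. For its derivative (`hCt`) the
  -- constants cancel, leaving `K'/g - g' K/g²`.
  have hA : ∀ t, ∑' k, a k * innovationKernel γ k t =
      1 / g * spectralKernel z t + 0 * spectralKernelDeriv z t + -1 := by
    intro t
    rw [(tsum_mul_quotient_coeff (hadmK t) hz g g').1, (powerSum_innovationKernel hF hz t).1, hg]
    field_simp
    ring
  have hCt : ∀ t, ∑' k, c k * innovationKernel γ k t =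
      -(g' / g ^ 2) * spectralKernel z t + 1 / g * spectralKernelDeriv z t + 0 := by
    intro t
    rw [(tsum_mul_quotient_coeff (hadmK t) hz g g').2, (powerSum_innovationKernel hF hz t).1,
      (powerSum_innovationKernel hF hz t).2, hg, hg']
    field_simp
    ring
  have hN := integral_norm_spectralKernel_sq_pos (F := F) hz
  have hEα := integral_kernels_mul_conj (F := F) hz (1 / g) 0 (-1) (1 / g) 0 (-1)
  have hEβ := integral_kernels_mul_conj (F := F) hz (-(g' / g ^ 2)) (1 / g) 0 (1 / g) 0 (-1)
  have hEδ := integral_kernels_mul_conj (F := F) hz (-(g' / g ^ 2)) (1 / g) 0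
    (-(g' / g ^ 2)) (1 / g) 0
  rw [← powerSum_covSeq hF hz, ← deriv_powerSum_covSeq hF hz, hg, hg'] at hEα hEβ hEδ
  unfold zeroIntensity
  set N := ∫ t, ‖spectralKernel z t‖ ^ 2 ∂F with hNdef
  set D := ∫ t, ‖spectralKernelDeriv z t‖ ^ 2 ∂F
  set M := ∫ t, spectralKernelDeriv z t * conj (spectralKernel z t) ∂F
  set δ : ℝ := ∫ t, ‖-(g' / g ^ 2) * spectralKernel z t + 1 / g * spectralKernelDeriv z t + 0‖ ^ 2 ∂F
    with hδ
  have hsq : ∀ w : ℂ, w * conj w = ((‖w‖ ^ 2 : ℝ) : ℂ) := fun w => by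
    rw [Complex.mul_conj, Complex.normSq_eq_norm_sq]
  have hδc : ∫ t, (-(g' / g ^ 2) * spectralKernel z t + 1 / g * spectralKernelDeriv z t + 0) *
      conj (-(g' / g ^ 2) * spectralKernel z t + 1 / g * spectralKernelDeriv z t + 0) ∂F = (δ : ℂ) := by
    simp_rw [hsq]
    rw [integral_complex_ofReal]
  have hcg0 : conj g ≠ 0 := (map_ne_zero _).2 hg0
  have hnsq : ∀ w : ℂ, ((‖w‖ : ℝ) : ℂ) ^ 2 = w * conj w := fun w => by rw [hsq]; push_cast; rfl
  -- The variance of `Y/G` is `N/|g|² - 1`, so the factor `1 + α` in the Gaussian formula is just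
  -- `N/|g|²` and all dependence on `g`, `g'` cancels in the end.
  have hαc : ∫ t, (1 / g * spectralKernel z t + 0 * spectralKernelDeriv z t + -1) *
      conj (1 / g * spectralKernel z t + 0 * spectralKernelDeriv z t + -1) ∂F =
      ((N / ‖g‖ ^ 2 - 1 : ℝ) : ℂ) := by
    rw [hEα]
    push_cast
    rw [hnsq]
    simp only [map_div₀, map_one, map_zero, map_neg]
    field_simp
    ring
  have hmain := hS.lintegral_exp_neg_mul hr0 hr1 hab hcb
    (by simp_rw [hA]; exact hαc) (by simp_rw [hA, hCt]; exact hEβ)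
    (by simp_rw [hCt]; exact hδc)
  have hreal : δ / (1 + (N / ‖g‖ ^ 2 - 1)) -
      ‖-(g' / g ^ 2) * conj (1 / g) * (N : ℂ) + 1 / g * conj (0 : ℂ) * (D : ℂ) +
        1 / g * conj (1 / g) * M + -(g' / g ^ 2) * conj (0 : ℂ) * conj M +
        -(g' / g ^ 2) * conj (-1 : ℂ) * g + 1 / g * conj (-1 : ℂ) * g' +
        0 * conj (1 / g) * conj g + 0 * conj (0 : ℂ) * conj g' + 0 * conj (-1 : ℂ)‖ ^ 2 /
        (1 + (N / ‖g‖ ^ 2 - 1)) ^ 2 =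
      π * (π⁻¹ * ((N * D - ‖M‖ ^ 2) / N ^ 2)) := by
    rw [mul_inv_cancel_left₀ Real.pi_ne_zero]
    rw [← Complex.ofReal_inj]
    have hNc : (N : ℂ) ≠ 0 := by exact_mod_cast hN.ne'
    push_cast
    rw [← hδc, hEδ]
    simp only [hnsq, map_div₀, map_one, map_zero, map_neg, map_add, map_mul, map_pow, Complex.conj_conj,
      Complex.conj_ofReal, zero_mul, mul_zero, add_zero]
    have h1 : (1 : ℂ) + (N / (g * conj g) - 1) = N / (g * conj g) := by ring
    rw [h1]
    field_simp
    ring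
  rw [hreal] at hmain
  rw [← hmain]
  refine lintegral_congr_ae ?_
  filter_upwards [hS.ae_mem_admissibleSeq] with u hu
  rw [(tsum_mul_quotient_coeff hu hz g g').1, (tsum_mul_quotient_coeff hu hz g g').2,
    deriv_powerSum hu hz]

/-- The law of the coefficients of the random power series. -/
def coeffLaw (ξ : ℤ → Ω → ℂ) (P : Measure Ω) : Measure (ℕ → ℂ) := P.map fun u (k : ℕ) => ξ k u

/-- The law of the innovations. -/
def innovationLaw (ξ : ℤ → Ω → ℂ) (γ : ℤ → ℂ) (P : Measure Ω) : Measure (ℕ → ℂ) :=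
  P.map fun u k => innovation ξ γ k u

lemma aemeasurable_coeff (hξ : IsStationaryComplexGaussian ξ γ P) :
    AEMeasurable (fun u (k : ℕ) => ξ k u) P :=
  aemeasurable_pi_iff.2 fun k => hξ.gaussian.aemeasurable k

lemma aemeasurable_innovation (hξ : IsStationaryComplexGaussian ξ γ P) :
    AEMeasurable (fun u k => innovation ξ γ k u) P :=
  aemeasurable_pi_iff.2 fun k => (hξ.gaussian.aemeasurable k).sub
    ((hξ.gaussian.aemeasurable 0).const_mul _)

lemma measurable_add_mul_covSeq :
    Measurable fun q : (ℕ → ℂ) × ℂ => fun k => q.1 k + q.2 * covSeq γ k :=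
  measurable_pi_iff.2 fun k => by fun_prop

/-- Independence makes the joint law of innovations and `ξ 0` a product, so `ξ 0` can be integrated
out first with the innovations frozen. -/
lemma coeffLaw_eq (hξ : IsStationaryComplexGaussian ξ γ P) (hF : IsSpectralMeasure F γ) :
    coeffLaw ξ P = ((innovationLaw ξ γ P).prod (P.map (ξ 0))).map
      fun q k => q.1 k + q.2 * covSeq γ k := by
  have := hξ.gaussian.isProbabilityMeasure
  have hind := indepFun_innovation hξ hF
  rw [indepFun_iff_map_prod_eq_prod_map_map (aemeasurable_innovation hξ)
    (hξ.gaussian.aemeasurable 0)] at hind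
  rw [innovationLaw, ← hind, AEMeasurable.map_map_of_aemeasurable
    measurable_add_mul_covSeq.aemeasurable
    ((aemeasurable_innovation hξ).prodMk (hξ.gaussian.aemeasurable 0)), coeffLaw]
  congr 1
  funext u k
  simp only [Function.comp_apply, innovation, covSeq]
  ring

lemma ae_innovationLaw (hξ : IsStationaryComplexGaussian ξ γ P) (hF : IsSpectralMeasure F γ) :
    ∀ᵐ y ∂(innovationLaw ξ γ P), y ∈ admissibleSeq := by
  have := hF.isProbabilityMeasure
  exact (ae_map_iff (aemeasurable_innovation hξ) measurableSet_admissibleSeq).2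
    (isSpectralGaussian_innovation hξ hF).ae_mem_admissibleSeq

lemma ae_coeffLaw (hξ : IsStationaryComplexGaussian ξ γ P) (hF : IsSpectralMeasure F γ) :
    ∀ᵐ x ∂(coeffLaw ξ P), x ∈ admissibleSeq := by
  have := hF.isProbabilityMeasure
  refine (ae_map_iff (aemeasurable_coeff hξ) measurableSet_admissibleSeq).2 ?_
  filter_upwards [(isSpectralGaussian_innovation hξ hF).ae_mem_admissibleSeq] with u hu
  have := add_mul_mem_admissibleSeq hu (covSeq_mem_admissibleSeq hF) (ξ 0 u)
  refine (iff_of_eq (congrArg (· ∈ admissibleSeq) (funext fun k => ?_))).1 this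
  simp only [innovation, covSeq]
  ring

/-- The integrated number of zeros of `y + c γ` over the level `c`. -/
lemma lintegral_zeroNumber_add_mul (hF : IsSpectralMeasure F γ) {y : ℕ → ℂ}
    (hy : y ∈ admissibleSeq) {A : Set ℂ} (hA : MeasurableSet A) (hA1 : A ⊆ Metric.ball 0 1) :
    ∫⁻ c, ENNReal.ofReal (complexGaussianPDF 1 c) *
      zeroNumber A (fun k => y k + c * covSeq γ k) =
    ∫⁻ z in A, ENNReal.ofReal π⁻¹ * (ENNReal.ofReal
      (rexp (-‖powerSum y z / powerSum (covSeq γ) z‖ ^ 2)) *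
      ‖powerSum (derivSeq y) z / powerSum (covSeq γ) z -
        powerSum y z * deriv (powerSum (covSeq γ)) z / powerSum (covSeq γ) z ^ 2‖ₑ ^ 2) := by
  have hγ := covSeq_mem_admissibleSeq hF
  have hgd := differentiableOn_powerSum hγ
  have hyd := differentiableOn_powerSum hy
  have hg0 : ∀ z ∈ Metric.ball (0 : ℂ) 1, powerSum (covSeq γ) z ≠ 0 := fun z hz =>
    powerSum_covSeq_ne_zero hF (mem_ball_zero_iff.1 hz)
  have hh : DifferentiableOn ℂ (fun z => -(powerSum y z / powerSum (covSeq γ) z))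
      (Metric.ball 0 1) := (hyd.div hgd hg0).neg
  have harea := lintegral_mul_encard_preimage Metric.isOpen_ball hh hA hA1
    (p := fun c => ENNReal.ofReal (complexGaussianPDF 1 c))
    (continuous_complexGaussianPDF 1).measurable.ennreal_ofReal
  have hset : ∀ c, zeroNumber A (fun k => y k + c * covSeq γ k) =
      (({z ∈ A | -(powerSum y z / powerSum (covSeq γ) z) = c}.encard : ℕ∞) : ℝ≥0∞) := by
    intro c
    rw [zeroNumber]
    congr 3
    ext z
    refine and_congr_right fun hz => ?_
    have hz1 := hA1 hz
    have hz2 := mem_ball_zero_iff.1 hz1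
    rw [powerSum_add_mul hy hγ c hz2, and_iff_right hz2, neg_eq_iff_eq_neg,
      div_eq_iff (hg0 z hz1), neg_mul, add_eq_zero_iff_eq_neg]
  simp_rw [hset]
  rw [harea]
  refine setLIntegral_congr_fun hA fun z hz => ?_
  have hz1 := hA1 hz
  have hnb := Metric.isOpen_ball.mem_nhds hz1
  have hd1 := (hyd.differentiableAt hnb).hasDerivAt
  have hd2 := (hgd.differentiableAt hnb).hasDerivAt
  have hd := (hd1.div hd2 (hg0 z hz1)).neg.deriv
  have hd' : deriv (fun z => -(powerSum y z / powerSum (covSeq γ) z)) z =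
      -(powerSum (derivSeq y) z / powerSum (covSeq γ) z -
        powerSum y z * deriv (powerSum (covSeq γ)) z / powerSum (covSeq γ) z ^ 2) := by
    refine hd.trans ?_
    rw [deriv_powerSum hy (mem_ball_zero_iff.1 hz1)]
    have := hg0 z hz1
    field_simp
  rw [hd', enorm_neg, ← mul_assoc, ← ENNReal.ofReal_mul (by positivity), complexGaussianPDF,
    norm_neg, mul_one, inv_one, one_mul]

/-- The expected number of zeros in a set for which the number of zeros is measurable. -/
lemma lintegral_zeroNumber (hξ : IsStationaryComplexGaussian ξ γ P) (hF : IsSpectralMeasure F γ)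
    {A : Set ℂ} (hA : MeasurableSet A) (hA1 : A ⊆ Metric.ball 0 1)
    (hm : AEMeasurable (zeroNumber A) (coeffLaw ξ P)) :
    ∫⁻ x, zeroNumber A x ∂(coeffLaw ξ P) = ∫⁻ z in A, ENNReal.ofReal (zeroIntensity F z) := by
  have := hξ.gaussian.isProbabilityMeasure
  have := hF.isProbabilityMeasure
  have hLp : IsProbabilityMeasure (innovationLaw ξ γ P) :=
    Measure.isProbabilityMeasure_map (aemeasurable_innovation hξ)
  have hνp : IsProbabilityMeasure (P.map (ξ 0)) :=
    Measure.isProbabilityMeasure_map (hξ.gaussian.aemeasurable 0)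
  have hγ := covSeq_mem_admissibleSeq hF
  rw [coeffLaw_eq hξ hF] at hm ⊢
  have hm2 : AEMeasurable (fun q : (ℕ → ℂ) × ℂ => zeroNumber A fun k => q.1 k + q.2 * covSeq γ k)
      ((innovationLaw ξ γ P).prod (P.map (ξ 0))) := hm.comp_measurable measurable_add_mul_covSeq
  rw [lintegral_map' hm measurable_add_mul_covSeq.aemeasurable, lintegral_prod _ hm2]
  have hinner : ∀ᵐ y ∂(innovationLaw ξ γ P),
      ∫⁻ c, zeroNumber A (fun k => y k + c * covSeq γ k) ∂(P.map (ξ 0)) =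
      ∫⁻ z in A, ENNReal.ofReal π⁻¹ * (ENNReal.ofReal
        (rexp (-‖powerSum y z / powerSum (covSeq γ) z‖ ^ 2)) *
        ‖powerSum (derivSeq y) z / powerSum (covSeq γ) z -
          powerSum y z * deriv (powerSum (covSeq γ)) z / powerSum (covSeq γ) z ^ 2‖ₑ ^ 2) := by
    filter_upwards [ae_innovationLaw hξ hF] with y hy
    rw [← lintegral_zeroNumber_add_mul hF hy hA hA1, map_apply_zero hξ hF,
      lintegral_withDensity_eq_lintegral_mul_non_measurable _
        (continuous_complexGaussianPDF 1).measurable.ennreal_ofReal (by simp)]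
    rfl
  rw [lintegral_congr_ae hinner]
  obtain ⟨hp1, hp2⟩ := aemeasurable_powerSum_prod (ae_innovationLaw hξ hF) hA hA1
  have hgm : AEMeasurable (fun q : (ℕ → ℂ) × ℂ => powerSum (covSeq γ) q.2)
      ((innovationLaw ξ γ P).prod (volume.restrict A)) :=
    (((differentiableOn_powerSum hγ).continuousOn.mono hA1).aemeasurable hA).comp_quasiMeasurePreserving
      Measure.quasiMeasurePreserving_snd
  have hgm' : AEMeasurable (fun q : (ℕ → ℂ) × ℂ => deriv (powerSum (covSeq γ)) q.2)
      ((innovationLaw ξ γ P).prod (volume.restrict A)) :=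
    ((measurable_deriv _).comp measurable_snd).aemeasurable
  rw [lintegral_lintegral_swap]
  · refine setLIntegral_congr_fun hA fun z hz => ?_
    have hz1 := mem_ball_zero_iff.1 (hA1 hz)
    obtain ⟨hq1, hq2⟩ := aemeasurable_powerSum (ae_innovationLaw hξ hF) hz1
    have hH : AEMeasurable (fun y => ENNReal.ofReal
        (rexp (-‖powerSum y z / powerSum (covSeq γ) z‖ ^ 2)) *
        ‖powerSum (derivSeq y) z / powerSum (covSeq γ) z -
          powerSum y z * deriv (powerSum (covSeq γ)) z / powerSum (covSeq γ) z ^ 2‖ₑ ^ 2)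
        (innovationLaw ξ γ P) := by fun_prop
    rw [lintegral_const_mul'' _ hH]
    unfold innovationLaw at hH ⊢
    rw [lintegral_map' hH (aemeasurable_innovation hξ),
      lintegral_exp_neg_innovation hξ hF hz1 rfl rfl, ← ENNReal.ofReal_mul (by positivity),
      inv_mul_cancel_left₀ Real.pi_ne_zero]
  · refine AEMeasurable.const_mul ?_ _
    exact ((((hp1.div hgm).norm.pow_const 2).neg.exp).ennreal_ofReal).mul
      ((((hp2.div hgm).sub ((hp1.mul hgm').div (hgm.pow_const 2))).enorm).pow_const 2)

end FirstIntensity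

/-! ### Measurability of zero counts in Borel sets; existence of the intensity -/

section FirstIntensityExists

variable {Ω : Type*} [MeasurableSpace Ω] {P : Measure Ω} {ξ : ℤ → Ω → ℂ} {γ : ℤ → ℂ}
  {F : Measure ℝ}

lemma measurableSet_zeros {x : ℕ → ℂ} (hx : x ∈ admissibleSeq) :
    MeasurableSet {z : ℂ | ‖z‖ < 1 ∧ powerSum x z = 0} := by
  have h := ((differentiableOn_powerSum hx).continuousOn.isOpen_inter_preimage Metric.isOpen_ball
    (isOpen_compl_singleton (x := (0 : ℂ)))).measurableSet
  convert! (Metric.isOpen_ball (x := (0 : ℂ)) (ε := 1)).measurableSet.diff h using 1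
  ext z
  simp only [mem_ofPred_eq, Set.mem_sdiff, mem_ball_zero_iff, mem_inter_iff, mem_preimage,
    mem_compl_iff, mem_singleton_iff]
  tauto

lemma zeroNumber_eq_restrict {x : ℕ → ℂ} (hx : x ∈ admissibleSeq) {A : Set ℂ}
    (hA : MeasurableSet A) :
    zeroNumber A x = (Measure.count.restrict {z : ℂ | ‖z‖ < 1 ∧ powerSum x z = 0}) A := by
  rw [Measure.restrict_apply hA, Measure.count_apply (hA.inter (measurableSet_zeros hx))]
  rfl

/-- A π-λ argument from closed sets. The complement step subtracts counts, so the count in the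
closed disk must be almost surely finite; it is, since its expectation is the integral of a
continuous intensity over a compact set. This is why the radius stays below 1. -/
lemma aemeasurable_zeroNumber_inter (hξ : IsStationaryComplexGaussian ξ γ P)
    (hF : IsSpectralMeasure F γ) {R : ℝ} (hR : R < 1) {A : Set ℂ} (hA : MeasurableSet A) :
    AEMeasurable (zeroNumber (A ∩ Metric.closedBall 0 R)) (coeffLaw ξ P) := by
  have := hF.isProbabilityMeasure
  set K : Set ℂ := Metric.closedBall 0 R with hK
  have hKc : IsCompact K := isCompact_closedBall 0 R
  have hKm : MeasurableSet K := hKc.measurableSet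
  have hK1 : K ⊆ Metric.ball 0 1 := Metric.closedBall_subset_ball hR
  have hae := ae_coeffLaw hξ hF
  have hmK := aemeasurable_zeroNumber_of_isCompact hae hKc hK1
  have hfin : ∀ᵐ x ∂(coeffLaw ξ P), zeroNumber K x < ⊤ := by
    refine ae_lt_top' hmK ?_
    rw [lintegral_zeroNumber hξ hF hKm hK1 hmK]
    exact (((continuousOn_zeroIntensity (F := F)).mono hK1).integrableOn_compact
      hKc).setLIntegral_lt_top.ne
  induction A, hA using MeasurableSpace.induction_on_inter
    (borel_eq_generateFrom_isClosed (α := ℂ) ▸ BorelSpace.measurable_eq) isPiSystem_isClosed with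
  | empty =>
    refine (aemeasurable_const (b := (0 : ℝ≥0∞))).congr (Eventually.of_forall fun x => ?_)
    simp [zeroNumber]
  | basic t ht =>
    exact aemeasurable_zeroNumber_of_isCompact hae (hKc.inter_left ht)
      (inter_subset_right.trans hK1)
  | compl t ht ih =>
    refine (hmK.sub ih).congr ?_
    filter_upwards [hae, hfin] with x hx hxf
    rw [Pi.sub_apply, zeroNumber_eq_restrict hx hKm, zeroNumber_eq_restrict hx (ht.inter hKm),
      zeroNumber_eq_restrict hx (ht.compl.inter hKm), ← measure_sdiff inter_subset_right
        (ht.inter hKm).nullMeasurableSet]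
    · congr 1
      ext z
      simp only [Set.mem_sdiff, mem_inter_iff, mem_compl_iff]
      tauto
    · rw [zeroNumber_eq_restrict hx hKm] at hxf
      exact ((measure_mono inter_subset_right).trans_lt hxf).ne
  | iUnion f hfd hfm ih =>
    refine (AEMeasurable.tsum (L := SummationFilter.unconditional ℕ) ih).congr ?_
    filter_upwards [hae] with x hx
    rw [zeroNumber_eq_restrict hx ((MeasurableSet.iUnion hfm).inter hKm), iUnion_inter,
      measure_iUnion (fun i j hij => (hfd hij).mono inter_subset_left inter_subset_left)
        fun i => (hfm i).inter hKm]
    exact tsum_congr fun i => zeroNumber_eq_restrict hx ((hfm i).inter hKm)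

lemma aemeasurable_zeroNumber (hξ : IsStationaryComplexGaussian ξ γ P)
    (hF : IsSpectralMeasure F γ) {A : Set ℂ} (hA : MeasurableSet A) (hA1 : A ⊆ Metric.ball 0 1) :
    AEMeasurable (zeroNumber A) (coeffLaw ξ P) := by
  set R : ℕ → ℝ := fun n => 1 - 1 / ((n : ℝ) + 1) with hR
  have hR1 : ∀ n, R n < 1 := fun n => by
    have : (0 : ℝ) < 1 / ((n : ℝ) + 1) := by positivity
    simp only [hR]
    linarith
  have hmono : Monotone fun n => A ∩ Metric.closedBall (0 : ℂ) (R n) := fun m n hmn =>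
    inter_subset_inter_right _ (Metric.closedBall_subset_closedBall (by
      simp only [hR]
      gcongr))
  have hU : A = ⋃ n, A ∩ Metric.closedBall 0 (R n) := by
    rw [← inter_iUnion, eq_comm, inter_eq_left]
    intro z hz
    obtain ⟨n, hn⟩ := exists_nat_one_div_lt (sub_pos.2 (mem_ball_zero_iff.1 (hA1 hz)))
    refine mem_iUnion.2 ⟨n, mem_closedBall_zero_iff.2 ?_⟩
    simp only [hR]
    linarith
  refine (AEMeasurable.iSup fun n => aemeasurable_zeroNumber_inter hξ hF (hR1 n) hA).congr ?_
  filter_upwards [ae_coeffLaw hξ hF] with x hx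
  rw [zeroNumber_eq_restrict hx hA]
  conv_rhs => rw [hU]
  rw [hmono.measure_iUnion]
  simp_rw [zeroNumber_eq_restrict hx (hA.inter Metric.isClosed_closedBall.measurableSet)]

/-- The zeros of the random power series have a first intensity. -/
theorem isFirstIntensity_zeroIntensity (hξ : IsStationaryComplexGaussian ξ γ P)
    (hF : IsSpectralMeasure F γ) : IsFirstIntensity ξ P (zeroIntensity F) := by
  have := hF.isProbabilityMeasure
  refine ⟨continuousOn_zeroIntensity, fun z hz => zeroIntensity_nonneg (mem_ball_zero_iff.1 hz),
    fun A hA hA1 => ?_⟩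
  have hm := aemeasurable_zeroNumber hξ hF hA hA1
  rw [← lintegral_zeroNumber hξ hF hA hA1 hm]
  unfold coeffLaw at hm ⊢
  rw [lintegral_map' hm (aemeasurable_coeff hξ)]
  rfl

end FirstIntensityExists

/-! ### Limits at `1` with a linear rate -/

/-- `g r = a + O(1 - r)` as `r → 1` from the left. -/
def LinearLimit (g : ℝ → ℝ) (a : ℝ) : Prop :=
  (fun r => g r - a) =O[𝓝[<] 1] fun r => 1 - r

namespace LinearLimit

variable {g h : ℝ → ℝ} {a b : ℝ}

lemma tendsto (hg : LinearLimit g a) : Tendsto g (𝓝[<] 1) (𝓝 a) := by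
  have h1 : Tendsto (fun r : ℝ => 1 - r) (𝓝[<] 1) (𝓝 0) := by
    have : Tendsto (fun r : ℝ => 1 - r) (𝓝 1) (𝓝 (1 - 1)) := by
      exact (continuous_const.sub continuous_id).tendsto 1
    rw [sub_self] at this
    exact this.mono_left nhdsWithin_le_nhds
  have := hg.trans_tendsto h1
  simpa using this.add_const a

lemma isBigO_one (hg : LinearLimit g a) : g =O[𝓝[<] 1] fun _ => (1 : ℝ) :=
  hg.tendsto.isBigO_one ℝ

lemma const (a : ℝ) : LinearLimit (fun _ => a) a := by
  simpa [LinearLimit] using isBigO_zero _ _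

lemma id : LinearLimit (fun r => r) 1 := by
  unfold LinearLimit
  exact IsBigO.of_bound 1 (by filter_upwards with r; rw [one_mul, norm_sub_rev])

lemma congr' (hg : LinearLimit g a) (hgh : g =ᶠ[𝓝[<] 1] h) : LinearLimit h a := by
  refine IsBigO.congr' hg ?_ EventuallyEq.rfl
  filter_upwards [hgh] with r hr
  rw [hr]

lemma add (hg : LinearLimit g a) (hh : LinearLimit h b) :
    LinearLimit (fun r => g r + h r) (a + b) := by
  refine (IsBigO.add hg hh).congr_left fun r => ?_
  ring

lemma neg (hg : LinearLimit g a) : LinearLimit (fun r => -g r) (-a) := by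
  refine (IsBigO.neg_left hg).congr_left fun r => ?_
  ring

lemma sub (hg : LinearLimit g a) (hh : LinearLimit h b) :
    LinearLimit (fun r => g r - h r) (a - b) := by
  refine (IsBigO.sub hg hh).congr_left fun r => ?_
  ring

lemma mul (hg : LinearLimit g a) (hh : LinearLimit h b) :
    LinearLimit (fun r => g r * h r) (a * b) := by
  have h0 := IsBigO.mul hg hh.isBigO_one
  simp only [mul_one] at h0
  have h1 := h0.add (IsBigO.const_mul_left hh a)
  refine h1.congr_left fun r => ?_
  ring

lemma pow (hg : LinearLimit g a) (n : ℕ) : LinearLimit (fun r => g r ^ n) (a ^ n) := by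
  induction n with
  | zero => simpa using const 1
  | succ n ih => simpa only [pow_succ] using ih.mul hg

lemma inv (hg : LinearLimit g a) (ha : a ≠ 0) : LinearLimit (fun r => (g r)⁻¹) a⁻¹ := by
  have h1 : (fun r => (g r)⁻¹) =O[𝓝[<] 1] fun _ => (1 : ℝ) := (hg.tendsto.inv₀ ha).isBigO_one ℝ
  have h2 := (IsBigO.mul hg h1).const_mul_left (-a⁻¹)
  simp only [mul_one] at h2
  refine h2.congr' ?_ EventuallyEq.rfl
  filter_upwards [hg.tendsto.eventually_ne ha] with r hr
  field_simp
  ring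

lemma div (hg : LinearLimit g a) (hh : LinearLimit h b) (hb : b ≠ 0) :
    LinearLimit (fun r => g r / h r) (a / b) := by
  simpa only [div_eq_mul_inv] using hg.mul (hh.inv hb)

lemma one_sub_sq : LinearLimit (fun r => 1 - r ^ 2) 0 := by
  simpa using (const 1).sub (id.pow 2)

end LinearLimit

lemma eventually_mem_Ico_half_one : ∀ᶠ r : ℝ in 𝓝[<] 1, r ∈ Ico (1 / 2 : ℝ) 1 :=
  Ico_mem_nhdsLT (by norm_num)

lemma LinearLimit.isBigO_one_sub_sq {g : ℝ → ℝ} {a : ℝ} (hg : LinearLimit g a) :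
    (fun r => g r - a) =O[𝓝[<] 1] fun r => 1 - r ^ 2 := by
  refine IsBigO.trans hg (IsBigO.of_bound 1 ?_)
  filter_upwards [eventually_mem_Ico_half_one] with r hr
  have h1 : 0 < 1 - r := by linarith [hr.2]
  have h2 : 0 < 1 - r ^ 2 := by nlinarith [hr.1, hr.2]
  rw [Real.norm_of_nonneg h1.le, Real.norm_of_nonneg h2.le]
  nlinarith [hr.1, hr.2]

/-! ### The denominator `|1 - r e^{-is}|²` -/

/-- The squared distance `1 - 2 r cos s + r²` of `1` to `r e^{is}`. -/
def circleDist (r s : ℝ) : ℝ := 1 - 2 * r * cos s + r ^ 2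

lemma circleDist_eq (r s : ℝ) : circleDist r s = (1 - r) ^ 2 + 2 * r * (1 - cos s) := by
  unfold circleDist; ring

lemma one_sub_cos_nonneg (s : ℝ) : 0 ≤ 1 - cos s := by linarith [cos_le_one s]

lemma continuous_circleDist (r : ℝ) : Continuous (circleDist r) := by
  unfold circleDist; fun_prop

lemma circleDist_pos {r : ℝ} (h0 : 0 ≤ r) (h1 : r < 1) (s : ℝ) : 0 < circleDist r s := by
  rw [circleDist_eq]
  have := one_sub_cos_nonneg s
  have : 0 < (1 - r) ^ 2 := by apply pow_pos; linarith
  positivity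

lemma circleDist_neg (r s : ℝ) : circleDist r (-s) = circleDist r s := by
  simp [circleDist]

lemma one_sub_cos_le_circleDist {r : ℝ} (h0 : 1 / 2 ≤ r) (s : ℝ) : 1 - cos s ≤ circleDist r s := by
  rw [circleDist_eq]
  nlinarith [one_sub_cos_nonneg s, sq_nonneg (1 - r)]

lemma mul_sq_le_one_sub_cos {s : ℝ} (hs : |s| ≤ π) : 2 / π ^ 2 * s ^ 2 ≤ 1 - cos s := by
  linarith [cos_le_one_sub_mul_cos_sq hs]

/-- Since `2r(1 - cos s)` is `circleDist r s - (1 - r)²`, the quotient is `1/(2r)` minus a multiple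
of the Poisson-type term; `r ≥ 1/2` makes the factors `1/(2r)` at most 1. -/
lemma abs_one_sub_cos_div_sub_le {r : ℝ} (h0 : 1 / 2 ≤ r) (h1 : r < 1) (s : ℝ) :
    |(1 - cos s) / circleDist r s - 1 / 2| ≤ (1 - r) + (1 - r) ^ 2 / circleDist r s := by
  have hD := circleDist_pos (by linarith) h1 s
  have hr : 0 < r := by linarith
  have e : (1 - cos s) / circleDist r s - 1 / 2
      = (1 - r) * (1 / (2 * r)) - (1 - r) ^ 2 / circleDist r s * (1 / (2 * r)) := by
    field_simp
    rw [circleDist_eq]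
    ring
  have h2 : 0 ≤ 1 / (2 * r) := by positivity
  have h3 : 1 / (2 * r) ≤ 1 := by rw [div_le_one (by positivity)]; linarith
  have h4 : 0 ≤ (1 - r) ^ 2 / circleDist r s := by positivity
  rw [e, abs_le]
  constructor <;> nlinarith

lemma abs_one_sub_cos_sq_div_sub_le {r : ℝ} (h0 : 1 / 2 ≤ r) (h1 : r < 1) (s : ℝ) :
    |(1 - cos s) ^ 2 / circleDist r s ^ 2 - 1 / 4|
      ≤ 3 / 2 * ((1 - r) + (1 - r) ^ 2 / circleDist r s) := by
  have hD := circleDist_pos (by linarith) h1 s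
  have h2 := abs_one_sub_cos_div_sub_le h0 h1 s
  have h3 : 0 ≤ (1 - cos s) / circleDist r s := div_nonneg (one_sub_cos_nonneg s) hD.le
  have h4 : (1 - cos s) / circleDist r s ≤ 1 :=
    (div_le_one hD).2 (one_sub_cos_le_circleDist h0 s)
  rw [← div_pow]
  set x := (1 - cos s) / circleDist r s
  have e : x ^ 2 - 1 / 4 = (x - 1 / 2) * (x + 1 / 2) := by ring
  rw [e, abs_mul, abs_of_nonneg (show 0 ≤ x + 1 / 2 by linarith), mul_comm]
  exact mul_le_mul (by linarith) h2 (abs_nonneg _) (by norm_num)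

/-! ### Integrals of the singular kernels -/

lemma norm_exp_mul_I_sub_sq (r θ : ℝ) :
    ‖Complex.exp (θ * Complex.I) - r‖ ^ 2 = circleDist r θ := by
  rw [← Complex.normSq_eq_norm_sq, Complex.normSq_apply]
  simp only [Complex.sub_re, Complex.sub_im, Complex.exp_ofReal_mul_I_re,
    Complex.exp_ofReal_mul_I_im, Complex.ofReal_re, Complex.ofReal_im, circleDist]
  nlinarith [sin_sq_add_cos_sq θ]

lemma integral_inv_circleDist {r : ℝ} (h0 : 0 ≤ r) (h1 : r < 1) :
    ∫ s in (-π)..π, (circleDist r s)⁻¹ = 2 * π / (1 - r ^ 2) := by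
  have hr : (r : ℂ) ∈ Metric.ball (0 : ℂ) 1 := by
    simp [abs_of_nonneg h0, h1]
  -- The Poisson integral of the constant function 1, evaluated at the point `r`.
  have hP := (diffContOnCl_const (c := (1 : ℂ)) (s := Metric.ball (0 : ℂ) 1)
    (𝕜 := ℂ)).circleAverage_poissonKernel_smul' hr
  rw [Real.circleAverage_def] at hP
  have e : ∀ θ : ℝ, ((‖circleMap 0 1 θ - 0‖ ^ 2 - ‖(r : ℂ) - 0‖ ^ 2)
      / ‖circleMap 0 1 θ - 0 - ((r : ℂ) - 0)‖ ^ 2) • (1 : ℂ)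
      = (((1 - r ^ 2) * (circleDist r θ)⁻¹ : ℝ) : ℂ) := by
    intro θ
    have : circleMap 0 1 θ = Complex.exp (θ * Complex.I) := by simp [circleMap]
    rw [this]
    simp only [sub_zero, norm_exp_mul_I_sub_sq, Complex.norm_exp_ofReal_mul_I]
    rw [Complex.norm_real, Real.norm_eq_abs, sq_abs, Complex.real_smul, mul_one, one_pow,
      div_eq_mul_inv]
  simp only [e] at hP
  rw [intervalIntegral.integral_ofReal, intervalIntegral.integral_const_mul] at hP
  have hper : Function.Periodic (fun s => (circleDist r s)⁻¹) (2 * π) := by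
    intro s; simp [circleDist]
  have hshift := hper.intervalIntegral_add_eq 0 (-π)
  rw [zero_add, show -π + 2 * π = π by ring] at hshift
  rw [hshift, Complex.real_smul, ← Complex.ofReal_mul] at hP
  have hP' : (2 * π)⁻¹ * ((1 - r ^ 2) * ∫ s in (-π)..π, (circleDist r s)⁻¹) = 1 := by
    exact_mod_cast hP
  have : 0 < 1 - r ^ 2 := by nlinarith
  have := pi_pos
  field_simp at hP' ⊢
  linarith

lemma circleDist_ne_zero {r : ℝ} (h0 : 0 ≤ r) (h1 : r < 1) (s : ℝ) : circleDist r s ≠ 0 :=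
  (circleDist_pos h0 h1 s).ne'

/-- The derivative of the periodic function `sin s / circleDist r s` integrates to 0, which
expresses the integral through that of `cos s / circleDist r s`, and hence through the Poisson
integral. -/
lemma integral_sin_sq_div_circleDist_sq {r : ℝ} (h0 : 0 < r) (h1 : r < 1) :
    ∫ s in (-π)..π, sin s ^ 2 / circleDist r s ^ 2 = π / (1 - r ^ 2) := by
  have hne := circleDist_ne_zero h0.le h1
  have hc := continuous_circleDist r
  have hd : ∀ s, HasDerivAt (fun s => sin s / circleDist r s)
      (cos s / circleDist r s - 2 * r * (sin s ^ 2 / circleDist r s ^ 2)) s := by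
    intro s
    have hD : HasDerivAt (circleDist r) (2 * r * sin s) s := by
      have := (((hasDerivAt_cos s).const_mul (2 * r)).const_sub 1).add_const (r ^ 2)
      refine this.congr_deriv ?_
      ring
    refine ((hasDerivAt_sin s).div hD (hne s)).congr_deriv ?_
    have := hne s
    field_simp
  have hcc : Continuous fun s => cos s / circleDist r s := continuous_cos.div hc hne
  have hcs : Continuous fun s => sin s ^ 2 / circleDist r s ^ 2 :=
    (continuous_sin.pow 2).div (hc.pow 2) fun s => pow_ne_zero 2 (hne s)
  have hci : Continuous fun s => (circleDist r s)⁻¹ := hc.inv₀ hne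
  have hI := intervalIntegral.integral_eq_sub_of_hasDerivAt (a := -π) (b := π) (fun s _ => hd s)
    ((hcc.sub (continuous_const.mul hcs)).intervalIntegrable _ _)
  have hcr : Continuous fun s => 2 * r * (sin s ^ 2 / circleDist r s ^ 2) :=
    continuous_const.mul hcs
  rw [intervalIntegral.integral_sub (hcc.intervalIntegrable _ _) (hcr.intervalIntegrable _ _),
    intervalIntegral.integral_const_mul] at hI
  have e : ∀ s, cos s / circleDist r s
      = (1 + r ^ 2) / (2 * r) * (circleDist r s)⁻¹ - 1 / (2 * r) := by
    intro s
    have := hne s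
    field_simp
    unfold circleDist
    ring
  simp only [e] at hI
  have hcm : Continuous fun s => (1 + r ^ 2) / (2 * r) * (circleDist r s)⁻¹ :=
    continuous_const.mul hci
  rw [intervalIntegral.integral_sub (hcm.intervalIntegrable _ _) intervalIntegrable_const, intervalIntegral.integral_const_mul,
    integral_inv_circleDist h0.le h1, intervalIntegral.integral_const] at hI
  simp only [sin_pi, sin_neg, neg_zero, zero_div, sub_zero, smul_eq_mul] at hI
  have h2 : 0 < 1 - r ^ 2 := by nlinarith
  generalize (∫ s in (-π)..π, sin s ^ 2 / circleDist r s ^ 2) = J at hI ⊢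
  field_simp at hI ⊢
  refine mul_left_cancel₀ (pow_ne_zero 2 h0.ne') ?_
  linear_combination (-1 / 4) * hI

/-- The value coincides with that of `integral_inv_circleDist`; this makes the singular terms cancel
when the density is positive. -/
lemma integral_one_sub_cos_div_circleDist_sq {r : ℝ} (h0 : 0 < r) (h1 : r < 1) :
    (1 + r) ^ 2 * ∫ s in (-π)..π, (1 - cos s) / circleDist r s ^ 2 = 2 * π / (1 - r ^ 2) := by
  have hne := circleDist_ne_zero h0.le h1
  have hc := continuous_circleDist r
  have hcs : Continuous fun s => sin s ^ 2 / circleDist r s ^ 2 :=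
    (continuous_sin.pow 2).div (hc.pow 2) fun s => pow_ne_zero 2 (hne s)
  have hci : Continuous fun s => (circleDist r s)⁻¹ := hc.inv₀ hne
  have e : ∀ s, (1 + r) ^ 2 * ((1 - cos s) / circleDist r s ^ 2)
      = 1 / (2 * r) - (1 - r) ^ 2 / (2 * r) * (circleDist r s)⁻¹
        + 2 * r * (sin s ^ 2 / circleDist r s ^ 2) := by
    intro s
    have := hne s
    field_simp
    rw [sin_sq, circleDist]
    ring
  have hc1 : Continuous fun s => (1 - r) ^ 2 / (2 * r) * (circleDist r s)⁻¹ :=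
    continuous_const.mul hci
  have hc2 : Continuous fun s => 2 * r * (sin s ^ 2 / circleDist r s ^ 2) :=
    continuous_const.mul hcs
  rw [← intervalIntegral.integral_const_mul]
  simp only [e]
  rw [intervalIntegral.integral_add (intervalIntegrable_const.sub (hc1.intervalIntegrable _ _))
      (hc2.intervalIntegrable _ _),
    intervalIntegral.integral_sub intervalIntegrable_const (hc1.intervalIntegrable _ _),
    intervalIntegral.integral_const_mul, intervalIntegral.integral_const_mul,
    integral_inv_circleDist h0.le h1, integral_sin_sq_div_circleDist_sq h0 h1,
    intervalIntegral.integral_const, smul_eq_mul]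
  have h2 : 0 < 1 - r ^ 2 := by nlinarith
  field_simp
  ring

/-! ### Weights with a removable singularity -/

/-- An integrable weight on the circle that is bounded near `0`. -/
structure IsTameWeight (v : ℝ → ℝ) : Prop where
  intervalIntegrable : IntervalIntegrable v volume (-π) π
  isBigO_one : v =O[𝓝 0] fun _ => (1 : ℝ)

namespace IsTameWeight

lemma mul_continuous {v c : ℝ → ℝ} (hv : IsTameWeight v) (hc : Continuous c) :
    IsTameWeight fun s => v s * c s := by
  refine ⟨hv.intervalIntegrable.mul_continuousOn hc.continuousOn, ?_⟩
  simpa using hv.isBigO_one.mul ((hc.tendsto 0).isBigO_one ℝ)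

lemma exists_bound {v : ℝ → ℝ} (hv : IsTameWeight v) :
    ∃ C δ : ℝ, 0 ≤ C ∧ 0 < δ ∧ ∀ s, |s| < δ → |v s| ≤ C := by
  obtain ⟨C, hC, hb⟩ := hv.isBigO_one.exists_nonneg
  obtain ⟨δ, hδ, hs⟩ := Metric.eventually_nhds_iff.1 hb.bound
  refine ⟨C, δ, hC, hδ, fun s h => ?_⟩
  have := hs (y := s) (by simpa using h)
  simpa using this

/-- Integrals of a tame weight against kernels that converge off the origin. -/
lemma linearLimit_integral {v : ℝ → ℝ} (hv : IsTameWeight v) {κ : ℝ → ℝ → ℝ} {κ₀ M : ℝ}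
    (hκc : ∀ r ∈ Ico (1 / 2 : ℝ) 1, Continuous (κ r))
    (hκ : ∀ r ∈ Ico (1 / 2 : ℝ) 1, ∀ s,
      |κ r s - κ₀| ≤ M * ((1 - r) + (1 - r) ^ 2 / circleDist r s)) :
    LinearLimit (fun r => ∫ s in (-π)..π, v s * κ r s) (κ₀ * ∫ s in (-π)..π, v s) := by
  obtain ⟨C, δ, hC, hδ, hb⟩ := hv.exists_bound
  have hM : 0 ≤ M := by
    have h := (abs_nonneg _).trans (hκ (1 / 2) ⟨le_rfl, by norm_num⟩ 0)
    have hD := circleDist_pos (r := 1 / 2) (by norm_num) (by norm_num) 0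
    have : 0 < (1 - 1 / 2 : ℝ) + (1 - 1 / 2) ^ 2 / circleDist (1 / 2) 0 := by positivity
    exact nonneg_of_mul_nonneg_left h this
  -- `m` is a lower bound for `1 - cos s`, hence for `circleDist r s`, on `δ ≤ |s| ≤ π`. For `|s| <
  -- δ` the bound `C` on the weight is used instead.
  set m : ℝ := 2 / π ^ 2 * δ ^ 2 with hm
  have hm0 : 0 < m := by have := pi_pos; positivity
  set V := ∫ s in (-π)..π, |v s| with hV
  have hV0 : 0 ≤ V := intervalIntegral.integral_nonneg (by linarith [pi_pos]) fun s _ => abs_nonneg _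
  refine IsBigO.of_bound (M * (V + C * (2 * π) + V / m)) ?_
  filter_upwards [eventually_mem_Ico_half_one] with r hr
  have hr0 : 0 ≤ r := by linarith [hr.1]
  have h1r : 0 < 1 - r := by linarith [hr.2]
  have hne := circleDist_ne_zero hr0 hr.2
  have hci : Continuous fun s => (circleDist r s)⁻¹ := (continuous_circleDist r).inv₀ hne
  have hpt : ∀ s ∈ Ioc (-π) π, ‖v s * κ r s - κ₀ * v s‖
      ≤ M * ((1 - r) * |v s| + C * (1 - r) ^ 2 * (circleDist r s)⁻¹ + (1 - r) ^ 2 / m * |v s|) := by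
    intro s hs
    have hD := circleDist_pos hr0 hr.2 s
    have e : v s * κ r s - κ₀ * v s = v s * (κ r s - κ₀) := by ring
    have h2 : |v s| * ((1 - r) ^ 2 / circleDist r s)
        ≤ C * (1 - r) ^ 2 * (circleDist r s)⁻¹ + (1 - r) ^ 2 / m * |v s| := by
      by_cases h : |s| < δ
      · have : |v s| * ((1 - r) ^ 2 / circleDist r s) ≤ C * ((1 - r) ^ 2 / circleDist r s) :=
          mul_le_mul_of_nonneg_right (hb s h) (by positivity)
        have h3 : 0 ≤ (1 - r) ^ 2 / m * |v s| := by positivity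
        calc _ ≤ _ := this
          _ = C * (1 - r) ^ 2 * (circleDist r s)⁻¹ := by rw [div_eq_mul_inv]; ring
          _ ≤ _ := by linarith
      · have hsπ : |s| ≤ π := abs_le.2 ⟨hs.1.le, hs.2⟩
        have h4 : m ≤ circleDist r s := by
          refine le_trans ?_ ((mul_sq_le_one_sub_cos hsπ).trans (one_sub_cos_le_circleDist hr.1 s))
          rw [hm]
          have : δ ^ 2 ≤ s ^ 2 := by
            rw [← sq_abs s]; exact pow_le_pow_left₀ hδ.le (not_lt.1 h) 2
          gcongr
        have h5 : (1 - r) ^ 2 / circleDist r s ≤ (1 - r) ^ 2 / m := by gcongr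
        have h6 : 0 ≤ C * (1 - r) ^ 2 * (circleDist r s)⁻¹ := by positivity
        have := mul_le_mul_of_nonneg_left h5 (abs_nonneg (v s))
        linarith
    rw [e, norm_mul, Real.norm_eq_abs, Real.norm_eq_abs]
    calc |v s| * |κ r s - κ₀|
        ≤ |v s| * (M * ((1 - r) + (1 - r) ^ 2 / circleDist r s)) :=
          mul_le_mul_of_nonneg_left (hκ r hr s) (abs_nonneg _)
      _ = M * ((1 - r) * |v s| + |v s| * ((1 - r) ^ 2 / circleDist r s)) := by ring
      _ ≤ _ := by
        refine mul_le_mul_of_nonneg_left ?_ hM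
        linarith
  have hvi := hv.intervalIntegrable
  have hva : IntervalIntegrable (fun s => |v s|) volume (-π) π := hvi.abs
  have hi1 : IntervalIntegrable (fun s => (1 - r) * |v s|) volume (-π) π := hva.const_mul _
  have hi2 : IntervalIntegrable (fun s => C * (1 - r) ^ 2 * (circleDist r s)⁻¹) volume (-π) π :=
    (hci.intervalIntegrable _ _).const_mul _
  have hi3 : IntervalIntegrable (fun s => (1 - r) ^ 2 / m * |v s|) volume (-π) π :=
    hva.const_mul _
  have hle := intervalIntegral.norm_integral_le_of_norm_le (μ := volume) (by linarith [pi_pos])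
    (Eventually.of_forall hpt) (((hi1.add hi2).add hi3).const_mul M)
  rw [intervalIntegral.integral_sub (hvi.mul_continuousOn (hκc r hr).continuousOn)
      (hvi.const_mul _), intervalIntegral.integral_const_mul,
    intervalIntegral.integral_const_mul, intervalIntegral.integral_add (hi1.add hi2) hi3,
    intervalIntegral.integral_add hi1 hi2, intervalIntegral.integral_const_mul,
    intervalIntegral.integral_const_mul, intervalIntegral.integral_const_mul,
    integral_inv_circleDist hr0 hr.2] at hle
  refine hle.trans ?_
  rw [Real.norm_of_nonneg h1r.le, mul_assoc M]
  refine mul_le_mul_of_nonneg_left ?_ hM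
  have h7 : 0 < 1 - r ^ 2 := by nlinarith
  -- The Poisson mass is of order `1/(1 - r)`, so one of the two factors `1 - r` survives: this is
  -- the linear rate.
  have h8 : (1 - r) ^ 2 * (2 * π / (1 - r ^ 2)) ≤ (1 - r) * (2 * π) := by
    rw [← mul_div_assoc, div_le_iff₀ h7]
    have : 0 ≤ (1 - r) * (2 * π) * ((1 - r) * r) := by have := pi_pos; positivity
    nlinarith
  have h9 : (1 - r) ^ 2 / m * V ≤ (1 - r) * (V / m) := by
    have : (1 - r) ^ 2 ≤ 1 - r := by nlinarith
    calc (1 - r) ^ 2 / m * V = (1 - r) ^ 2 * (V / m) := by ring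
      _ ≤ _ := mul_le_mul_of_nonneg_right this (by positivity)
  nlinarith [mul_le_mul_of_nonneg_left h8 hC]

lemma linearLimit_integral_div {v : ℝ → ℝ} (hv : IsTameWeight v) :
    LinearLimit (fun r => ∫ s in (-π)..π, v s * ((1 - cos s) / circleDist r s))
      (1 / 2 * ∫ s in (-π)..π, v s) := by
  refine hv.linearLimit_integral (M := 1) (fun r hr => ?_) fun r hr s => ?_
  · exact (continuous_const.sub continuous_cos).div (continuous_circleDist r)
      (circleDist_ne_zero (by linarith [hr.1]) hr.2)
  · rw [one_mul]
    exact abs_one_sub_cos_div_sub_le hr.1 hr.2 s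

lemma linearLimit_integral_sq_div {v : ℝ → ℝ} (hv : IsTameWeight v) :
    LinearLimit (fun r => ∫ s in (-π)..π, v s * ((1 - cos s) ^ 2 / circleDist r s ^ 2))
      (1 / 4 * ∫ s in (-π)..π, v s) := by
  refine hv.linearLimit_integral (M := 3 / 2) (fun r hr => ?_) fun r hr s => ?_
  · exact ((continuous_const.sub continuous_cos).pow 2).div ((continuous_circleDist r).pow 2)
      fun s => pow_ne_zero 2 (circleDist_ne_zero (by linarith [hr.1]) hr.2 s)
  · exact abs_one_sub_cos_sq_div_sub_le hr.1 hr.2 s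

/-- Dividing by a power of `1 - cos s` an integrable function that vanishes to that order. -/
lemma div_one_sub_cos_pow {q : ℝ → ℝ} (hq : IntervalIntegrable q volume (-π) π) {m : ℕ}
    (h0 : q =O[𝓝 0] fun s => s ^ (2 * m)) :
    IsTameWeight fun s => q s / (1 - cos s) ^ m := by
  have hπ : ∀ᶠ s : ℝ in 𝓝 0, |s| ≤ π := by
    have : Tendsto (fun s : ℝ => |s|) (𝓝 0) (𝓝 |0|) := continuous_abs.tendsto 0
    rw [abs_zero] at this
    exact (this.eventually_lt_const pi_pos).mono fun s hs => hs.le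
  have hO : (fun s => q s / (1 - cos s) ^ m) =O[𝓝 0] fun _ => (1 : ℝ) := by
    obtain ⟨C, hC, hb⟩ := h0.exists_nonneg
    -- `π²/2` is the reciprocal of the constant in `mul_sq_le_one_sub_cos`, converting powers of
    -- `s²` into powers of `1 - cos s`.
    refine IsBigO.of_bound (C * (π ^ 2 / 2) ^ m) ?_
    filter_upwards [hb.bound, hπ] with s hs hsπ
    have hw := mul_sq_le_one_sub_cos hsπ
    rw [norm_div, norm_pow, Real.norm_of_nonneg (one_sub_cos_nonneg s), norm_one, mul_one]
    have h2 : ‖q s‖ ≤ C * (π ^ 2 / 2) ^ m * (1 - cos s) ^ m := by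
      refine hs.trans ?_
      rw [mul_assoc, ← mul_pow, norm_pow, pow_mul, Real.norm_eq_abs, sq_abs]
      refine mul_le_mul_of_nonneg_left (pow_le_pow_left₀ (sq_nonneg _) ?_ m) hC
      have := pi_pos
      calc s ^ 2 = π ^ 2 / 2 * (2 / π ^ 2 * s ^ 2) := by field_simp
        _ ≤ _ := by gcongr
    exact div_le_of_le_mul₀ (pow_nonneg (one_sub_cos_nonneg s) m) (by positivity) h2
  refine ⟨?_, hO⟩
  obtain ⟨C, hC, hb⟩ := hO.exists_nonneg
  obtain ⟨δ, hδ, hs⟩ := Metric.eventually_nhds_iff.1 hb.bound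
  have hle : -π ≤ π := by linarith [pi_pos]
  rw [intervalIntegrable_iff_integrableOn_Ioc_of_le hle] at hq ⊢
  have hmes : Measurable fun s : ℝ => ((1 - cos s) ^ m)⁻¹ := by fun_prop
  set c : ℝ := 2 / π ^ 2 * δ ^ 2 with hc
  have hc0 : 0 < c := by have := pi_pos; positivity
  have hg : IntegrableOn (fun s => C + ‖q s‖ / c ^ m) (Ioc (-π) π) :=
    (integrable_const C).add (hq.norm.div_const _)
  refine Integrable.mono' hg (hq.aestronglyMeasurable.mul hmes.aestronglyMeasurable) ?_
  filter_upwards [ae_restrict_mem measurableSet_Ioc] with s hsm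
  by_cases h : |s| < δ
  · have h3 := hs (y := s) (by simpa using h)
    rw [norm_one, mul_one] at h3
    have : 0 ≤ ‖q s‖ / c ^ m := by positivity
    linarith
  · have hsπ : |s| ≤ π := abs_le.2 ⟨hsm.1.le, hsm.2⟩
    have h4 : c ≤ 1 - cos s := by
      refine le_trans ?_ (mul_sq_le_one_sub_cos hsπ)
      have : δ ^ 2 ≤ s ^ 2 := by
        rw [← sq_abs s]; exact pow_le_pow_left₀ hδ.le (not_lt.1 h) 2
      rw [hc]
      gcongr
    rw [norm_div, norm_pow, Real.norm_of_nonneg (one_sub_cos_nonneg s)]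
    have : ‖q s‖ / (1 - cos s) ^ m ≤ ‖q s‖ / c ^ m := by gcongr
    linarith

end IsTameWeight

/-! ### Taylor expansions at the origin -/

section Taylor

variable {f : ℝ → ℝ}

/-- The cubic coefficient need not be identified: it cancels in the even part, and in the odd part
multiplication by `sin s` makes it `O(s⁴)`. -/
lemma exists_taylor_isBigO_pow_four (hf : ContDiffAt ℝ ∞ f 0) :
    ∃ d : ℝ, (fun s => f s - (f 0 + deriv f 0 * s + iteratedDeriv 2 f 0 / 2 * s ^ 2 + d * s ^ 3))
      =O[𝓝 0] fun s => s ^ 4 := by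
  obtain ⟨u, hu, hfu⟩ := hf.contDiffOn (m := ((4 : ℕ) : WithTop ℕ∞))
    (WithTop.coe_le_coe.2 le_top) (fun h => by norm_cast at h)
  obtain ⟨δ, hδ, hball⟩ := Metric.mem_nhds_iff.1 hu
  have h0 : (0 : ℝ) ∈ Metric.ball (0 : ℝ) δ := Metric.mem_ball_self hδ
  have ht := (taylor_isLittleO (convex_ball (0 : ℝ) δ) h0 (hfu.mono hball)).isBigO
  rw [nhdsWithin_eq_nhds.2 (Metric.ball_mem_nhds _ hδ)] at ht
  have hi : ∀ n, iteratedDerivWithin n f (Metric.ball 0 δ) 0 = iteratedDeriv n f 0 :=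
    fun n => iteratedDerivWithin_of_isOpen Metric.isOpen_ball h0
  simp only [taylorWithinEval_succ, taylor_within_zero_eval, hi, sub_zero] at ht
  refine ⟨iteratedDeriv 3 f 0 / 6, ?_⟩
  have h4 : (fun s : ℝ => iteratedDeriv 4 f 0 / 24 * s ^ 4) =O[𝓝 0] fun s => s ^ 4 :=
    (isBigO_refl _ _).const_mul_left _
  refine (ht.add h4).congr_left fun s => ?_
  simp [iteratedDeriv_one, Nat.factorial, smul_eq_mul]
  ring

lemma IsBigO.comp_neg {g : ℝ → ℝ} {n : ℕ} (hg : g =O[𝓝 0] fun s => s ^ n) :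
    (fun s => g (-s)) =O[𝓝 0] fun s => s ^ n := by
  have hneg : Tendsto (fun s : ℝ => -s) (𝓝 0) (𝓝 0) := by
    simpa using (continuous_neg.tendsto (0 : ℝ))
  refine (hg.comp_tendsto hneg).trans (IsBigO.of_bound 1 ?_)
  filter_upwards with s
  simp

lemma isBigO_pow_pow_nhds_zero {m n : ℕ} (h : m ≤ n) :
    (fun s : ℝ => s ^ n) =O[𝓝 0] fun s => s ^ m := by
  refine IsBigO.of_bound 1 ?_
  have : ∀ᶠ s : ℝ in 𝓝 0, |s| < 1 := by
    have : Tendsto (fun s : ℝ => |s|) (𝓝 0) (𝓝 |0|) := continuous_abs.tendsto 0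
    rw [abs_zero] at this
    exact this.eventually_lt_const one_pos
  filter_upwards [this] with s hs
  rw [one_mul, norm_pow, norm_pow, Real.norm_eq_abs]
  exact pow_le_pow_of_le_one (abs_nonneg _) hs.le h

lemma one_sub_cos_sub_isBigO : (fun s : ℝ => 1 - cos s - s ^ 2 / 2) =O[𝓝 0] fun s => s ^ 4 := by
  refine IsBigO.of_bound (5 / 96) ?_
  have : ∀ᶠ s : ℝ in 𝓝 0, |s| < 1 := by
    have : Tendsto (fun s : ℝ => |s|) (𝓝 0) (𝓝 |0|) := continuous_abs.tendsto 0
    rw [abs_zero] at this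
    exact this.eventually_lt_const one_pos
  filter_upwards [this] with s hs
  have := cos_bound hs.le
  rw [Real.norm_eq_abs, norm_pow, Real.norm_eq_abs, mul_comm]
  rw [← abs_neg]
  convert this using 2
  ring

lemma sin_isBigO : sin =O[𝓝 0] fun s => s ^ 1 := by
  refine IsBigO.of_bound 1 ?_
  filter_upwards with s
  simpa using abs_sin_le_abs (x := s)

lemma sin_sub_isBigO : (fun s : ℝ => sin s - s) =O[𝓝 0] fun s => s ^ 3 := by
  refine IsBigO.of_bound 1 ?_
  have : ∀ᶠ s : ℝ in 𝓝 0, |s| < 1 := by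
    have : Tendsto (fun s : ℝ => |s|) (𝓝 0) (𝓝 |0|) := continuous_abs.tendsto 0
    rw [abs_zero] at this
    exact this.eventually_lt_const one_pos
  filter_upwards [this] with s hs
  have h1 := sin_bound hs.le
  rw [Real.norm_eq_abs, norm_pow, Real.norm_eq_abs, one_mul]
  have h2 : |s| ^ 5 ≤ |s| ^ 3 := pow_le_pow_of_le_one (abs_nonneg _) hs.le (by norm_num)
  have h3 : |s ^ 3 / 6| = |s| ^ 3 / 6 := by rw [abs_div, abs_pow]; norm_num
  have h4 := abs_sub_abs_le_abs_sub (sin s - s) (-(s ^ 3 / 6))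
  rw [abs_neg, h3] at h4
  have h5 : sin s - s - -(s ^ 3 / 6) = sin s - (s - s ^ 3 / 6) := by ring
  rw [h5] at h4
  have : 0 ≤ |s| ^ 3 := by positivity
  linarith

/-- A smooth function of size `O(s⁴)` has a vanishing Taylor polynomial of order two. -/
lemma eq_zero_and_iteratedDeriv_two_eq_zero (hf : ContDiffAt ℝ ∞ f 0)
    (hO : f =O[𝓝 0] fun s => s ^ 4) : f 0 = 0 ∧ iteratedDeriv 2 f 0 = 0 := by
  have h0 : f 0 = 0 := by
    obtain ⟨C, -, hb⟩ := hO.exists_nonneg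
    simpa using hb.bound.self_of_nhds
  refine ⟨h0, ?_⟩
  obtain ⟨d, hd⟩ := exists_taylor_isBigO_pow_four hf
  have h1 := hO.sub hd
  -- Adding the reflected expansion removes the odd terms, isolating the quadratic one.
  have h2 : (fun s : ℝ => iteratedDeriv 2 f 0 * s ^ 2) =O[𝓝 0] fun s => s ^ 4 := by
    refine (h1.add (IsBigO.comp_neg h1)).congr_left fun s => ?_
    rw [h0]
    ring
  obtain ⟨C, hC, hb⟩ := h2.exists_nonneg
  by_contra hne
  have hlim : Tendsto (fun s : ℝ => C * s ^ 2) (𝓝[≠] 0) (𝓝 0) := by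
    have : Tendsto (fun s : ℝ => C * s ^ 2) (𝓝 0) (𝓝 (C * 0 ^ 2)) :=
      (continuous_const.mul (continuous_id.pow 2)).tendsto 0
    simpa using this.mono_left nhdsWithin_le_nhds
  have hpos : 0 < |iteratedDeriv 2 f 0| := abs_pos.2 hne
  obtain ⟨s, ⟨hs1, hs2⟩, hs3⟩ := (((hlim.eventually_lt_const hpos).and
    (hb.bound.filter_mono nhdsWithin_le_nhds)).and eventually_mem_nhdsWithin).exists
  have hs0 : 0 < s ^ 2 := by
    have : s ≠ 0 := hs3
    positivity
  rw [norm_mul, norm_pow, norm_pow, Real.norm_eq_abs, Real.norm_eq_abs,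
    show |s| ^ 4 = s ^ 2 * s ^ 2 by rw [← sq_abs]; ring, sq_abs] at hs2
  nlinarith

lemma symmPart_zero (f : ℝ → ℝ) : symmPart f 0 = f 0 := by simp [symmPart]

lemma contDiffAt_comp_neg (hf : ContDiffAt ℝ ∞ f 0) : ContDiffAt ℝ ∞ (fun s => f (-s)) 0 := by
  have h : ContDiffAt ℝ ∞ f (-0) := by rwa [neg_zero]
  exact h.comp (0 : ℝ) contDiffAt_id.neg

lemma contDiffAt_symmPart (hf : ContDiffAt ℝ ∞ f 0) : ContDiffAt ℝ ∞ (symmPart f) 0 :=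
  (hf.add (contDiffAt_comp_neg hf)).div_const 2

lemma contDiffAt_antisymmPart (hf : ContDiffAt ℝ ∞ f 0) : ContDiffAt ℝ ∞ (antisymmPart f) 0 :=
  (hf.sub (contDiffAt_comp_neg hf)).div_const 2

/-- The quadratic term is modelled by `1 - cos s` because `(1 - cos s)(1 + cos s) = sin² s`, whose
integral against `circleDist⁻²` is explicit. `antisymmPart_mul_sin_sub_isBigO` uses `sin² s` as its
model for the same reason. -/
lemma symmPart_sub_isBigO (hf : ContDiffAt ℝ ∞ f 0) :
    (fun s => symmPart f s - f 0 - iteratedDeriv 2 f 0 * (1 - cos s)) =O[𝓝 0] fun s => s ^ 4 := by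
  obtain ⟨d, hd⟩ := exists_taylor_isBigO_pow_four hf
  refine (((hd.add (IsBigO.comp_neg hd)).const_mul_left (1 / 2)).sub
    (one_sub_cos_sub_isBigO.const_mul_left (iteratedDeriv 2 f 0))).congr_left fun s => ?_
  unfold symmPart
  ring

lemma symmPart_sub_isBigO_sq (hf : ContDiffAt ℝ ∞ f 0) :
    (fun s => symmPart f s - f 0) =O[𝓝 0] fun s => s ^ (2 * 1) := by
  obtain ⟨d, hd⟩ := exists_taylor_isBigO_pow_four hf
  have h1 := ((hd.add (IsBigO.comp_neg hd)).const_mul_left (1 / 2)).trans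
    (isBigO_pow_pow_nhds_zero (m := 2) (by norm_num))
  have h2 : (fun s : ℝ => iteratedDeriv 2 f 0 / 2 * s ^ 2) =O[𝓝 0] fun s => s ^ 2 :=
    (isBigO_refl _ _).const_mul_left _
  refine (h1.add h2).congr_left fun s => ?_
  unfold symmPart
  ring

lemma antisymmPart_mul_sin_sub_isBigO (hf : ContDiffAt ℝ ∞ f 0) :
    (fun s => antisymmPart f s * sin s - deriv f 0 * sin s ^ 2) =O[𝓝 0] fun s => s ^ 4 := by
  obtain ⟨d, hd⟩ := exists_taylor_isBigO_pow_four hf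
  have h1 := ((hd.sub (IsBigO.comp_neg hd)).const_mul_left (1 / 2)).trans
    (isBigO_pow_pow_nhds_zero (m := 3) (by norm_num))
  have h2 : (fun s : ℝ => d * s ^ 3) =O[𝓝 0] fun s => s ^ 3 :=
    (isBigO_refl _ _).const_mul_left _
  have h3 := ((h1.add h2).sub (sin_sub_isBigO.const_mul_left (deriv f 0))).mul sin_isBigO
  refine (h3.congr_left fun s => ?_).congr_right fun s => ?_
  · unfold antisymmPart
    ring
  · ring

end Taylor

/-! ### Integrability of the symmetrized density and of its quotients -/

section Quotients

variable {f : ℝ → ℝ}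

lemma intervalIntegrable_comp_neg (hf : IntervalIntegrable f volume (-π) π) :
    IntervalIntegrable (fun s => f (-s)) volume (-π) π := by
  have h := (IntervalIntegrable.iff_comp_neg (by finiteness)).1 hf
  rw [neg_neg] at h
  exact h.symm

lemma intervalIntegrable_symmPart (hf : IntervalIntegrable f volume (-π) π) :
    IntervalIntegrable (symmPart f) volume (-π) π :=
  (hf.add (intervalIntegrable_comp_neg hf)).div_const 2

lemma intervalIntegrable_antisymmPart (hf : IntervalIntegrable f volume (-π) π) :
    IntervalIntegrable (antisymmPart f) volume (-π) π :=
  (hf.sub (intervalIntegrable_comp_neg hf)).div_const 2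

lemma isTameWeight_symmPart (hf : IntervalIntegrable f volume (-π) π) (hs : ContDiffAt ℝ ∞ f 0) :
    IsTameWeight fun s => (symmPart f s - f 0) / (1 - cos s) := by
  simpa only [pow_one] using IsTameWeight.div_one_sub_cos_pow (m := 1)
    ((intervalIntegrable_symmPart hf).sub intervalIntegrable_const) (symmPart_sub_isBigO_sq hs)

lemma isTameWeight_symmPart_sq (hf : IntervalIntegrable f volume (-π) π)
    (hs : ContDiffAt ℝ ∞ f 0) :
    IsTameWeight fun s =>
      (symmPart f s - f 0 - iteratedDeriv 2 f 0 * (1 - cos s)) / (1 - cos s) ^ 2 := by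
  refine IsTameWeight.div_one_sub_cos_pow (m := 2) ?_ (symmPart_sub_isBigO hs)
  exact ((intervalIntegrable_symmPart hf).sub intervalIntegrable_const).sub
    (Continuous.intervalIntegrable (by fun_prop) _ _)

lemma isTameWeight_antisymmPart (hf : IntervalIntegrable f volume (-π) π)
    (hs : ContDiffAt ℝ ∞ f 0) :
    IsTameWeight fun s =>
      (antisymmPart f s * sin s - deriv f 0 * sin s ^ 2) / (1 - cos s) ^ 2 := by
  refine IsTameWeight.div_one_sub_cos_pow (m := 2) ?_ (antisymmPart_mul_sin_sub_isBigO hs)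
  exact ((intervalIntegrable_antisymmPart hf).mul_continuousOn continuous_sin.continuousOn).sub
    (Continuous.intervalIntegrable (by fun_prop) _ _)

lemma IsTameWeight.intervalIntegrable_congr {v g : ℝ → ℝ} (hv : IsTameWeight v)
    (h : ∀ s, s ≠ 0 → g s = v s) : IntervalIntegrable g volume (-π) π := by
  refine hv.intervalIntegrable.congr_ae (ae_restrict_of_ae ?_)
  filter_upwards [compl_mem_ae_iff.2 (measure_singleton (0 : ℝ))] with s hs
  exact (h s hs).symm

lemma opI_congr {v g : ℝ → ℝ} (h : ∀ s, s ≠ 0 → g s = v s) : opI g = opI v := by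
  unfold opI
  congr 1
  refine intervalIntegral.integral_congr_ae ?_
  filter_upwards [compl_mem_ae_iff.2 (measure_singleton (0 : ℝ))] with s hs _
  exact h s hs

lemma integral_eq_opI (g : ℝ → ℝ) : ∫ s in (-π)..π, g s = 2 * π * opI g := by
  have := pi_pos
  unfold opI
  field_simp

lemma opT_symmPart (f : ℝ → ℝ) {s : ℝ} (hs : s ≠ 0) :
    opT (symmPart f) s = (symmPart f s - f 0) / (1 - cos s) := by
  rw [opT, if_neg hs, symmPart_zero]

/-- Both `g 0` and `g''(0)` vanish, and the latter is the value of `T g` at 0, so neither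
application of `T` subtracts anything. -/
lemma opT_opT {g : ℝ → ℝ} (hg : ContDiffAt ℝ ∞ g 0) (hO : g =O[𝓝 0] fun s => s ^ 4) {s : ℝ}
    (hs : s ≠ 0) : opT (opT g) s = g s / (1 - cos s) ^ 2 := by
  obtain ⟨h0, h2⟩ := eq_zero_and_iteratedDeriv_two_eq_zero hg hO
  have h3 : opT g 0 = 0 := by rw [opT, if_pos rfl, h2]
  rw [opT, if_neg hs, h3, opT, if_neg hs, h0, sub_zero, sub_zero, div_div, sq]

lemma symmPart_isBigO (hs : ContDiffAt ℝ ∞ f 0) (h0 : f 0 = 0) (h2 : iteratedDeriv 2 f 0 = 0) :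
    symmPart f =O[𝓝 0] fun s => s ^ 4 := by
  simpa [h0, h2] using symmPart_sub_isBigO hs

lemma symmPart_mul_cos_isBigO (hs : ContDiffAt ℝ ∞ f 0) (h0 : f 0 = 0)
    (h2 : iteratedDeriv 2 f 0 = 0) : (fun s => symmPart f s * cos s) =O[𝓝 0] fun s => s ^ 4 := by
  simpa using (symmPart_isBigO hs h0 h2).mul ((continuous_cos.tendsto 0).isBigO_one ℝ)

lemma antisymmPart_mul_sin_isBigO (hs : ContDiffAt ℝ ∞ f 0) (h1 : deriv f 0 = 0) :
    (fun s => antisymmPart f s * sin s) =O[𝓝 0] fun s => s ^ 4 := by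
  simpa [h1] using antisymmPart_mul_sin_sub_isBigO hs

end Quotients

/-! ### The intensity on a ray in terms of the rotated density -/

lemma measurable_toIocMod {p : ℝ} (hp : 0 < p) (a : ℝ) : Measurable (toIocMod hp a) := by
  have h : toIocMod hp a = fun b => b - ((-⌊(a + p - b) / p⌋ : ℤ) : ℝ) * p := by
    ext b
    rw [toIocMod, toIocDiv_eq_neg_floor, zsmul_eq_mul]
  rw [h]
  have h1 : Measurable fun b : ℝ => ((-⌊(a + p - b) / p⌋ : ℤ) : ℝ) := by
    have h2 : Measurable fun b : ℝ => (a + p - b) / p := by fun_prop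
    exact (measurable_from_top (f := fun n : ℤ => ((-n : ℤ) : ℝ))).comp
      (Int.measurable_floor.comp h2)
  fun_prop

section Rotation

variable {F : Measure ℝ} {φ : ℝ} {f : ℝ → ℝ}

/-- By periodicity, the reduction modulo `2π` in the rotated measure does not affect the integrand.
-/
lemma integral_comp_sub_eq {E : Type*} [NormedAddCommGroup E] [NormedSpace ℝ E]
    (hf : IsDensityOnCircle f (rotatedMeasure F φ)) {Ψ : ℝ → E} (hΨ : StronglyMeasurable Ψ)
    (hper : Function.Periodic Ψ (2 * π)) :
    ∫ t, Ψ (t - φ) ∂F = ∫ s in (-π)..π, f s • Ψ s := by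
  have h1 : ∀ t, Ψ (t - φ) = Ψ (toIocMod two_pi_pos (-π) (t - φ)) := by
    intro t
    rw [toIocMod, hper.sub_zsmul_eq]
  have hm : Measurable fun t => toIocMod two_pi_pos (-π) (t - φ) :=
    (measurable_toIocMod _ _).comp (measurable_id.sub_const φ)
  simp only [h1]
  rw [← integral_map (f := Ψ) hm.aemeasurable hΨ.aestronglyMeasurable]
  change ∫ s, Ψ s ∂(rotatedMeasure F φ) = _
  rw [hf.eq_withDensity, integral_withDensity_eq_integral_toReal_smul₀
    hf.integrable.aemeasurable.ennreal_ofReal (by simp),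
    intervalIntegral.integral_of_le (by linarith [pi_pos])]
  refine setIntegral_congr_fun measurableSet_Ioc fun s hs => ?_
  rw [ENNReal.toReal_ofReal (hf.nonneg s hs)]

lemma IsDensityOnCircle.intervalIntegrable {G : Measure ℝ} (hf : IsDensityOnCircle f G) :
    IntervalIntegrable f volume (-π) π :=
  (intervalIntegrable_iff_integrableOn_Ioc_of_le (by linarith [pi_pos])).2 hf.integrable

lemma integral_mul_eq_symmPart (hf : IntervalIntegrable f volume (-π) π) {Ψ : ℝ → ℝ}
    (hΨ : Continuous Ψ) (heven : ∀ s, Ψ (-s) = Ψ s) :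
    ∫ s in (-π)..π, f s * Ψ s = ∫ s in (-π)..π, symmPart f s * Ψ s := by
  have h1 : IntervalIntegrable (fun s => f s * Ψ s) volume (-π) π :=
    hf.mul_continuousOn hΨ.continuousOn
  have h2 : IntervalIntegrable (fun s => f (-s) * Ψ s) volume (-π) π :=
    (intervalIntegrable_comp_neg hf).mul_continuousOn hΨ.continuousOn
  have h3 := intervalIntegral.integral_comp_neg (a := -π) (b := π) fun s => f s * Ψ s
  simp only [heven, neg_neg] at h3
  have e : ∀ s, symmPart f s * Ψ s = 1 / 2 * (f s * Ψ s + f (-s) * Ψ s) := by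
    intro s; unfold symmPart; ring
  simp only [e]
  rw [intervalIntegral.integral_const_mul, intervalIntegral.integral_add h1 h2, h3]
  ring

lemma integral_mul_eq_antisymmPart (hf : IntervalIntegrable f volume (-π) π) {Ψ : ℝ → ℝ}
    (hΨ : Continuous Ψ) (hodd : ∀ s, Ψ (-s) = -Ψ s) :
    ∫ s in (-π)..π, f s * Ψ s = ∫ s in (-π)..π, antisymmPart f s * Ψ s := by
  have h1 : IntervalIntegrable (fun s => f s * Ψ s) volume (-π) π :=
    hf.mul_continuousOn hΨ.continuousOn
  have h2 : IntervalIntegrable (fun s => f (-s) * Ψ s) volume (-π) π :=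
    (intervalIntegrable_comp_neg hf).mul_continuousOn hΨ.continuousOn
  have h3 := intervalIntegral.integral_comp_neg (a := -π) (b := π) fun s => f s * Ψ s
  simp only [hodd, neg_neg, mul_neg, intervalIntegral.integral_neg] at h3
  have e : ∀ s, antisymmPart f s * Ψ s = 1 / 2 * (f s * Ψ s - f (-s) * Ψ s) := by
    intro s; unfold antisymmPart; ring
  simp only [e]
  rw [intervalIntegral.integral_const_mul, intervalIntegral.integral_sub h1 h2, ← h3]
  ring

lemma spectralKernel_ray (r φ t : ℝ) : spectralKernel (r * Complex.exp (φ * Complex.I)) t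
    = (1 - r * Complex.exp (-((t - φ : ℝ) * Complex.I)))⁻¹ := by
  unfold spectralKernel
  rw [mul_assoc, ← Complex.exp_add]
  congr 4
  push_cast
  ring

lemma norm_sq_one_sub_mul_exp (r s : ℝ) :
    ‖1 - r * Complex.exp (-(s * Complex.I))‖ ^ 2 = circleDist r s := by
  have h : 1 - r * Complex.exp (-(s * Complex.I))
      = Complex.exp (-(s * Complex.I)) * (Complex.exp (s * Complex.I) - r) := by
    rw [mul_sub, ← Complex.exp_add, neg_add_cancel, Complex.exp_zero]
    ring
  have h1 : ‖Complex.exp (-(s * Complex.I))‖ = 1 := by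
    have := Complex.norm_exp_ofReal_mul_I (-s)
    simpa using this
  rw [h, norm_mul, h1, one_mul, norm_exp_mul_I_sub_sq]

lemma norm_spectralKernel_ray_sq (r φ t : ℝ) :
    ‖spectralKernel (r * Complex.exp (φ * Complex.I)) t‖ ^ 2 = (circleDist r (t - φ))⁻¹ := by
  rw [spectralKernel_ray, norm_inv, inv_pow, norm_sq_one_sub_mul_exp]

lemma norm_spectralKernelDeriv_ray_sq (r φ t : ℝ) :
    ‖spectralKernelDeriv (r * Complex.exp (φ * Complex.I)) t‖ ^ 2
      = (circleDist r (t - φ) ^ 2)⁻¹ := by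
  unfold spectralKernelDeriv
  rw [norm_mul, norm_exp_neg_I_mul, one_mul, norm_pow, norm_spectralKernel_ray_sq, inv_pow]

/-- The product is `e^{-it} K |K|²`. With `s = t - φ` this leaves `e^{-iφ}(e^{-is} - r)` over the
squared distance; the phase disappears when the modulus of the integral is taken. -/
lemma spectralKernelDeriv_ray_mul_conj (r φ t : ℝ) :
    spectralKernelDeriv (r * Complex.exp (φ * Complex.I)) t
        * conj (spectralKernel (r * Complex.exp (φ * Complex.I)) t)
      = Complex.exp ((-φ : ℝ) * Complex.I)
        * ((((cos (t - φ) - r) / circleDist r (t - φ) ^ 2 : ℝ) : ℂ)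
          - ((sin (t - φ) / circleDist r (t - φ) ^ 2 : ℝ) : ℂ) * Complex.I) := by
  unfold spectralKernelDeriv
  have h1 := Complex.mul_conj (spectralKernel (r * Complex.exp (φ * Complex.I)) t)
  rw [Complex.normSq_eq_norm_sq, norm_spectralKernel_ray_sq] at h1
  rw [mul_assoc, sq, mul_assoc, h1, spectralKernel_ray, Complex.inv_def,
    Complex.normSq_eq_norm_sq, norm_sq_one_sub_mul_exp]
  set s := t - φ with hs
  have h2 : Complex.exp (-(Complex.I * t))
      = Complex.exp ((-φ : ℝ) * Complex.I) * Complex.exp ((-s : ℝ) * Complex.I) := by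
    rw [← Complex.exp_add]
    congr 1
    rw [hs]
    push_cast
    ring
  have h3 : conj (1 - (r : ℂ) * Complex.exp (-(s * Complex.I)))
      = 1 - r * Complex.exp (s * Complex.I) := by
    rw [map_sub, map_one, map_mul, Complex.conj_ofReal, ← Complex.exp_conj]
    simp
  have h4 : Complex.exp ((-s : ℝ) * Complex.I) * (1 - r * Complex.exp (s * Complex.I))
      = ((cos s - r : ℝ) : ℂ) - (sin s : ℝ) * Complex.I := by
    rw [mul_sub, mul_left_comm, ← Complex.exp_add]
    simp only [Complex.ofReal_neg, neg_mul, neg_add_cancel, Complex.exp_zero, mul_one]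
    rw [← neg_mul, Complex.exp_mul_I, Complex.cos_neg, Complex.sin_neg]
    push_cast
    ring
  rw [h2, h3, mul_assoc]
  congr 1
  calc _ = Complex.exp ((-s : ℝ) * Complex.I) * (1 - r * Complex.exp (s * Complex.I))
        * ((circleDist r s : ℂ) ^ 2)⁻¹ := by push_cast; ring
    _ = _ := by rw [h4]; push_cast; ring

/-- The intensity on the ray of argument `φ`, in terms of integrals of the even and odd parts of
the rotated spectral density. -/
lemma zeroIntensity_ray (hf : IsDensityOnCircle f (rotatedMeasure F φ)) {r : ℝ} (h0 : 0 ≤ r)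
    (h1 : r < 1) :
    zeroIntensity F (r * Complex.exp (φ * Complex.I)) = π⁻¹ *
      (((∫ s in (-π)..π, symmPart f s * ((1 - cos s) / circleDist r s ^ 2))
          * (∫ s in (-π)..π, symmPart f s * ((1 + cos s) / circleDist r s ^ 2))
        - (∫ s in (-π)..π, antisymmPart f s * (sin s / circleDist r s ^ 2)) ^ 2)
        / (∫ s in (-π)..π, symmPart f s * (circleDist r s)⁻¹) ^ 2) := by
  have hfi := hf.intervalIntegrable
  have hne := circleDist_ne_zero h0 h1
  have hc := continuous_circleDist r
  have hinv : Continuous fun s => (circleDist r s)⁻¹ := hc.inv₀ hne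
  have hinv2 : Continuous fun s => (circleDist r s ^ 2)⁻¹ :=
    (hc.pow 2).inv₀ fun s => pow_ne_zero 2 (hne s)
  have hcos : Continuous fun s => (cos s - r) / circleDist r s ^ 2 :=
    (continuous_cos.sub continuous_const).mul hinv2
  have hsin : Continuous fun s => sin s / circleDist r s ^ 2 := continuous_sin.mul hinv2
  have hD : Function.Periodic (circleDist r) (2 * π) := fun s => by simp [circleDist]
  have e1 : ∫ t, ‖spectralKernel (r * Complex.exp (φ * Complex.I)) t‖ ^ 2 ∂F
      = ∫ s in (-π)..π, symmPart f s * (circleDist r s)⁻¹ := by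
    simp only [norm_spectralKernel_ray_sq]
    rw [integral_comp_sub_eq hf (Ψ := fun s => (circleDist r s)⁻¹) hinv.stronglyMeasurable
      (fun s => by simp only [hD s])]
    exact integral_mul_eq_symmPart hfi hinv fun s => by rw [circleDist_neg]
  have e2 : ∫ t, ‖spectralKernelDeriv (r * Complex.exp (φ * Complex.I)) t‖ ^ 2 ∂F
      = ∫ s in (-π)..π, symmPart f s * (circleDist r s ^ 2)⁻¹ := by
    simp only [norm_spectralKernelDeriv_ray_sq]
    rw [integral_comp_sub_eq hf (Ψ := fun s => (circleDist r s ^ 2)⁻¹) hinv2.stronglyMeasurable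
      (fun s => by simp only [hD s])]
    exact integral_mul_eq_symmPart hfi hinv2 fun s => by rw [circleDist_neg]
  have e3 : ‖∫ t, spectralKernelDeriv (r * Complex.exp (φ * Complex.I)) t
        * conj (spectralKernel (r * Complex.exp (φ * Complex.I)) t) ∂F‖ ^ 2
      = (∫ s in (-π)..π, symmPart f s * ((cos s - r) / circleDist r s ^ 2)) ^ 2
        + (∫ s in (-π)..π, antisymmPart f s * (sin s / circleDist r s ^ 2)) ^ 2 := by
    have hcont : Continuous fun s => ((((cos s - r) / circleDist r s ^ 2 : ℝ) : ℂ)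
          - ((sin s / circleDist r s ^ 2 : ℝ) : ℂ) * Complex.I) :=
      (Complex.continuous_ofReal.comp hcos).sub
        ((Complex.continuous_ofReal.comp hsin).mul continuous_const)
    simp only [spectralKernelDeriv_ray_mul_conj]
    rw [integral_const_mul, norm_mul, Complex.norm_exp_ofReal_mul_I, one_mul,
      integral_comp_sub_eq hf (Ψ := fun s => ((((cos s - r) / circleDist r s ^ 2 : ℝ) : ℂ)
          - ((sin s / circleDist r s ^ 2 : ℝ) : ℂ) * Complex.I)) hcont.stronglyMeasurable
        (fun s => by simp only [hD s, cos_add_two_pi, sin_add_two_pi])]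
    have hi1 : IntervalIntegrable (fun s => ((f s * ((cos s - r) / circleDist r s ^ 2) : ℝ) : ℂ))
        volume (-π) π :=
      have h := hfi.mul_continuousOn hcos.continuousOn
      ⟨h.1.ofReal, h.2.ofReal⟩
    have hi2 : IntervalIntegrable
        (fun s => ((f s * (sin s / circleDist r s ^ 2) : ℝ) : ℂ) * Complex.I)
        volume (-π) π :=
      have h := hfi.mul_continuousOn hsin.continuousOn
      IntervalIntegrable.mul_const ⟨h.1.ofReal, h.2.ofReal⟩ _
    have e : ∀ s, f s • ((((cos s - r) / circleDist r s ^ 2 : ℝ) : ℂ)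
          - ((sin s / circleDist r s ^ 2 : ℝ) : ℂ) * Complex.I)
        = ((f s * ((cos s - r) / circleDist r s ^ 2) : ℝ) : ℂ)
          - ((f s * (sin s / circleDist r s ^ 2) : ℝ) : ℂ) * Complex.I := by
      intro s
      rw [Complex.real_smul]
      push_cast
      ring
    simp only [e]
    rw [intervalIntegral.integral_sub hi1 hi2, intervalIntegral.integral_mul_const,
      intervalIntegral.integral_ofReal, intervalIntegral.integral_ofReal,
      integral_mul_eq_symmPart hfi hcos fun s => by rw [circleDist_neg, cos_neg],
      integral_mul_eq_antisymmPart hfi hsin fun s => by rw [circleDist_neg, sin_neg, neg_div],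
      ← Complex.normSq_eq_norm_sq, Complex.normSq_apply]
    simp only [Complex.sub_re, Complex.sub_im, Complex.mul_re, Complex.mul_im, Complex.ofReal_re,
      Complex.ofReal_im, Complex.I_re, Complex.I_im]
    ring
  have hh := intervalIntegrable_symmPart hfi
  -- All even integrals are combinations of `I₀` and `I₁`, the integrals against `circleDist⁻²` and
  -- `cos s * circleDist⁻²`. In these terms `N D - (Re)²` is `I₀² - I₁²`, independently of the
  -- explicit `r`, and factors into the integrals against `1 ± cos s`.
  have hlin : ∀ p q : ℝ, ∫ s in (-π)..π, symmPart f s * ((p + q * cos s) / circleDist r s ^ 2)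
      = p * (∫ s in (-π)..π, symmPart f s * (circleDist r s ^ 2)⁻¹)
        + q * ∫ s in (-π)..π, symmPart f s * (cos s * (circleDist r s ^ 2)⁻¹) := by
    intro p q
    have hi1 : IntervalIntegrable (fun s => p * (symmPart f s * (circleDist r s ^ 2)⁻¹))
        volume (-π) π := (hh.mul_continuousOn hinv2.continuousOn).const_mul p
    have hi2 : IntervalIntegrable (fun s => q * (symmPart f s * (cos s * (circleDist r s ^ 2)⁻¹)))
        volume (-π) π :=
      (hh.mul_continuousOn (continuous_cos.mul hinv2).continuousOn).const_mul q
    rw [← intervalIntegral.integral_const_mul, ← intervalIntegral.integral_const_mul,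
      ← intervalIntegral.integral_add hi1 hi2]
    congr 1
    ext s
    ring
  have l1 := hlin 1 (-1)
  have l2 := hlin 1 1
  have l3 := hlin (-r) 1
  have l4 := hlin (1 + r ^ 2) (-(2 * r))
  have c1 : ∀ s, 1 + -1 * cos s = 1 - cos s := fun s => by ring
  have c2 : ∀ s, 1 + 1 * cos s = 1 + cos s := fun s => by ring
  have c3 : ∀ s, -r + 1 * cos s = cos s - r := fun s => by ring
  have c4 : ∀ s, (1 + r ^ 2 + -(2 * r) * cos s) / circleDist r s ^ 2 = (circleDist r s)⁻¹ := by
    intro s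
    have := hne s
    rw [show 1 + r ^ 2 + -(2 * r) * cos s = circleDist r s by unfold circleDist; ring]
    field_simp
  simp only [c1] at l1
  simp only [c2] at l2
  simp only [c3] at l3
  simp only [c4] at l4
  unfold zeroIntensity
  rw [e1, e2, e3, l1, l2, l3]
  congr 2
  rw [l4]
  ring

end Rotation

/-! ### Asymptotics of the integrals -/

lemma one_sub_cos_pos {s : ℝ} (hs : |s| ≤ π) (h0 : s ≠ 0) : 0 < 1 - cos s := by
  refine lt_of_lt_of_le ?_ (mul_sq_le_one_sub_cos hs)
  have := pi_pos
  positivity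

/-- On `[-π, π]` the divisor vanishes only at 0, where `q 0 = 0` makes both sides zero; so division
by it can be undone pointwise. -/
lemma div_one_sub_cos_pow_mul {q : ℝ → ℝ} (hq : q 0 = 0) (m : ℕ) (x : ℝ) {s : ℝ}
    (hs : s ∈ uIcc (-π) π) :
    q s / (1 - cos s) ^ m * ((1 - cos s) ^ m * x) = q s * x := by
  rw [uIcc_of_le (by linarith [pi_pos])] at hs
  rcases eq_or_ne s 0 with rfl | h
  · simp [hq]
  · have := (one_sub_cos_pos (abs_le.2 hs) h).ne'
    field_simp

section Asymptotics

variable {f : ℝ → ℝ} {r : ℝ}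

lemma integral_symmPart_circleDist (hf : IntervalIntegrable f volume (-π) π)
    (hs : ContDiffAt ℝ ∞ f 0) (h0 : 0 ≤ r) (h1 : r < 1) :
    ∫ s in (-π)..π, symmPart f s * (circleDist r s)⁻¹
      = f 0 * (2 * π / (1 - r ^ 2))
        + ∫ s in (-π)..π, (symmPart f s - f 0) / (1 - cos s) * ((1 - cos s) / circleDist r s) := by
  have hinv : Continuous fun s => (circleDist r s)⁻¹ :=
    (continuous_circleDist r).inv₀ (circleDist_ne_zero h0 h1)
  rw [← integral_inv_circleDist h0 h1, ← intervalIntegral.integral_const_mul,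
    ← intervalIntegral.integral_add]
  · refine intervalIntegral.integral_congr fun s hsm => ?_
    have := div_one_sub_cos_pow_mul (q := fun s => symmPart f s - f 0)
      (by simp [symmPart_zero]) 1 (circleDist r s)⁻¹ hsm
    simp only [pow_one] at this
    simp only [div_eq_mul_inv] at this ⊢
    rw [this]
    ring
  · exact (hinv.intervalIntegrable _ _).const_mul _
  · exact (isTameWeight_symmPart hf hs).intervalIntegrable.mul_continuousOn
      ((continuous_const.sub continuous_cos).mul hinv).continuousOn

lemma continuous_div_circleDist_sq (h0 : 0 ≤ r) (h1 : r < 1) {c : ℝ → ℝ} (hc : Continuous c) :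
    Continuous fun s => c s / circleDist r s ^ 2 :=
  hc.div ((continuous_circleDist r).pow 2) fun s => pow_ne_zero 2 (circleDist_ne_zero h0 h1 s)

lemma integral_symmPart_one_sub_cos (hf : IntervalIntegrable f volume (-π) π)
    (hs : ContDiffAt ℝ ∞ f 0) (h0 : 0 ≤ r) (h1 : r < 1) :
    ∫ s in (-π)..π, symmPart f s * ((1 - cos s) / circleDist r s ^ 2)
      = f 0 * (∫ s in (-π)..π, (1 - cos s) / circleDist r s ^ 2)
        + ∫ s in (-π)..π,
            (symmPart f s - f 0) / (1 - cos s) * ((1 - cos s) ^ 2 / circleDist r s ^ 2) := by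
  rw [← intervalIntegral.integral_const_mul, ← intervalIntegral.integral_add]
  · refine intervalIntegral.integral_congr fun s hsm => ?_
    have := div_one_sub_cos_pow_mul (q := fun s => symmPart f s - f 0)
      (by simp [symmPart_zero]) 1 ((1 - cos s) / circleDist r s ^ 2) hsm
    simp only [pow_one] at this
    have e : (1 - cos s) ^ 2 / circleDist r s ^ 2
        = (1 - cos s) * ((1 - cos s) / circleDist r s ^ 2) := by ring
    simp only [e]
    rw [this]
    ring
  · exact (continuous_div_circleDist_sq h0 h1
      (continuous_const.sub continuous_cos)).intervalIntegrable _ _ |>.const_mul _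
  · exact (isTameWeight_symmPart hf hs).intervalIntegrable.mul_continuousOn
      (continuous_div_circleDist_sq h0 h1 ((continuous_const.sub continuous_cos).pow 2)).continuousOn

/-- With `f 0 = 0` the leading term is quadratic and contributes the integral of `sin² s`. If `f 0 ≠
0` the singularity is stronger, and `sq_mul_integral_one_add_cos` replaces this lemma. -/
lemma integral_symmPart_one_add_cos (hf : IntervalIntegrable f volume (-π) π)
    (hs : ContDiffAt ℝ ∞ f 0) (hf0 : f 0 = 0) (h0 : 0 < r) (h1 : r < 1) :
    ∫ s in (-π)..π, symmPart f s * ((1 + cos s) / circleDist r s ^ 2)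
      = iteratedDeriv 2 f 0 * (π / (1 - r ^ 2))
        + ∫ s in (-π)..π,
            (symmPart f s - f 0 - iteratedDeriv 2 f 0 * (1 - cos s)) / (1 - cos s) ^ 2
              * (1 + cos s) * ((1 - cos s) ^ 2 / circleDist r s ^ 2) := by
  rw [← integral_sin_sq_div_circleDist_sq h0 h1, ← intervalIntegral.integral_const_mul,
    ← intervalIntegral.integral_add]
  · refine intervalIntegral.integral_congr fun s hsm => ?_
    have := div_one_sub_cos_pow_mul
      (q := fun s => symmPart f s - f 0 - iteratedDeriv 2 f 0 * (1 - cos s))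
      (by simp [symmPart_zero]) 2 ((1 + cos s) / circleDist r s ^ 2) hsm
    have e : (symmPart f s - f 0 - iteratedDeriv 2 f 0 * (1 - cos s)) / (1 - cos s) ^ 2
          * (1 + cos s) * ((1 - cos s) ^ 2 / circleDist r s ^ 2)
        = (symmPart f s - f 0 - iteratedDeriv 2 f 0 * (1 - cos s)) / (1 - cos s) ^ 2
          * ((1 - cos s) ^ 2 * ((1 + cos s) / circleDist r s ^ 2)) := by ring
    simp only [e]
    rw [this, hf0, sin_sq]
    ring
  · exact (continuous_div_circleDist_sq h0.le h1
      (continuous_sin.pow 2)).intervalIntegrable _ _ |>.const_mul _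
  · exact ((isTameWeight_symmPart_sq hf hs).mul_continuous
      (continuous_const.add continuous_cos)).intervalIntegrable.mul_continuousOn
      (continuous_div_circleDist_sq h0.le h1
        ((continuous_const.sub continuous_cos).pow 2)).continuousOn

lemma integral_antisymmPart_sin (hf : IntervalIntegrable f volume (-π) π)
    (hs : ContDiffAt ℝ ∞ f 0) (h0 : 0 < r) (h1 : r < 1) :
    ∫ s in (-π)..π, antisymmPart f s * (sin s / circleDist r s ^ 2)
      = deriv f 0 * (π / (1 - r ^ 2))
        + ∫ s in (-π)..π,
            (antisymmPart f s * sin s - deriv f 0 * sin s ^ 2) / (1 - cos s) ^ 2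
              * ((1 - cos s) ^ 2 / circleDist r s ^ 2) := by
  rw [← integral_sin_sq_div_circleDist_sq h0 h1, ← intervalIntegral.integral_const_mul,
    ← intervalIntegral.integral_add]
  · refine intervalIntegral.integral_congr fun s hsm => ?_
    have := div_one_sub_cos_pow_mul
      (q := fun s => antisymmPart f s * sin s - deriv f 0 * sin s ^ 2)
      (by simp) 2 (circleDist r s ^ 2)⁻¹ hsm
    simp only [div_eq_mul_inv] at this ⊢
    rw [this]
    ring
  · exact (continuous_div_circleDist_sq h0.le h1
      (continuous_sin.pow 2)).intervalIntegrable _ _ |>.const_mul _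
  · exact (isTameWeight_antisymmPart hf hs).intervalIntegrable.mul_continuousOn
      (continuous_div_circleDist_sq h0.le h1
        ((continuous_const.sub continuous_cos).pow 2)).continuousOn

/-- The two integrals against `1 ± cos s` combine to the integral of the Poisson kernel. -/
lemma sq_mul_integral_one_add_cos (hf : IntervalIntegrable f volume (-π) π)
    (h0 : 0 ≤ r) (h1 : r < 1) :
    (1 - r) ^ 2 * (∫ s in (-π)..π, symmPart f s * ((1 + cos s) / circleDist r s ^ 2))
      = 2 * (∫ s in (-π)..π, symmPart f s * (circleDist r s)⁻¹)
        - (1 + r) ^ 2 * ∫ s in (-π)..π, symmPart f s * ((1 - cos s) / circleDist r s ^ 2) := by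
  have hh := intervalIntegrable_symmPart hf
  have hinv : Continuous fun s => (circleDist r s)⁻¹ :=
    (continuous_circleDist r).inv₀ (circleDist_ne_zero h0 h1)
  have hi1 : IntervalIntegrable (fun s => 2 * (symmPart f s * (circleDist r s)⁻¹))
      volume (-π) π := (hh.mul_continuousOn hinv.continuousOn).const_mul 2
  have hi2 : IntervalIntegrable
      (fun s => (1 + r) ^ 2 * (symmPart f s * ((1 - cos s) / circleDist r s ^ 2)))
      volume (-π) π := (hh.mul_continuousOn (continuous_div_circleDist_sq h0 h1
        (continuous_const.sub continuous_cos)).continuousOn).const_mul _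
  rw [← intervalIntegral.integral_const_mul, ← intervalIntegral.integral_const_mul,
    ← intervalIntegral.integral_const_mul, ← intervalIntegral.integral_sub hi1 hi2]
  congr 1
  ext s
  have := circleDist_ne_zero h0 h1 s
  field_simp
  unfold circleDist
  ring

lemma opI_opT_symmPart (f : ℝ → ℝ) :
    ∫ s in (-π)..π, (symmPart f s - f 0) / (1 - cos s) = 2 * π * opI (opT (symmPart f)) := by
  rw [integral_eq_opI, opI_congr fun s hs => opT_symmPart f hs]

/-- The intensity in the case of a positive spectral density. -/
lemma linearLimit_of_ne_zero (hf : IntervalIntegrable f volume (-π) π)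
    (hs : ContDiffAt ℝ ∞ f 0) (hf0 : f 0 ≠ 0) :
    LinearLimit (fun r =>
      ((∫ s in (-π)..π, symmPart f s * ((1 - cos s) / circleDist r s ^ 2))
          * (∫ s in (-π)..π, symmPart f s * ((1 + cos s) / circleDist r s ^ 2))
        - (∫ s in (-π)..π, antisymmPart f s * (sin s / circleDist r s ^ 2)) ^ 2)
        / (∫ s in (-π)..π, symmPart f s * (circleDist r s)⁻¹) ^ 2 - 1 / (1 - r ^ 2) ^ 2)
      (-(deriv f 0 ^ 2 + opI (opT (symmPart f)) ^ 2) / (4 * f 0 ^ 2)) := by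
  have hπ := pi_pos
  have hA0 := (isTameWeight_symmPart hf hs).linearLimit_integral_div
  have hB0 := (isTameWeight_symmPart hf hs).linearLimit_integral_sq_div
  have hC0 := (isTameWeight_antisymmPart hf hs).linearLimit_integral_sq_div
  have hA := (LinearLimit.const (f 0 * (2 * π))).add (LinearLimit.one_sub_sq.mul hA0)
  -- The limit of `J0 - (1 + r)² J1`: the terms with `f 0` cancel (see `hβr`), and the tame parts
  -- give `(1/2 - 4 · 1/4)` times the integral of the weight.
  have hβ := hA0.sub ((((LinearLimit.const 1).add LinearLimit.id).pow 2).mul hB0)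
  have hC := (LinearLimit.const (deriv f 0 * π)).add (LinearLimit.one_sub_sq.mul hC0)
  rw [opI_opT_symmPart] at hβ
  have hne : f 0 * (2 * π) + 0 * (1 / 2 * ∫ s in (-π)..π, (symmPart f s - f 0) / (1 - cos s))
      ≠ 0 := by rw [zero_mul, add_zero]; positivity
  have key := (((hβ.pow 2).add (hC.pow 2)).div (hA.pow 2) (pow_ne_zero 2 hne)).neg
  have e : -(((1 / 2 * (2 * π * opI (opT (symmPart f)))
        - (1 + 1) ^ 2 * (1 / 4 * (2 * π * opI (opT (symmPart f))))) ^ 2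
      + (deriv f 0 * π + 0 * (1 / 4 * ∫ s in (-π)..π,
          (antisymmPart f s * sin s - deriv f 0 * sin s ^ 2) / (1 - cos s) ^ 2)) ^ 2)
      / (f 0 * (2 * π) + 0 * (1 / 2 * ∫ s in (-π)..π, (symmPart f s - f 0) / (1 - cos s))) ^ 2)
      = -(deriv f 0 ^ 2 + opI (opT (symmPart f)) ^ 2) / (4 * f 0 ^ 2) := by
    field_simp
    ring
  rw [e] at key
  refine key.congr' ?_
  filter_upwards [eventually_mem_Ico_half_one, hA.tendsto.eventually_ne hne] with r hr hAr
  have hr0 : 0 < r := by linarith [hr.1]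
  have hε : 1 - r ^ 2 ≠ 0 := by nlinarith [hr.2]
  have hsum := sq_mul_integral_one_add_cos hf hr0.le hr.2
  have h0 := integral_symmPart_circleDist hf hs hr0.le hr.2
  have h1 := integral_symmPart_one_sub_cos hf hs hr0.le hr.2
  have h3 := integral_antisymmPart_sin hf hs hr0 hr.2
  have hw := integral_one_sub_cos_div_circleDist_sq hr0 hr.2
  have h1r : (1 - r) ≠ 0 := by linarith [hr.2]
  have h1r' : (1 + r) ≠ 0 := by linarith [hr.2]
  have hεe : 1 - r ^ 2 = (1 - r) * (1 + r) := by ring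
  set J0 := ∫ s in (-π)..π, symmPart f s * (circleDist r s)⁻¹
  set J1 := ∫ s in (-π)..π, symmPart f s * ((1 - cos s) / circleDist r s ^ 2)
  set J2 := ∫ s in (-π)..π, symmPart f s * ((1 + cos s) / circleDist r s ^ 2)
  set J3 := ∫ s in (-π)..π, antisymmPart f s * (sin s / circleDist r s ^ 2)
  set K0 := ∫ s in (-π)..π, (symmPart f s - f 0) / (1 - cos s) * ((1 - cos s) / circleDist r s)
  set K1 := ∫ s in (-π)..π,
    (symmPart f s - f 0) / (1 - cos s) * ((1 - cos s) ^ 2 / circleDist r s ^ 2)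
  set K3 := ∫ s in (-π)..π, (antisymmPart f s * sin s - deriv f 0 * sin s ^ 2) / (1 - cos s) ^ 2
    * ((1 - cos s) ^ 2 / circleDist r s ^ 2)
  have hβr : K0 - (1 + r) ^ 2 * K1 = J0 - (1 + r) ^ 2 * J1 := by
    rw [h0, h1, mul_add, mul_left_comm, hw]
    ring
  have hAr' : f 0 * (2 * π) + (1 - r ^ 2) * K0 = (1 - r ^ 2) * J0 := by
    rw [h0]; field_simp
  have hCr : deriv f 0 * π + (1 - r ^ 2) * K3 = (1 - r ^ 2) * J3 := by
    rw [h3]; field_simp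
  rw [hAr'] at hAr
  have hJ0 : J0 ≠ 0 := right_ne_zero_of_mul hAr
  rw [hβr, hAr', hCr]
  -- Eliminating `J2` completes a square: `(1 - r²)² J1 J2 = J0² - (J0 - (1 + r)² J1)²`.
  have hJ2 : J2 = (2 * J0 - (1 + r) ^ 2 * J1) / (1 - r) ^ 2 := by
    rw [← hsum]; field_simp
  rw [hJ2, hεe]
  field_simp
  ring

/-- The intensity, multiplied by `1 - r²`, where the spectral density vanishes. -/
lemma linearLimit_of_eq_zero (hf : IntervalIntegrable f volume (-π) π)
    (hs : ContDiffAt ℝ ∞ f 0) (hf0 : f 0 = 0) (hf1 : deriv f 0 = 0)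
    (hI : opI (opT (symmPart f)) ≠ 0) :
    LinearLimit (fun r => (1 - r ^ 2) *
      (((∫ s in (-π)..π, symmPart f s * ((1 - cos s) / circleDist r s ^ 2))
          * (∫ s in (-π)..π, symmPart f s * ((1 + cos s) / circleDist r s ^ 2))
        - (∫ s in (-π)..π, antisymmPart f s * (sin s / circleDist r s ^ 2)) ^ 2)
        / (∫ s in (-π)..π, symmPart f s * (circleDist r s)⁻¹) ^ 2))
      (iteratedDeriv 2 f 0 / (2 * opI (opT (symmPart f)))) := by
  have hπ := pi_pos
  have h0 := (isTameWeight_symmPart hf hs).linearLimit_integral_div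
  have h1 := (isTameWeight_symmPart hf hs).linearLimit_integral_sq_div
  -- This is `(1 - r²) J2`, the only integral that still needs the factor `1 - r²`; the odd integral
  -- is bounded since `f'(0) = 0`.
  have h2 := (LinearLimit.const (iteratedDeriv 2 f 0 * π)).add (LinearLimit.one_sub_sq.mul
    ((isTameWeight_symmPart_sq hf hs).mul_continuous (continuous_const.add continuous_cos)
      (c := fun s => 1 + cos s)).linearLimit_integral_sq_div)
  have h3 := (isTameWeight_antisymmPart hf hs).linearLimit_integral_sq_div
  rw [opI_opT_symmPart] at h0 h1
  have hne : 1 / 2 * (2 * π * opI (opT (symmPart f))) ≠ 0 := by positivity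
  have key := ((h1.mul h2).sub (LinearLimit.one_sub_sq.mul (h3.pow 2))).div (h0.pow 2)
    (pow_ne_zero 2 hne)
  simp only [zero_mul, add_zero, sub_zero] at key
  have e : 1 / 4 * (2 * π * opI (opT (symmPart f))) * (iteratedDeriv 2 f 0 * π)
      / (1 / 2 * (2 * π * opI (opT (symmPart f)))) ^ 2
      = iteratedDeriv 2 f 0 / (2 * opI (opT (symmPart f))) := by
    field_simp
    ring
  rw [e] at key
  refine key.congr' ?_
  filter_upwards [eventually_mem_Ico_half_one] with r hr
  have hr0 : 0 < r := by linarith [hr.1]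
  have hε : 1 - r ^ 2 ≠ 0 := by nlinarith [hr.2]
  rw [integral_symmPart_circleDist hf hs hr0.le hr.2,
    integral_symmPart_one_sub_cos hf hs hr0.le hr.2,
    integral_symmPart_one_add_cos hf hs hf0 hr0 hr.2, integral_antisymmPart_sin hf hs hr0 hr.2,
    hf1, hf0]
  simp only [zero_mul, zero_add]
  rw [← mul_div_assoc]
  congr 1
  field_simp

lemma intervalIntegrable_opT_symmPart (hf : IntervalIntegrable f volume (-π) π)
    (hs : ContDiffAt ℝ ∞ f 0) : IntervalIntegrable (opT (symmPart f)) volume (-π) π :=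
  (isTameWeight_symmPart hf hs).intervalIntegrable_congr fun _ h => opT_symmPart f h

lemma isTameWeight_symmPart_of_eq_zero (hf : IntervalIntegrable f volume (-π) π)
    (hs : ContDiffAt ℝ ∞ f 0) (hf0 : f 0 = 0) (hf2 : iteratedDeriv 2 f 0 = 0) :
    IsTameWeight fun s => symmPart f s / (1 - cos s) ^ 2 := by
  simpa [hf0, hf2] using isTameWeight_symmPart_sq hf hs

lemma isTameWeight_symmPart_mul_cos (hf : IntervalIntegrable f volume (-π) π)
    (hs : ContDiffAt ℝ ∞ f 0) (hf0 : f 0 = 0) (hf2 : iteratedDeriv 2 f 0 = 0) :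
    IsTameWeight fun s => symmPart f s * cos s / (1 - cos s) ^ 2 := by
  have := (isTameWeight_symmPart_of_eq_zero hf hs hf0 hf2).mul_continuous continuous_cos
  simpa only [div_mul_eq_mul_div] using this

lemma isTameWeight_antisymmPart_of_eq_zero (hf : IntervalIntegrable f volume (-π) π)
    (hs : ContDiffAt ℝ ∞ f 0) (hf1 : deriv f 0 = 0) :
    IsTameWeight fun s => antisymmPart f s * sin s / (1 - cos s) ^ 2 := by
  simpa [hf1] using isTameWeight_antisymmPart hf hs

lemma opT_opT_symmPart (hs : ContDiffAt ℝ ∞ f 0) (hf0 : f 0 = 0) (hf2 : iteratedDeriv 2 f 0 = 0)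
    {s : ℝ} (h : s ≠ 0) : opT (opT (symmPart f)) s = symmPart f s / (1 - cos s) ^ 2 :=
  opT_opT (contDiffAt_symmPart hs) (symmPart_isBigO hs hf0 hf2) h

lemma opT_opT_symmPart_mul_cos (hs : ContDiffAt ℝ ∞ f 0) (hf0 : f 0 = 0)
    (hf2 : iteratedDeriv 2 f 0 = 0) {s : ℝ} (h : s ≠ 0) :
    opT (opT fun s => symmPart f s * cos s) s = symmPart f s * cos s / (1 - cos s) ^ 2 :=
  opT_opT ((contDiffAt_symmPart hs).mul contDiff_cos.contDiffAt)
    (symmPart_mul_cos_isBigO hs hf0 hf2) h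

lemma opT_opT_antisymmPart_mul_sin (hs : ContDiffAt ℝ ∞ f 0) (hf1 : deriv f 0 = 0) {s : ℝ}
    (h : s ≠ 0) :
    opT (opT fun s => antisymmPart f s * sin s) s
      = antisymmPart f s * sin s / (1 - cos s) ^ 2 :=
  opT_opT ((contDiffAt_antisymmPart hs).mul contDiff_sin.contDiffAt)
    (antisymmPart_mul_sin_isBigO hs hf1) h

/-- The intensity where the spectral density vanishes to fourth order. -/
lemma linearLimit_of_eq_zero_of_iteratedDeriv_eq_zero (hf : IntervalIntegrable f volume (-π) π)
    (hs : ContDiffAt ℝ ∞ f 0) (hf0 : f 0 = 0) (hf1 : deriv f 0 = 0)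
    (hf2 : iteratedDeriv 2 f 0 = 0) (hI : opI (opT (symmPart f)) ≠ 0) :
    LinearLimit (fun r =>
      (((∫ s in (-π)..π, symmPart f s * ((1 - cos s) / circleDist r s ^ 2))
          * (∫ s in (-π)..π, symmPart f s * ((1 + cos s) / circleDist r s ^ 2))
        - (∫ s in (-π)..π, antisymmPart f s * (sin s / circleDist r s ^ 2)) ^ 2)
        / (∫ s in (-π)..π, symmPart f s * (circleDist r s)⁻¹) ^ 2))
      ((opI (opT (opT (symmPart f))) ^ 2 - opI (opT (opT fun s => symmPart f s * cos s)) ^ 2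
          - opI (opT (opT fun s => antisymmPart f s * sin s)) ^ 2)
        / (4 * opI (opT (symmPart f)) ^ 2)) := by
  have hπ := pi_pos
  have hU := isTameWeight_symmPart_of_eq_zero hf hs hf0 hf2
  have hUc := isTameWeight_symmPart_mul_cos hf hs hf0 hf2
  have iU : ∫ s in (-π)..π, symmPart f s / (1 - cos s) ^ 2 = 2 * π * opI (opT (opT (symmPart f))) := by
    rw [integral_eq_opI, opI_congr fun s h => opT_opT_symmPart hs hf0 hf2 h]
  have iUc : ∫ s in (-π)..π, symmPart f s * cos s / (1 - cos s) ^ 2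
      = 2 * π * opI (opT (opT fun s => symmPart f s * cos s)) := by
    rw [integral_eq_opI, opI_congr fun s h => opT_opT_symmPart_mul_cos hs hf0 hf2 h]
  have h0 := (isTameWeight_symmPart hf hs).linearLimit_integral_div
  rw [opI_opT_symmPart] at h0
  have h1 := (hU.mul_continuous (continuous_const.sub continuous_cos)
    (c := fun s => 1 - cos s)).linearLimit_integral_sq_div
  have h2 := (hU.mul_continuous (continuous_const.add continuous_cos)
    (c := fun s => 1 + cos s)).linearLimit_integral_sq_div
  have h3 := (isTameWeight_antisymmPart_of_eq_zero hf hs hf1).linearLimit_integral_sq_div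
  -- The weights with `1 - cos s` and `1 + cos s` give the difference and the sum of the same two
  -- quantities, whose product is the difference of squares in the limit.
  have i1 : ∫ s in (-π)..π, symmPart f s / (1 - cos s) ^ 2 * (1 - cos s)
      = 2 * π * opI (opT (opT (symmPart f)))
        - 2 * π * opI (opT (opT fun s => symmPart f s * cos s)) := by
    rw [← iU, ← iUc, ← intervalIntegral.integral_sub hU.intervalIntegrable hUc.intervalIntegrable]
    congr 1
    ext s
    ring
  have i2 : ∫ s in (-π)..π, symmPart f s / (1 - cos s) ^ 2 * (1 + cos s)
      = 2 * π * opI (opT (opT (symmPart f)))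
        + 2 * π * opI (opT (opT fun s => symmPart f s * cos s)) := by
    rw [← iU, ← iUc, ← intervalIntegral.integral_add hU.intervalIntegrable hUc.intervalIntegrable]
    congr 1
    ext s
    ring
  rw [i1] at h1
  rw [i2] at h2
  rw [integral_eq_opI, ← opI_congr fun s h => opT_opT_antisymmPart_mul_sin hs hf1 h] at h3
  have hne : 1 / 2 * (2 * π * opI (opT (symmPart f))) ≠ 0 := by positivity
  have key := ((h1.mul h2).sub (h3.pow 2)).div (h0.pow 2) (pow_ne_zero 2 hne)
  convert! key.congr' ?_ using 1
  · field_simp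
    ring
  · filter_upwards [eventually_mem_Ico_half_one] with r hr
    have hr0 : 0 < r := by linarith [hr.1]
    have hcancel : ∀ (q : ℝ → ℝ), q 0 = 0 → ∀ c : ℝ → ℝ,
        ∫ s in (-π)..π, q s / (1 - cos s) ^ 2 * c s * ((1 - cos s) ^ 2 / circleDist r s ^ 2)
          = ∫ s in (-π)..π, q s * (c s / circleDist r s ^ 2) := by
      intro q hq c
      refine intervalIntegral.integral_congr fun s hsm => ?_
      have := div_one_sub_cos_pow_mul hq 2 (c s / circleDist r s ^ 2) hsm
      rw [← this]
      ring
    rw [hcancel _ (by rw [symmPart_zero, hf0]), hcancel _ (by rw [symmPart_zero, hf0]),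
      integral_symmPart_circleDist hf hs hr0.le hr.2, integral_antisymmPart_sin hf hs hr0 hr.2,
      hf0, hf1]
    simp only [zero_mul, zero_add, sub_zero]

end Asymptotics

/-! ### The expansions of the first intensity -/

section Density

variable {f : ℝ → ℝ} {F : Measure ℝ} {φ : ℝ}

lemma IsDensityOnCircle.integral_eq_one [IsProbabilityMeasure F]
    (hf : IsDensityOnCircle f (rotatedMeasure F φ)) : ∫ s in (-π)..π, f s = 1 := by
  have h := integral_comp_sub_eq (E := ℝ) hf (Ψ := fun _ => 1) stronglyMeasurable_const
    (fun _ => rfl)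
  simpa using h.symm

/-- Since `1 - cos s ≤ 2`, the integrand dominates half the symmetrized density, whose integral is
1. -/
lemma IsDensityOnCircle.opI_opT_symmPart_pos [IsProbabilityMeasure F]
    (hf : IsDensityOnCircle f (rotatedMeasure F φ)) (hs : ContDiffAt ℝ ∞ f 0) (hf0 : f 0 = 0) :
    0 < opI (opT (symmPart f)) := by
  have hfi := hf.intervalIntegrable
  have hint : ∫ s in (-π)..π, symmPart f s = 1 := by
    have := integral_mul_eq_symmPart hfi (Ψ := fun _ => 1) continuous_const fun _ => rfl
    simp only [mul_one] at this
    rw [← this, hf.integral_eq_one]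
  have hle : ∫ s in (-π)..π, symmPart f s / 2
      ≤ ∫ s in (-π)..π, (symmPart f s - f 0) / (1 - cos s) := by
    refine intervalIntegral.integral_mono_on_of_le_Ioo (by linarith [pi_pos])
      ((intervalIntegrable_symmPart hfi).div_const 2) (isTameWeight_symmPart hfi hs).intervalIntegrable
      fun s hsm => ?_
    have hnn : 0 ≤ symmPart f s := by
      have h1 := hf.nonneg s ⟨hsm.1, hsm.2.le⟩
      have h2 := hf.nonneg (-s) ⟨by linarith [hsm.2], by linarith [hsm.1]⟩
      unfold symmPart
      positivity
    rcases eq_or_ne s 0 with rfl | hs0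
    · simp [symmPart_zero, hf0]
    · have hw := one_sub_cos_pos (abs_le.2 ⟨hsm.1.le, hsm.2.le⟩) hs0
      rw [hf0, sub_zero]
      exact div_le_div_of_nonneg_left hnn hw (by linarith [neg_one_le_cos s])
  rw [intervalIntegral.integral_div, hint, opI_opT_symmPart] at hle
  by_contra hneg
  have : 2 * π * opI (opT (symmPart f)) ≤ 0 :=
    mul_nonpos_of_nonneg_of_nonpos (by positivity) (not_lt.1 hneg)
  linarith

/-- A nonnegative density that vanishes at 0 has a local minimum there. -/
lemma IsDensityOnCircle.deriv_eq_zero {G : Measure ℝ} (hf : IsDensityOnCircle f G)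
    (hf0 : f 0 = 0) : deriv f 0 = 0 := by
  refine IsLocalMin.deriv_eq_zero ?_
  filter_upwards [Ioc_mem_nhds (neg_lt_zero.2 pi_pos) pi_pos] with s hs
  rw [hf0]
  exact hf.nonneg s hs

end Density

theorem theorem2p1 {Ω : Type*} [MeasurableSpace Ω] (P : Measure Ω) [IsProbabilityMeasure P]
    (ξ : ℤ → Ω → ℂ) (γ : ℤ → ℂ) (hξ : IsStationaryComplexGaussian ξ γ P)
    (F : Measure ℝ) (hF : IsSpectralMeasure F γ)
    (φ : ℝ) (f : ℝ → ℝ) (hf : IsDensityOnCircle f (rotatedMeasure F φ))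
    (hsmooth : ContDiffAt ℝ ∞ f 0) :
    ∃ ρ : ℂ → ℝ, IsFirstIntensity ξ P ρ ∧
      IntervalIntegrable (opT (symmPart f)) volume (-π) π ∧
      (0 < f 0 →
        (fun r : ℝ => ρ (r * Complex.exp (φ * Complex.I)) -
            (1 / (π * (1 - r ^ 2) ^ 2) -
              1 / (4 * π * f 0 ^ 2) * (deriv f 0 ^ 2 + opI (opT (symmPart f)) ^ 2)))
          =O[𝓝[<] 1] fun r : ℝ => 1 - r ^ 2) ∧
      (f 0 = 0 →
        0 < opI (opT (symmPart f)) ∧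
        (fun r : ℝ => ρ (r * Complex.exp (φ * Complex.I)) -
            1 / (π * (1 - r ^ 2)) * (iteratedDeriv 2 f 0 / (2 * opI (opT (symmPart f)))))
          =O[𝓝[<] 1] fun _ : ℝ => (1 : ℝ)) ∧
      (f 0 = 0 → iteratedDeriv 2 f 0 = 0 →
        IntervalIntegrable (opT (opT (symmPart f))) volume (-π) π ∧
        IntervalIntegrable (opT (opT fun s => symmPart f s * cos s)) volume (-π) π ∧
        IntervalIntegrable (opT (opT fun s => antisymmPart f s * sin s)) volume (-π) π ∧
        (fun r : ℝ => ρ (r * Complex.exp (φ * Complex.I)) -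
            1 / π * ((opI (opT (opT (symmPart f))) ^ 2
                - opI (opT (opT fun s => symmPart f s * cos s)) ^ 2
                - opI (opT (opT fun s => antisymmPart f s * sin s)) ^ 2)
              / (4 * opI (opT (symmPart f)) ^ 2)))
          =O[𝓝[<] 1] fun r : ℝ => 1 - r ^ 2) := by
  have := hF.isProbabilityMeasure
  have hfi := hf.intervalIntegrable
  have hπ := pi_pos
  refine ⟨zeroIntensity F, isFirstIntensity_zeroIntensity hξ hF,
    intervalIntegrable_opT_symmPart hfi hsmooth, fun hf0 => ?_, fun hf0 => ?_, fun hf0 hf2 => ?_⟩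
  · refine ((linearLimit_of_ne_zero hfi hsmooth hf0.ne').isBigO_one_sub_sq.const_mul_left
      π⁻¹).congr' ?_ EventuallyEq.rfl
    filter_upwards [eventually_mem_Ico_half_one] with r hr
    have hε : 1 - r ^ 2 ≠ 0 := by nlinarith [hr.1, hr.2]
    rw [zeroIntensity_ray hf (by linarith [hr.1]) hr.2, mul_sub, mul_sub]
    field_simp
    ring
  · have hI := hf.opI_opT_symmPart_pos hsmooth hf0
    refine ⟨hI, ?_⟩
    have h1 := linearLimit_of_eq_zero hfi hsmooth hf0 (hf.deriv_eq_zero hf0) hI.ne'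
    -- Dividing the limit of `(1 - r²) π ρ` by `1 - r²` costs exactly the linear rate, which leaves
    -- an error `O(1)`.
    have h2 : (fun r : ℝ => π⁻¹ * (1 - r ^ 2)⁻¹) =O[𝓝[<] 1] fun r => (1 - r)⁻¹ := by
      refine IsBigO.of_bound π⁻¹ ?_
      filter_upwards [eventually_mem_Ico_half_one] with r hr
      have h1r : 0 < 1 - r := by linarith [hr.2]
      have h2r : 1 - r ≤ 1 - r ^ 2 := by nlinarith [hr.1, hr.2]
      rw [norm_mul, Real.norm_of_nonneg (inv_nonneg.2 hπ.le),
        Real.norm_of_nonneg (inv_nonneg.2 (h1r.le.trans h2r)),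
        Real.norm_of_nonneg (inv_nonneg.2 h1r.le)]
      gcongr
    refine (IsBigO.mul h2 h1).congr' ?_ ?_
    · filter_upwards [eventually_mem_Ico_half_one] with r hr
      have hε : 1 - r ^ 2 ≠ 0 := by nlinarith [hr.1, hr.2]
      rw [zeroIntensity_ray hf (by linarith [hr.1]) hr.2, mul_sub, ← mul_assoc,
        inv_mul_cancel_right₀ hε, one_div, mul_inv]
    · filter_upwards [eventually_mem_Ico_half_one] with r hr
      exact inv_mul_cancel₀ (by linarith [hr.2])
  · have hf1 := hf.deriv_eq_zero hf0
    have hI := hf.opI_opT_symmPart_pos hsmooth hf0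
    refine ⟨(isTameWeight_symmPart_of_eq_zero hfi hsmooth hf0 hf2).intervalIntegrable_congr
        fun _ h => opT_opT_symmPart hsmooth hf0 hf2 h,
      (isTameWeight_symmPart_mul_cos hfi hsmooth hf0 hf2).intervalIntegrable_congr
        fun _ h => opT_opT_symmPart_mul_cos hsmooth hf0 hf2 h,
      (isTameWeight_antisymmPart_of_eq_zero hfi hsmooth hf1).intervalIntegrable_congr
        fun _ h => opT_opT_antisymmPart_mul_sin hsmooth hf1 h, ?_⟩
    refine ((linearLimit_of_eq_zero_of_iteratedDeriv_eq_zero hfi hsmooth hf0 hf1 hf2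
      hI.ne').isBigO_one_sub_sq.const_mul_left π⁻¹).congr' ?_ EventuallyEq.rfl
    filter_upwards [eventually_mem_Ico_half_one] with r hr
    rw [zeroIntensity_ray hf (by linarith [hr.1]) hr.2, mul_sub, one_div]


end
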